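/- **Proposition 8.4 (Dual space).** Let $\overline{\mathbb R}=[-\infty,\infty]$ with its usual compact topology and give $\overline{\mathbb R}^2$ the product topology. Let $\mathcal B_c(\overline{\mathbb R}^2)$ be the space of continuous $F:\overline{\mathbb R}^2\to\mathbb R$ with $F(-\infty,s)=F(s,-\infty)=0$ for all $s\in\overline{\mathbb R}$, with the uniform norm. Let $\mathcal A_c(\mathbb R^2)$ be the space of distributions $f\in\mathcal D'(\mathbb R^2)$ with $f=\partial_1\partial_2F$ for some (necessarily unique) $F\in\mathcal B_c(\overline{\mathbb R}^2)$, called the primitive of $f$, with the Alexiewicz norm $\|f\|=\|F\|_\infty$. For $g:\overline{\mathbb R}^2\to\mathbb R$ let $V_1g(\cdot,y)$ and $V_2g(x,\cdot)$ be the one-variable variations over $\overline{\mathbb R}$ with the other variable fixed, and let $V_{12}g=\sup\sum_i|g(a_i,c_i)+g(b_i,d_i)-g(a_i,d_i)-g(b_i,c_i)|$ be the Vitali variation, the supremum being over all divisions of $\overline{\mathbb R}^2$ into finitely many nonoverlapping intervals $[a_i,b_i]\times[c_i,d_i]$ with union $\overline{\mathbb R}^2$. Let $\mathcal{HKBV}(\overline{\mathbb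 R}^2)$ be the space of all $g$ with $V_{12}g<\infty$ and with $V_1g(\cdot,y_0)<\infty$, $V_2g(x_0,\cdot)<\infty$ for some $x_0,y_0\in\overline{\mathbb R}$, normed by $\|g\|_{bv}=\|g\|_\infty+\sup_yV_1g(\cdot,y)+\sup_xV_2g(x,\cdot)+V_{12}g$. Fix a normalisation: numbers $\alpha_{--},\alpha_{++},\alpha_{-+},\alpha_{+-}\in[0,1]$ with sum $1$ and, for each of the four edges $x=\pm\infty$, $y=\pm\infty$ of $\overline{\mathbb R}^2$, numbers $\beta_-,\beta_+\in[0,1]$ with sum $1$. The normalisation $\tilde g$ of $g\in\mathcal{HKBV}(\overline{\mathbb R}^2)$ is given at $(x,y)\in\mathbb R^2$ by $$\tilde g(x,y)=\alpha_{--}\,g(x-,y-)+\alpha_{++}\,g(x+,y+)+\alpha_{-+}\,g(x-,y+)+\alpha_{+-}\,g(x+,y-),$$ where $g(x\pm,y\pm)$ denote the limits of $g(s,t)$ with $s\to x\pm$, $t\to y\pm$; for $y\in\mathbb R$ by $\tilde g(\infty,y)=\beta_-\lim_{(s,t)\to(\infty,y-)}g(s,t)+\beta_+\lim_{(s,t)\to(\infty,y+)}g(s,t)$,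 similarly on the other three edges with the weights of that edge, and at each of the four corners by the limit of $g$ there (limits on the boundary being taken from inside $\mathbb R^2$). Let $\mathcal N$ be the normed subspace of all $g\in\mathcal{HKBV}(\overline{\mathbb R}^2)$ with $\tilde g=g$. For $f\in\mathcal A_c(\mathbb R^2)$ with primitive $F$ and $g\in\mathcal{HKBV}(\overline{\mathbb R}^2)$ the integral of $fg$ over $\overline{\mathbb R}^2$ is defined by integration by parts, $$\int_{-\infty}^\infty\int_{-\infty}^\infty fg=F(\infty,\infty)g(\infty,\infty)-\int_{-\infty}^\infty F(x,\infty)\,d_1g(x,\infty)-\int_{-\infty}^\infty F(\infty,y)\,d_2g(\infty,y)+\int_{-\infty}^\infty\int_{-\infty}^\infty F(x,y)\,d_{12}g(x,y),$$ with Henstock--Stieltjes integrals on the right. Then, for $f\in\mathcal A_c(\mathbb R^2)$ and $g\in\mathcal N$, all these integrals exist, and $g\mapsto\left(f\mapsto\int_{-\infty}^\infty\int_{-\infty}^\infty fg\right)$ is a linear homeomorphism of $(\mathcal N,\|\cdot\|_{bv})$ onto the space $\mathcal A_c(\mathbb R^2)'$ of all bounded linear functionals on $\mathcal A_c(\mathbb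 R^2)$ with the operator norm. In this sense the dual space of $\mathcal A_c(\mathbb R^2)$ is the normalised $\mathcal{HKBV}(\overline{\mathbb R}^2)$. -/

import Mathlib

open Filter Topology MeasureTheory
open scoped Distributions LineDeriv ENNReal

namespace ContPrim

noncomputable section

/-- The extended real plane `[-∞, ∞] × [-∞, ∞]`, with the product topology. -/
abbrev RBar2 : Type := EReal × EReal

/-- Continuous real functions on the extended real plane that vanish when one of the variables is
`-∞`; the norm is the uniform norm. -/
def Bc : Submodule ℝ C(RBar2, ℝ) where
  carrier := {F | ∀ s : EReal, F (⊥, s) = 0 ∧ F (s, ⊥) = 0}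
  zero_mem' := fun s => ⟨rfl, rfl⟩
  add_mem' := fun {F G} hF hG s => by simp [hF s, hG s]
  smul_mem' := fun c F hF s => by simp [hF s]

/-- The restriction to `ℝ²` of a function on the extended real plane. -/
def restrictPlane (F : C(RBar2, ℝ)) : ℝ × ℝ → ℝ := fun p => F ((p.1 : EReal), (p.2 : EReal))

theorem continuous_restrictPlane (F : C(RBar2, ℝ)) : Continuous (restrictPlane F) :=
  F.continuous.comp ((continuous_coe_real_ereal.comp continuous_fst).prodMk
    (continuous_coe_real_ereal.comp continuous_snd))

/-- The distribution `φ ↦ ∫ φ u` on `ℝ²` defined by a locally integrable function `u`. -/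
def toDistribution (u : ℝ × ℝ → ℝ) : 𝓓'((⊤ : TopologicalSpace.Opens (ℝ × ℝ)), ℝ) :=
  (TestFunction.integralAgainstBilinCLM (ContinuousLinearMap.mul ℝ ℝ) volume u :
    𝓓((⊤ : TopologicalSpace.Opens (ℝ × ℝ)), ℝ) →L[ℝ] ℝ)

theorem toDistribution_apply {u : ℝ × ℝ → ℝ} (hu : Continuous u)
    (φ : 𝓓((⊤ : TopologicalSpace.Opens (ℝ × ℝ)), ℝ)) :
    toDistribution u φ = ∫ p, φ p * u p :=
  TestFunction.integralAgainstBilinCLM_eq_integral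
    (hu.locallyIntegrable.locallyIntegrableOn _)

theorem integrable_mul_test {u : ℝ × ℝ → ℝ} (hu : Continuous u)
    (φ : 𝓓((⊤ : TopologicalSpace.Opens (ℝ × ℝ)), ℝ)) :
    Integrable (fun p => φ p * u p) :=
  TestFunction.integrable_bilin (ContinuousLinearMap.mul ℝ ℝ)
    (hu.locallyIntegrable.locallyIntegrableOn _) φ

/-- The distributional derivative `∂₁₂ F = ∂₁ ∂₂ F` on `ℝ²`. -/
def mixedDeriv : Bc →ₗ[ℝ] 𝓓'((⊤ : TopologicalSpace.Opens (ℝ × ℝ)), ℝ) where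
  toFun F := ∂_{((1 : ℝ), (0 : ℝ))} (∂_{((0 : ℝ), (1 : ℝ))} (toDistribution (restrictPlane F.1)))
  map_add' F G := by
    have h : toDistribution (restrictPlane (F + G).1) =
        toDistribution (restrictPlane F.1) + toDistribution (restrictPlane G.1) := by
      ext φ
      change _ = toDistribution (restrictPlane F.1) φ + toDistribution (restrictPlane G.1) φ
      simp only [toDistribution_apply (continuous_restrictPlane _)]
      rw [← integral_add (integrable_mul_test (continuous_restrictPlane _) φ)
        (integrable_mul_test (continuous_restrictPlane _) φ)]
      congr 1
      ext p
      exact mul_add _ _ _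
    rw [h, LineDerivAdd.lineDerivOp_add, LineDerivAdd.lineDerivOp_add]
  map_smul' c F := by
    have h : toDistribution (restrictPlane (c • F).1) =
        c • toDistribution (restrictPlane F.1) := by
      ext φ
      change _ = c • toDistribution (restrictPlane F.1) φ
      simp only [toDistribution_apply (continuous_restrictPlane _)]
      rw [← integral_smul]
      congr 1
      ext p
      exact mul_left_comm _ _ _
    rw [h, LineDerivSMul.lineDerivOp_smul, LineDerivSMul.lineDerivOp_smul, RingHom.id_apply]

/-- The test function `t ↦ ψ (p - t)`. -/
def reflTest (ψ : ℝ × ℝ → ℝ) (h1 : ContDiff ℝ ((⊤ : ℕ∞) : WithTop ℕ∞) ψ)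
    (h2 : HasCompactSupport ψ) (p : ℝ × ℝ) : 𝓓((⊤ : TopologicalSpace.Opens (ℝ × ℝ)), ℝ) where
  toFun t := ψ (p - t)
  contDiff' := h1.comp (contDiff_const.sub contDiff_id)
  hasCompactSupport' := h2.comp_homeomorph (Homeomorph.subLeft p)
  tsupport_subset' := fun _ _ => trivial

theorem contDiff_dir {ψ : ℝ × ℝ → ℝ} (h1 : ContDiff ℝ ((⊤ : ℕ∞) : WithTop ℕ∞) ψ) (v : ℝ × ℝ) :
    ContDiff ℝ ((⊤ : ℕ∞) : WithTop ℕ∞) (fun t => fderiv ℝ ψ t v) :=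
  (h1.fderiv_right (by simp)).clm_apply contDiff_const

theorem hasCompactSupport_dir {ψ : ℝ × ℝ → ℝ} (h2 : HasCompactSupport ψ) (v : ℝ × ℝ) :
    HasCompactSupport (fun t => fderiv ℝ ψ t v) :=
  h2.fderiv_apply ℝ v

theorem lineDeriv_reflTest {ψ : ℝ × ℝ → ℝ} (h1 : ContDiff ℝ ((⊤ : ℕ∞) : WithTop ℕ∞) ψ)
    (h2 : HasCompactSupport ψ) (p v : ℝ × ℝ) :
    ∂_{v} (reflTest ψ h1 h2 p) =
      - reflTest _ (contDiff_dir h1 v) (hasCompactSupport_dir h2 v) p := by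
  ext t
  have hd : HasFDerivAt (fun t => ψ (p - t))
      ((fderiv ℝ ψ (p - t)).comp (-(ContinuousLinearMap.id ℝ (ℝ × ℝ)))) t := by
    refine HasFDerivAt.comp t (h1.differentiable (by simp) (p - t)).hasFDerivAt ?_
    simpa using (hasFDerivAt_id (𝕜 := ℝ) t).const_sub p
  have h3 : (∂_{v} (reflTest ψ h1 h2 p)) t = fderiv ℝ (fun t => ψ (p - t)) t v := by
    rw [TestFunction.lineDerivOp_eq_lineDerivCLM (𝕜 := ℝ),
      TestFunction.lineDerivCLM_apply_of_le (by simp)]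
    exact hd.differentiableAt.lineDeriv_eq_fderiv
  rw [h3, hd.fderiv]
  change fderiv ℝ ψ (p - t) (-v) = - fderiv ℝ ψ (p - t) v
  exact map_neg _ _

theorem conv_zero {u : ℝ × ℝ → ℝ} (hu : Continuous u)
    (h : ∂_{((1 : ℝ), (0 : ℝ))} (∂_{((0 : ℝ), (1 : ℝ))} (toDistribution u)) = 0)
    {ψ : ℝ × ℝ → ℝ} (h1 : ContDiff ℝ ((⊤ : ℕ∞) : WithTop ℕ∞) ψ)
    (h2 : HasCompactSupport ψ) (p : ℝ × ℝ) :
    ∫ t, u t * fderiv ℝ (fun s => fderiv ℝ ψ s (1, 0)) (p - t) (0, 1) = 0 := by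
  have h3 := congrArg (fun T => T (reflTest ψ h1 h2 p)) h
  simp only [Distribution.lineDerivOp_apply_apply] at h3
  rw [lineDeriv_reflTest, neg_neg, lineDeriv_reflTest, neg_neg, toDistribution_apply hu] at h3
  refine Eq.trans (integral_congr_ae (Eventually.of_forall fun t => ?_)) h3
  exact mul_comm (u t) _

/-- Derivative of a convolution along a direction. -/
theorem hasDerivAt_conv {u : ℝ × ℝ → ℝ} (hu : Continuous u)
    {ψ : ℝ × ℝ → ℝ} (h1 : ContDiff ℝ ((⊤ : ℕ∞) : WithTop ℕ∞) ψ)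
    (h2 : HasCompactSupport ψ) (p : ℝ × ℝ) :
    HasFDerivAt (fun p => ∫ t, u t * ψ (p - t))
      ((convolution u (fderiv ℝ ψ)
        ((ContinuousLinearMap.mul ℝ ℝ).precompR (ℝ × ℝ)) volume p)) p ∧
    ∀ v, (convolution u (fderiv ℝ ψ)
        ((ContinuousLinearMap.mul ℝ ℝ).precompR (ℝ × ℝ)) volume p) v =
      ∫ t, u t * fderiv ℝ ψ (p - t) v := by
  refine ⟨h2.hasFDerivAt_convolution_right (ContinuousLinearMap.mul ℝ ℝ) hu.locallyIntegrable
    (h1.of_le (by simp)) p, fun v => ?_⟩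
  rw [convolution_precompR_apply (ContinuousLinearMap.mul ℝ ℝ) hu.locallyIntegrable
    (h2.fderiv ℝ) (h1.continuous_fderiv (by simp))]
  rfl

theorem conv_rect {u : ℝ × ℝ → ℝ} (hu : Continuous u)
    (h : ∂_{((1 : ℝ), (0 : ℝ))} (∂_{((0 : ℝ), (1 : ℝ))} (toDistribution u)) = 0)
    {ψ : ℝ × ℝ → ℝ} (h1 : ContDiff ℝ ((⊤ : ℕ∞) : WithTop ℕ∞) ψ)
    (h2 : HasCompactSupport ψ) (a b c d : ℝ) :
    (∫ t, u t * ψ ((b, d) - t)) - (∫ t, u t * ψ ((a, d) - t)) =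
      (∫ t, u t * ψ ((b, c) - t)) - (∫ t, u t * ψ ((a, c) - t)) := by
  have hc : ∀ x y y' : ℝ, (∫ t, u t * fderiv ℝ ψ ((x, y) - t) (1, 0)) =
      ∫ t, u t * fderiv ℝ ψ ((x, y') - t) (1, 0) := by
    intro x y y'
    have hd : ∀ y : ℝ, HasDerivAt
        (fun y : ℝ => ∫ t, u t * fderiv ℝ ψ ((x, y) - t) (1, 0)) 0 y := by
      intro y
      obtain ⟨e1, e2⟩ := hasDerivAt_conv hu (contDiff_dir h1 (1, 0))
        (hasCompactSupport_dir h2 (1, 0)) (x, y)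
      have := e1.comp_hasDerivAt y ((hasDerivAt_const y x).prodMk (hasDerivAt_id y))
      rw [e2, conv_zero hu h h1 h2] at this
      exact this
    exact is_const_of_deriv_eq_zero (fun y => (hd y).differentiableAt) (fun y => (hd y).deriv) y y'
  have hd : ∀ x : ℝ, HasDerivAt
      (fun x : ℝ => (∫ t, u t * ψ ((x, d) - t)) - ∫ t, u t * ψ ((x, c) - t)) 0 x := by
    intro x
    have key : ∀ y : ℝ, HasDerivAt (fun x : ℝ => ∫ t, u t * ψ ((x, y) - t))
        (∫ t, u t * fderiv ℝ ψ ((x, y) - t) (1, 0)) x := by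
      intro y
      obtain ⟨e1, e2⟩ := hasDerivAt_conv hu h1 h2 (x, y)
      have := e1.comp_hasDerivAt x ((hasDerivAt_id x).prodMk (hasDerivAt_const x y))
      rw [e2] at this
      exact this
    have := (key d).sub (key c)
    rw [hc x d c, sub_self] at this
    exact this
  have := is_const_of_deriv_eq_zero (fun y => (hd y).differentiableAt) (fun y => (hd y).deriv) b a
  linarith [this]

theorem rect_eq {u : ℝ × ℝ → ℝ} (hu : Continuous u)
    (h : ∂_{((1 : ℝ), (0 : ℝ))} (∂_{((0 : ℝ), (1 : ℝ))} (toDistribution u)) = 0)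
    (a b c d : ℝ) : u (b, d) - u (a, d) = u (b, c) - u (a, c) := by
  let ψ : ℕ → ContDiffBump (0 : ℝ × ℝ) := fun n =>
    { rIn := 1 / (n + 1) / 2
      rOut := 1 / (n + 1)
      rIn_pos := by positivity
      rIn_lt_rOut := half_lt_self (by positivity) }
  have ht : ∀ p : ℝ × ℝ, Tendsto (fun n => ∫ t, u t * (ψ n).normed volume (p - t)) atTop
      (𝓝 (u p)) := by
    intro p
    have := ContDiffBump.convolution_tendsto_right_of_continuous (μ := volume) (φ := ψ)
      (l := atTop) (tendsto_one_div_add_atTop_nhds_zero_nat) hu p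
    refine this.congr fun n => ?_
    rw [← convolution_flip]
    refine integral_congr_ae (Eventually.of_forall fun t => ?_)
    exact mul_comm ((ψ n).normed volume (p - t)) (u t)
  refine tendsto_nhds_unique ((ht (b, d)).sub (ht (a, d))) ?_
  refine ((ht (b, c)).sub (ht (a, c))).congr fun n => ?_
  exact (conv_rect hu h (ψ n).contDiff_normed (ψ n).hasCompactSupport_normed a b c d).symm

theorem denseRange_coe_ereal : DenseRange (fun x : ℝ => (x : EReal)) := by
  rw [DenseRange, dense_iff_exists_between]
  intro a b hab
  obtain ⟨q, h1, h2⟩ := EReal.exists_rat_btwn_of_lt hab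
  exact ⟨_, ⟨(q : ℝ), rfl⟩, h1, h2⟩

/-- Primitives are unique. -/
theorem mixedDeriv_injective : Function.Injective mixedDeriv := by
  rw [← LinearMap.ker_eq_bot, LinearMap.ker_eq_bot']
  intro F hF
  have hr := rect_eq (continuous_restrictPlane F.1) hF
  have hdense : DenseRange (fun p : ℝ × ℝ => ((p.1 : EReal), (p.2 : EReal))) :=
    denseRange_coe_ereal.prodMap denseRange_coe_ereal
  have hbot : Tendsto (fun x : ℝ => (x : EReal)) atBot (𝓝 ⊥) := EReal.tendsto_coe_nhds_bot_iff.2 tendsto_id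
  have key : ∀ b d : ℝ, F.1 ((b : EReal), (d : EReal)) = 0 := by
    intro b d
    have e1 : ∀ c : ℝ, F.1 ((b : EReal), (d : EReal)) = F.1 ((b : EReal), (c : EReal)) := by
      intro c
      have t1 : Tendsto (fun a : ℝ => F.1 ((b : EReal), (d : EReal)) - F.1 ((a : EReal), (d : EReal)))
          atBot (𝓝 (F.1 ((b : EReal), (d : EReal)) - F.1 (⊥, (d : EReal)))) :=
        tendsto_const_nhds.sub ((F.1.continuous.tendsto _).comp (hbot.prodMk_nhds tendsto_const_nhds))
      have t2 : Tendsto (fun a : ℝ => F.1 ((b : EReal), (c : EReal)) - F.1 ((a : EReal), (c : EReal)))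
          atBot (𝓝 (F.1 ((b : EReal), (c : EReal)) - F.1 (⊥, (c : EReal)))) :=
        tendsto_const_nhds.sub ((F.1.continuous.tendsto _).comp (hbot.prodMk_nhds tendsto_const_nhds))
      have := tendsto_nhds_unique t1 (t2.congr fun a => (hr a b c d).symm)
      simpa [(F.2 _).1] using this
    have t3 : Tendsto (fun c : ℝ => F.1 ((b : EReal), (c : EReal))) atBot
        (𝓝 (F.1 ((b : EReal), ⊥))) :=
      (F.1.continuous.tendsto _).comp (tendsto_const_nhds.prodMk_nhds hbot)
    rw [(F.2 _).2] at t3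
    exact tendsto_nhds_unique (tendsto_const_nhds.congr e1) t3
  apply Subtype.ext
  apply ContinuousMap.coe_injective
  exact hdense.equalizer F.1.continuous continuous_const (funext fun p => key p.1 p.2)

/-- The distributions `f` on `ℝ²` such that `f = ∂₁₂ F` for some `F` in `Bc`. -/
def AcSubmodule : Submodule ℝ 𝓓'((⊤ : TopologicalSpace.Opens (ℝ × ℝ)), ℝ) :=
  LinearMap.range mixedDeriv

/-- The space of distributions that are integrable in the sense of the continuous primitive integral.
It is a separate type because its topology is that of the Alexiewicz norm and not the one of
distributions. -/
def Ac : Type := AcSubmodule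

instance : AddCommGroup Ac := inferInstanceAs (AddCommGroup AcSubmodule)
instance : Module ℝ Ac := inferInstanceAs (Module ℝ AcSubmodule)

/-- The unique primitive in `Bc` of an integrable distribution. -/
def primitive : Ac ≃ₗ[ℝ] Bc := (LinearEquiv.ofInjective mixedDeriv mixedDeriv_injective).symm

/-- The Alexiewicz norm: `‖f‖ = ‖F‖_∞`, where `F` is the primitive of `f`. -/
instance : NormedAddCommGroup Ac := NormedAddCommGroup.induced Ac Bc primitive primitive.injective
instance : NormedSpace ℝ Ac := NormedSpace.induced ℝ Ac Bc primitive

theorem Ac.norm_eq (f : Ac) : ‖f‖ = ‖primitive f‖ := rfl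

theorem Ac.mixedDeriv_primitive (f : Ac) : mixedDeriv (primitive f) = f.1 :=
  congrArg Subtype.val ((LinearEquiv.ofInjective mixedDeriv mixedDeriv_injective).apply_symm_apply f)

/-- Two intervals are nonoverlapping if their interiors are disjoint. For intervals of the extended
real line or plane this says that the intersection has Lebesgue measure zero. -/
def Nonoverlapping {α : Type*} [TopologicalSpace α] [PartialOrder α]
    (I J : NonemptyInterval α) : Prop :=
  Disjoint (interior (I : Set α)) (interior (J : Set α))

/-- A division of the interval `I`: finitely many pairwise nonoverlapping intervals with union `I`.
An interval of the extended real plane is a `NonemptyInterval RBar2` for the product order: the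
interval from `(a, c)` to `(b, d)` is `[a, b] × [c, d]`. -/
def IsDivision {α : Type*} [TopologicalSpace α] [PartialOrder α]
    (I : NonemptyInterval α) (D : Finset (NonemptyInterval α)) : Prop :=
  (D : Set (NonemptyInterval α)).Pairwise Nonoverlapping ∧
    (⋃ J ∈ D, (J : Set α)) = (I : Set α)

/-- The increment `g(a,c) + g(b,d) - g(a,d) - g(b,c)` of `g` over `[a, b] × [c, d]`. -/
def inc₂ (g : RBar2 → ℝ) (J : NonemptyInterval RBar2) : ℝ :=
  g (J.fst.1, J.fst.2) + g (J.snd.1, J.snd.2) - g (J.fst.1, J.snd.2) - g (J.snd.1, J.fst.2)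

/-- The variation of `g` in the first variable, the second variable being fixed as `y`. -/
def V₁ (g : RBar2 → ℝ) (y : EReal) : ℝ≥0∞ := eVariationOn (fun x => g (x, y)) Set.univ
/-- The variation of `g` in the second variable, the first variable being fixed as `x`. -/
def V₂ (g : RBar2 → ℝ) (x : EReal) : ℝ≥0∞ := eVariationOn (fun y => g (x, y)) Set.univ

/-- The Vitali variation: the supremum of `∑ |inc₂ g J|` over all divisions of the extended real
plane. -/
def V₁₂ (g : RBar2 → ℝ) : ℝ≥0∞ :=
  ⨆ (D : Finset (NonemptyInterval RBar2)) (_ : IsDivision ⊤ D), ∑ J ∈ D, ‖inc₂ g J‖ₑ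

/-- Finite Hardy-Krause variation. -/
def IsHKBV (g : RBar2 → ℝ) : Prop :=
  V₁₂ g < ∞ ∧ ∃ x₀ y₀ : EReal, V₁ g y₀ < ∞ ∧ V₂ g x₀ < ∞

/-- `‖g‖_bv = ‖g‖_∞ + ‖V₁ g‖_∞ + ‖V₂ g‖_∞ + V₁₂ g`, with values in `[0, ∞]`. -/
def hkENorm (g : RBar2 → ℝ) : ℝ≥0∞ :=
  (⨆ p, ‖g p‖ₑ) + (⨆ y, V₁ g y) + (⨆ x, V₂ g x) + V₁₂ g

theorem disjoint_interior_Icc {a b c d : EReal} (h : b ≤ c) :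
    Disjoint (interior (Set.Icc a b)) (interior (Set.Icc c d)) := by
  rw [Set.disjoint_iff_inter_eq_empty, ← interior_inter, ← Set.subset_empty_iff,
    ← interior_singleton b]
  exact interior_mono fun x hx => le_antisymm hx.1.2 (h.trans hx.2.1)

/-- The rectangle `[u i, u (i + 1)] × [v j, v (j + 1)]`. -/
def cell {u v : ℕ → EReal} (hu : Monotone u) (hv : Monotone v) (q : ℕ × ℕ) :
    NonemptyInterval RBar2 :=
  ⟨((u q.1, v q.2), (u (q.1 + 1), v (q.2 + 1))), hu q.1.le_succ, hv q.2.le_succ⟩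

theorem coe_cell {u v : ℕ → EReal} (hu : Monotone u) (hv : Monotone v) (q : ℕ × ℕ) :
    (cell hu hv q : Set RBar2) =
      Set.Icc (u q.1) (u (q.1 + 1)) ×ˢ Set.Icc (v q.2) (v (q.2 + 1)) :=
  (Set.Icc_prod_Icc _ _ _ _).symm

theorem nonoverlapping_cell {u v : ℕ → EReal} (hu : Monotone u) (hv : Monotone v)
    {q r : ℕ × ℕ} (h : q ≠ r) : Nonoverlapping (cell hu hv q) (cell hu hv r) := by
  unfold Nonoverlapping
  rw [coe_cell, coe_cell, interior_prod_eq, interior_prod_eq, Set.disjoint_prod]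
  by_cases h1 : q.1 = r.1
  · have h2 : q.2 ≠ r.2 := fun h2 => h (Prod.ext h1 h2)
    right
    rcases lt_or_gt_of_ne h2 with h3 | h3
    · exact disjoint_interior_Icc (hv h3)
    · exact (disjoint_interior_Icc (hv h3)).symm
  · left
    rcases lt_or_gt_of_ne h1 with h3 | h3
    · exact disjoint_interior_Icc (hu h3)
    · exact (disjoint_interior_Icc (hu h3)).symm

theorem exists_cell {u : ℕ → EReal} {n : ℕ} (h0 : u 0 = ⊥) (hn : u (n + 1) = ⊤) (x : EReal) :
    ∃ i ∈ Finset.range (n + 1), x ∈ Set.Icc (u i) (u (i + 1)) := by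
  classical
  by_contra hcon
  push Not at hcon
  have : ∀ i ≤ n + 1, u i ≤ x := by
    intro i
    induction i with
    | zero => intro _; rw [h0]; exact bot_le
    | succ i ih =>
      intro hi
      by_contra hlt
      exact hcon i (Finset.mem_range.2 hi) ⟨ih (by omega), (not_le.1 hlt).le⟩
  exact hcon n (by simp) ⟨this n (by omega), hn ▸ le_top⟩

/-- The sum of the increments over a rectangular grid is at most the Vitali variation. -/
theorem sum_cell_le (g : RBar2 → ℝ) {u v : ℕ → EReal} (hu : Monotone u) (hv : Monotone v)
    {n m : ℕ} (hu0 : u 0 = ⊥) (hun : u (n + 1) = ⊤) (hv0 : v 0 = ⊥) (hvm : v (m + 1) = ⊤) :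
    ∑ q ∈ Finset.range (n + 1) ×ˢ Finset.range (m + 1), ‖inc₂ g (cell hu hv q)‖ₑ ≤ V₁₂ g := by
  classical
  rw [← Finset.sum_image_of_pairwise_eq_zero (f := cell hu hv) (g := fun J => ‖inc₂ g J‖ₑ)]
  · refine le_iSup₂_of_le (f := fun (D : Finset (NonemptyInterval RBar2))
      (_ : IsDivision ⊤ D) => ∑ J ∈ D, ‖inc₂ g J‖ₑ) _ ⟨?_, ?_⟩ le_rfl
    · intro J hJ K hK hne
      simp only [Finset.coe_image, Set.mem_image] at hJ hK
      obtain ⟨q, -, rfl⟩ := hJ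
      obtain ⟨r, -, rfl⟩ := hK
      exact nonoverlapping_cell hu hv fun h => hne (h ▸ rfl)
    · rw [Set.eq_univ_of_forall (s := ((⊤ : NonemptyInterval RBar2) : Set RBar2))
        (fun p => ⟨bot_le, le_top⟩), Set.eq_univ_iff_forall]
      rintro ⟨x, y⟩
      obtain ⟨i, hi, hx⟩ := exists_cell hu0 hun x
      obtain ⟨j, hj, hy⟩ := exists_cell hv0 hvm y
      refine Set.mem_iUnion₂.2 ⟨cell hu hv (i, j),
        Finset.mem_image_of_mem _ (Finset.mem_product.2 ⟨hi, hj⟩), ?_⟩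
      rw [coe_cell]
      exact ⟨hx, hy⟩
  · intro q _ r _ hne he
    have h1 : u q.1 = u r.1 := congrArg (fun J : NonemptyInterval RBar2 => J.fst.1) he
    have h2 : v q.2 = v r.2 := congrArg (fun J : NonemptyInterval RBar2 => J.fst.2) he
    have h3 : u (q.1 + 1) = u (r.1 + 1) :=
      congrArg (fun J : NonemptyInterval RBar2 => J.snd.1) he
    have h4 : v (q.2 + 1) = v (r.2 + 1) :=
      congrArg (fun J : NonemptyInterval RBar2 => J.snd.2) he
    have h5 : u q.1 = u (q.1 + 1) ∨ v q.2 = v (q.2 + 1) := by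
      by_cases h6 : q.1 = r.1
      · have h7 : q.2 ≠ r.2 := fun h7 => hne (Prod.ext h6 h7)
        right
        rcases lt_or_gt_of_ne h7 with h8 | h8
        · exact le_antisymm (hv q.2.le_succ) (h2 ▸ hv h8)
        · exact le_antisymm (hv q.2.le_succ) (h4.trans_le (hv h8))
      · left
        rcases lt_or_gt_of_ne h6 with h8 | h8
        · exact le_antisymm (hu q.1.le_succ) (h1 ▸ hu h8)
        · exact le_antisymm (hu q.1.le_succ) (h3.trans_le (hu h8))
    have h6 : inc₂ g (cell hu hv q) = 0 := by
      simp only [inc₂, cell]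
      rcases h5 with h | h
      · rw [← h]; ring
      · rw [← h]; ring
    simp [h6]

/-- Extension of a sequence by `⊥` at the beginning and by `⊤` at the end. -/
def extendSeq (u : ℕ → EReal) (n : ℕ) : ℕ → EReal
  | 0 => ⊥
  | k + 1 => if k ≤ n then u k else ⊤

theorem monotone_extendSeq {u : ℕ → EReal} (hu : Monotone u) (n : ℕ) :
    Monotone (extendSeq u n) := by
  refine monotone_nat_of_le_succ fun k => ?_
  cases k with
  | zero => exact bot_le
  | succ k =>
    simp only [extendSeq]
    split_ifs
    · exact hu k.le_succ
    · exact le_top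
    · omega
    · exact le_rfl

/-- The two-term monotone sequence `min y z, max y z, max y z, …`. -/
def pairSeq (y z : EReal) : ℕ → EReal
  | 0 => min y z
  | _ + 1 => max y z

theorem monotone_pairSeq (y z : EReal) : Monotone (pairSeq y z) := by
  refine monotone_nat_of_le_succ fun k => ?_
  cases k with
  | zero => exact min_le_max
  | succ k => exact le_rfl

/-- Finiteness of `V₁ g z` for one `z` gives finiteness for all of them. -/
theorem V₁_le (g : RBar2 → ℝ) (y z : EReal) : V₁ g y ≤ V₁ g z + V₁₂ g := by
  refine iSup_le fun ⟨n, u, hu, _⟩ => ?_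
  have h1 := sum_cell_le g (monotone_extendSeq hu n) (monotone_extendSeq (monotone_pairSeq y z) 1)
    (n := n + 1) (m := 2) rfl (by simp [extendSeq]) rfl (by simp [extendSeq])
  have h2 : ∑ i ∈ Finset.range n, edist (g (u (i + 1), z)) (g (u i, z)) ≤ V₁ g z :=
    eVariationOn.sum_le (f := fun x => g (x, z)) hu (fun i => Set.mem_univ _)
  refine le_trans ?_ (add_le_add h2 h1)
  have h3 : ∑ i ∈ Finset.range n, ‖inc₂ g (cell (monotone_extendSeq hu n)
      (monotone_extendSeq (monotone_pairSeq y z) 1) (i + 1, 1))‖ₑ ≤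
      ∑ q ∈ Finset.range (n + 1 + 1) ×ˢ Finset.range (2 + 1), ‖inc₂ g (cell
        (monotone_extendSeq hu n) (monotone_extendSeq (monotone_pairSeq y z) 1) q)‖ₑ := by
    classical
    rw [← Finset.sum_image (s := Finset.range n) (g := fun i : ℕ => ((i + 1, 1) : ℕ × ℕ))
      (f := fun q => ‖inc₂ g (cell (monotone_extendSeq hu n)
        (monotone_extendSeq (monotone_pairSeq y z) 1) q)‖ₑ) (by intro i _ j _ h; simpa using h)]
    refine Finset.sum_le_sum_of_subset ?_
    intro q hq
    obtain ⟨i, hi, rfl⟩ := Finset.mem_image.1 hq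
    simp only [Finset.mem_product, Finset.mem_range] at hi ⊢
    omega
  refine le_trans ?_ (add_le_add_right h3 _)
  rw [← Finset.sum_add_distrib]
  refine Finset.sum_le_sum fun i hi => ?_
  have hi' := Finset.mem_range.1 hi
  rw [edist_eq_enorm_sub, edist_eq_enorm_sub]
  have e1 : extendSeq u n (i + 1) = u i := by simp [extendSeq, hi'.le]
  have e2 : extendSeq u n (i + 1 + 1) = u (i + 1) := by
    simp only [extendSeq]; rw [if_pos (by omega)]
  have e3 : extendSeq (pairSeq y z) 1 1 = min y z := by simp [extendSeq, pairSeq]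
  have e4 : extendSeq (pairSeq y z) 1 (1 + 1) = max y z := by simp [extendSeq, pairSeq]
  simp only [inc₂, cell, e1, e2, e3, e4]
  rcases le_total y z with h | h
  · rw [min_eq_left h, max_eq_right h]
    refine le_trans (le_of_eq ?_) (enorm_sub_le (a := g (u (i + 1), z) - g (u i, z)))
    congr 1; ring
  · rw [min_eq_right h, max_eq_left h]
    refine le_trans (le_of_eq ?_) (enorm_add_le _ _)
    congr 1; ring

theorem V₂_le (g : RBar2 → ℝ) (x z : EReal) : V₂ g x ≤ V₂ g z + V₁₂ g := by
  refine iSup_le fun ⟨n, u, hu, _⟩ => ?_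
  have h1 := sum_cell_le g (monotone_extendSeq (monotone_pairSeq x z) 1) (monotone_extendSeq hu n)
    (n := 2) (m := n + 1) rfl (by simp [extendSeq]) rfl (by simp [extendSeq])
  have h2 : ∑ i ∈ Finset.range n, edist (g (z, u (i + 1))) (g (z, u i)) ≤ V₂ g z :=
    eVariationOn.sum_le (f := fun y => g (z, y)) hu (fun i => Set.mem_univ _)
  refine le_trans ?_ (add_le_add h2 h1)
  have h3 : ∑ i ∈ Finset.range n, ‖inc₂ g (cell (monotone_extendSeq (monotone_pairSeq x z) 1)
      (monotone_extendSeq hu n) (1, i + 1))‖ₑ ≤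
      ∑ q ∈ Finset.range (2 + 1) ×ˢ Finset.range (n + 1 + 1), ‖inc₂ g (cell
        (monotone_extendSeq (monotone_pairSeq x z) 1) (monotone_extendSeq hu n) q)‖ₑ := by
    classical
    rw [← Finset.sum_image (s := Finset.range n) (g := fun i : ℕ => ((1, i + 1) : ℕ × ℕ))
      (f := fun q => ‖inc₂ g (cell (monotone_extendSeq (monotone_pairSeq x z) 1)
        (monotone_extendSeq hu n) q)‖ₑ) (by intro i _ j _ h; simpa using h)]
    refine Finset.sum_le_sum_of_subset ?_
    intro q hq
    obtain ⟨i, hi, rfl⟩ := Finset.mem_image.1 hq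
    simp only [Finset.mem_product, Finset.mem_range] at hi ⊢
    omega
  refine le_trans ?_ (add_le_add_right h3 _)
  rw [← Finset.sum_add_distrib]
  refine Finset.sum_le_sum fun i hi => ?_
  have hi' := Finset.mem_range.1 hi
  rw [edist_eq_enorm_sub, edist_eq_enorm_sub]
  have e1 : extendSeq u n (i + 1) = u i := by simp [extendSeq, hi'.le]
  have e2 : extendSeq u n (i + 1 + 1) = u (i + 1) := by
    simp only [extendSeq]; rw [if_pos (by omega)]
  have e3 : extendSeq (pairSeq x z) 1 1 = min x z := by simp [extendSeq, pairSeq]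
  have e4 : extendSeq (pairSeq x z) 1 (1 + 1) = max x z := by simp [extendSeq, pairSeq]
  simp only [inc₂, cell, e1, e2, e3, e4]
  rcases le_total x z with h | h
  · rw [min_eq_left h, max_eq_right h]
    refine le_trans (le_of_eq ?_) (enorm_sub_le (a := g (z, u (i + 1)) - g (z, u i)))
    congr 1; ring
  · rw [min_eq_right h, max_eq_left h]
    refine le_trans (le_of_eq ?_) (enorm_add_le _ _)
    congr 1; ring

/-- A function of finite Hardy-Krause variation has finite norm. -/
theorem IsHKBV.hkENorm_lt_top {g : RBar2 → ℝ} (hg : IsHKBV g) : hkENorm g < ∞ := by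
  obtain ⟨h12, x₀, y₀, h1, h2⟩ := hg
  have b1 : (⨆ y, V₁ g y) < ∞ :=
    (iSup_le fun y => V₁_le g y y₀).trans_lt (ENNReal.add_lt_top.2 ⟨h1, h12⟩)
  have b2 : (⨆ x, V₂ g x) < ∞ :=
    (iSup_le fun x => V₂_le g x x₀).trans_lt (ENNReal.add_lt_top.2 ⟨h2, h12⟩)
  have b0 : (⨆ p, ‖g p‖ₑ) ≤ ‖g (x₀, y₀)‖ₑ + V₁ g y₀ + ⨆ x, V₂ g x := by
    refine iSup_le fun ⟨x, y⟩ => ?_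
    have e1 : edist (g (x, y)) (g (x, y₀)) ≤ ⨆ x, V₂ g x :=
      (eVariationOn.edist_le (fun y => g (x, y)) (Set.mem_univ y) (Set.mem_univ y₀)).trans
        (le_iSup (V₂ g) x)
    have e2 : edist (g (x, y₀)) (g (x₀, y₀)) ≤ V₁ g y₀ :=
      eVariationOn.edist_le (fun x => g (x, y₀)) (Set.mem_univ x) (Set.mem_univ x₀)
    rw [edist_eq_enorm_sub] at e1 e2
    calc ‖g (x, y)‖ₑ = ‖g (x₀, y₀) + (g (x, y₀) - g (x₀, y₀)) + (g (x, y) - g (x, y₀))‖ₑ := by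
          congr 1; ring
      _ ≤ _ := (enorm_add_le _ _).trans
        (add_le_add ((enorm_add_le _ _).trans (add_le_add_right e2 _)) e1)
  exact ENNReal.add_lt_top.2 ⟨ENNReal.add_lt_top.2 ⟨ENNReal.add_lt_top.2 ⟨b0.trans_lt
    (ENNReal.add_lt_top.2 ⟨ENNReal.add_lt_top.2 ⟨enorm_lt_top, h1⟩, b2⟩), b1⟩, b2⟩, h12⟩

theorem isHKBV_of_hkENorm_lt_top {g : RBar2 → ℝ} (hg : hkENorm g < ∞) : IsHKBV g := by
  unfold hkENorm at hg
  simp only [ENNReal.add_lt_top] at hg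
  exact ⟨hg.2, ⊥, ⊥, (le_iSup (V₁ g) ⊥).trans_lt hg.1.1.2, (le_iSup (V₂ g) ⊥).trans_lt hg.1.2⟩

theorem eVariationOn_add_le' (f g : EReal → ℝ) :
    eVariationOn (f + g) Set.univ ≤ eVariationOn f Set.univ + eVariationOn g Set.univ := by
  refine iSup_le fun ⟨n, u, hu, hus⟩ => ?_
  refine le_trans ?_ (add_le_add (eVariationOn.sum_le (f := f) (n := n) hu hus)
    (eVariationOn.sum_le (f := g) (n := n) hu hus))
  rw [← Finset.sum_add_distrib]
  exact Finset.sum_le_sum fun i _ => edist_add_add_le _ _ _ _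

theorem eVariationOn_smul_le' (c : ℝ) (f : EReal → ℝ) :
    eVariationOn (c • f) Set.univ ≤ ‖c‖ₑ * eVariationOn f Set.univ := by
  refine iSup_le fun ⟨n, u, hu, hus⟩ => ?_
  refine le_trans ?_ (mul_le_mul_right (eVariationOn.sum_le (f := f) (n := n) hu hus) _)
  rw [Finset.mul_sum]
  refine Finset.sum_le_sum fun i _ => le_of_eq ?_
  rw [edist_eq_enorm_sub, edist_eq_enorm_sub, ← enorm_smul, smul_sub]
  rfl

theorem hkENorm_add_le (g h : RBar2 → ℝ) : hkENorm (g + h) ≤ hkENorm g + hkENorm h := by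
  have b0 : (⨆ p, ‖(g + h) p‖ₑ) ≤ (⨆ p, ‖g p‖ₑ) + ⨆ p, ‖h p‖ₑ :=
    iSup_le fun p => (enorm_add_le _ _).trans
      (add_le_add (le_iSup (fun p => ‖g p‖ₑ) p) (le_iSup (fun p => ‖h p‖ₑ) p))
  have b1 : (⨆ y, V₁ (g + h) y) ≤ (⨆ y, V₁ g y) + ⨆ y, V₁ h y :=
    iSup_le fun y => (eVariationOn_add_le' (fun x => g (x, y)) (fun x => h (x, y))).trans
      (add_le_add (le_iSup (V₁ g) y) (le_iSup (V₁ h) y))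
  have b2 : (⨆ x, V₂ (g + h) x) ≤ (⨆ x, V₂ g x) + ⨆ x, V₂ h x :=
    iSup_le fun x => (eVariationOn_add_le' (fun y => g (x, y)) (fun y => h (x, y))).trans
      (add_le_add (le_iSup (V₂ g) x) (le_iSup (V₂ h) x))
  have b3 : V₁₂ (g + h) ≤ V₁₂ g + V₁₂ h := by
    refine iSup₂_le fun D hD => ?_
    refine le_trans ?_ (add_le_add
      (le_iSup₂ (f := fun (D : Finset (NonemptyInterval RBar2)) (_ : IsDivision ⊤ D) =>
        ∑ J ∈ D, ‖inc₂ g J‖ₑ) D hD)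
      (le_iSup₂ (f := fun (D : Finset (NonemptyInterval RBar2)) (_ : IsDivision ⊤ D) =>
        ∑ J ∈ D, ‖inc₂ h J‖ₑ) D hD))
    rw [← Finset.sum_add_distrib]
    refine Finset.sum_le_sum fun J _ => le_trans (le_of_eq ?_) (enorm_add_le _ _)
    congr 1
    simp only [inc₂, Pi.add_apply]
    ring
  calc hkENorm (g + h) ≤ _ := add_le_add (add_le_add (add_le_add b0 b1) b2) b3
    _ = _ := by unfold hkENorm; ring

theorem hkENorm_smul_le (c : ℝ) (g : RBar2 → ℝ) : hkENorm (c • g) ≤ ‖c‖ₑ * hkENorm g := by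
  have b0 : (⨆ p, ‖(c • g) p‖ₑ) ≤ ‖c‖ₑ * ⨆ p, ‖g p‖ₑ :=
    iSup_le fun p => (enorm_smul c (g p)).le.trans
      (mul_le_mul_right (le_iSup (fun p => ‖g p‖ₑ) p) _)
  have b1 : (⨆ y, V₁ (c • g) y) ≤ ‖c‖ₑ * ⨆ y, V₁ g y :=
    iSup_le fun y => (eVariationOn_smul_le' c (fun x => g (x, y))).trans
      (mul_le_mul_right (le_iSup (V₁ g) y) _)
  have b2 : (⨆ x, V₂ (c • g) x) ≤ ‖c‖ₑ * ⨆ x, V₂ g x :=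
    iSup_le fun x => (eVariationOn_smul_le' c (fun y => g (x, y))).trans
      (mul_le_mul_right (le_iSup (V₂ g) x) _)
  have b3 : V₁₂ (c • g) ≤ ‖c‖ₑ * V₁₂ g := by
    refine iSup₂_le fun D hD => ?_
    refine le_trans ?_ (mul_le_mul_right
      (le_iSup₂ (f := fun (D : Finset (NonemptyInterval RBar2)) (_ : IsDivision ⊤ D) =>
        ∑ J ∈ D, ‖inc₂ g J‖ₑ) D hD) _)
    rw [Finset.mul_sum]
    refine Finset.sum_le_sum fun J _ => le_of_eq ?_
    rw [← enorm_smul]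
    congr 1
    simp only [inc₂, Pi.smul_apply, smul_eq_mul]
    ring
  calc hkENorm (c • g) ≤ _ := add_le_add (add_le_add (add_le_add b0 b1) b2) b3
    _ = _ := by unfold hkENorm; ring

def hkbvSubmodule : Submodule ℝ (RBar2 → ℝ) where
  carrier := {g | IsHKBV g}
  zero_mem' := isHKBV_of_hkENorm_lt_top <| by
    simpa using (hkENorm_smul_le 0 0).trans_lt (by simp)
  add_mem' := fun {g h} hg hh => isHKBV_of_hkENorm_lt_top <|
    (hkENorm_add_le g h).trans_lt (ENNReal.add_lt_top.2 ⟨hg.hkENorm_lt_top, hh.hkENorm_lt_top⟩)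
  smul_mem' := fun c g hg => isHKBV_of_hkENorm_lt_top <|
    (hkENorm_smul_le c g).trans_lt (ENNReal.mul_lt_top enorm_lt_top hg.hkENorm_lt_top)

/-- The space of functions of finite Hardy-Krause variation on the extended real plane. It is a
separate type because its topology is that of `‖·‖_bv` and not the one of pointwise convergence. -/
def HKBV : Type := hkbvSubmodule

instance : AddCommGroup HKBV := inferInstanceAs (AddCommGroup hkbvSubmodule)
instance : Module ℝ HKBV := inferInstanceAs (Module ℝ hkbvSubmodule)
instance : CoeFun HKBV (fun _ => RBar2 → ℝ) := ⟨fun g => g.1⟩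

/-- The norm `‖·‖_bv`, finite on `HKBV`. -/
instance : Norm HKBV := ⟨fun g => (hkENorm g).toReal⟩

theorem hkCore : NormedSpace.Core ℝ HKBV where
  norm_nonneg _ := ENNReal.toReal_nonneg
  norm_smul c g := by
    have hle : ∀ (c : ℝ) (g : HKBV), ‖c • g‖ ≤ ‖c‖ * ‖g‖ := by
      intro c g
      have := ENNReal.toReal_mono (ENNReal.mul_lt_top enorm_lt_top g.2.hkENorm_lt_top).ne
        (hkENorm_smul_le c g)
      rwa [ENNReal.toReal_mul, toReal_enorm] at this
    refine le_antisymm (hle c g) ?_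
    by_cases hc : c = 0
    · rw [hc, norm_zero, zero_mul]; exact ENNReal.toReal_nonneg
    · have := hle c⁻¹ (c • g)
      rw [smul_smul, inv_mul_cancel₀ hc, one_smul, norm_inv] at this
      have hp : 0 < ‖c‖ := norm_pos_iff.2 hc
      rwa [inv_mul_eq_div, le_div_iff₀' hp] at this
  norm_triangle g h := by
    have := ENNReal.toReal_mono
      (ENNReal.add_lt_top.2 ⟨g.2.hkENorm_lt_top, h.2.hkENorm_lt_top⟩).ne (hkENorm_add_le g.1 h.1)
    rwa [ENNReal.toReal_add g.2.hkENorm_lt_top.ne h.2.hkENorm_lt_top.ne] at this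
  norm_eq_zero_iff g := by
    constructor
    · intro h
      have h1 : hkENorm g = 0 := ((ENNReal.toReal_eq_zero_iff _).1 h).resolve_right
        g.2.hkENorm_lt_top.ne
      apply Subtype.ext
      funext p
      have h2 : ‖g.1 p‖ₑ ≤ hkENorm g :=
        (le_iSup (fun p => ‖g.1 p‖ₑ) p).trans (by unfold hkENorm; rw [add_assoc, add_assoc]; exact le_self_add)
      rw [h1] at h2
      exact enorm_eq_zero.1 (le_antisymm h2 bot_le)
    · rintro rfl
      have : hkENorm (0 : RBar2 → ℝ) = 0 := le_antisymm (by simpa using hkENorm_smul_le 0 0) bot_le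
      change (hkENorm (0 : RBar2 → ℝ)).toReal = 0
      rw [this]; rfl

instance : NormedAddCommGroup HKBV := NormedAddCommGroup.ofCore hkCore
instance : NormedSpace ℝ HKBV := NormedSpace.ofCore hkCore

/-- Weights for the normalisation at the points of one of the four open edges of the extended real
plane. -/
structure EdgeWeights where
  neg : ℝ
  pos : ℝ
  neg_nonneg : 0 ≤ neg
  pos_nonneg : 0 ≤ pos
  sum_eq_one : neg + pos = 1

/-- A normalisation: weights `αmm`, `αpp`, `αmp`, `αpm` in `[0, 1]` of sum one for the quadrant limits
at `(x-, y-)`, `(x+, y+)`, `(x-, y+)`, `(x+, y-)`, and two weights for each edge `x = -∞`, `x = ∞`,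
`y = -∞`, `y = ∞`. -/
structure Normalisation where
  αmm : ℝ
  αpp : ℝ
  αmp : ℝ
  αpm : ℝ
  αmm_nonneg : 0 ≤ αmm
  αpp_nonneg : 0 ≤ αpp
  αmp_nonneg : 0 ≤ αmp
  αpm_nonneg : 0 ≤ αpm
  sum_eq_one : αmm + αpp + αmp + αpm = 1
  left : EdgeWeights
  right : EdgeWeights
  bottom : EdgeWeights
  top : EdgeWeights

/-- `h` is the normalisation of `g`: the one-sided limits of `g` exist, and the values of `h` are the
weighted means of these limits (at the four corners: the limit). -/
structure IsNormalisationOf (N : Normalisation) (g h : RBar2 → ℝ) : Prop where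
  plane : ∀ x y : ℝ, ∃ lmm lpp lmp lpm : ℝ,
    Tendsto g (𝓝[<] (x : EReal) ×ˢ 𝓝[<] (y : EReal)) (𝓝 lmm) ∧
    Tendsto g (𝓝[>] (x : EReal) ×ˢ 𝓝[>] (y : EReal)) (𝓝 lpp) ∧
    Tendsto g (𝓝[<] (x : EReal) ×ˢ 𝓝[>] (y : EReal)) (𝓝 lmp) ∧
    Tendsto g (𝓝[>] (x : EReal) ×ˢ 𝓝[<] (y : EReal)) (𝓝 lpm) ∧
    h ((x : EReal), (y : EReal)) = N.αmm * lmm + N.αpp * lpp + N.αmp * lmp + N.αpm * lpm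
  left : ∀ y : ℝ, ∃ lm lp : ℝ,
    Tendsto g (𝓝[>] ⊥ ×ˢ 𝓝[<] (y : EReal)) (𝓝 lm) ∧
    Tendsto g (𝓝[>] ⊥ ×ˢ 𝓝[>] (y : EReal)) (𝓝 lp) ∧
    h (⊥, (y : EReal)) = N.left.neg * lm + N.left.pos * lp
  right : ∀ y : ℝ, ∃ lm lp : ℝ,
    Tendsto g (𝓝[<] ⊤ ×ˢ 𝓝[<] (y : EReal)) (𝓝 lm) ∧
    Tendsto g (𝓝[<] ⊤ ×ˢ 𝓝[>] (y : EReal)) (𝓝 lp) ∧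
    h (⊤, (y : EReal)) = N.right.neg * lm + N.right.pos * lp
  bottom : ∀ x : ℝ, ∃ lm lp : ℝ,
    Tendsto g (𝓝[<] (x : EReal) ×ˢ 𝓝[>] ⊥) (𝓝 lm) ∧
    Tendsto g (𝓝[>] (x : EReal) ×ˢ 𝓝[>] ⊥) (𝓝 lp) ∧
    h ((x : EReal), ⊥) = N.bottom.neg * lm + N.bottom.pos * lp
  top : ∀ x : ℝ, ∃ lm lp : ℝ,
    Tendsto g (𝓝[<] (x : EReal) ×ˢ 𝓝[<] ⊤) (𝓝 lm) ∧
    Tendsto g (𝓝[>] (x : EReal) ×ˢ 𝓝[<] ⊤) (𝓝 lp) ∧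
    h ((x : EReal), ⊤) = N.top.neg * lm + N.top.pos * lp
  corner_bb : Tendsto g (𝓝[>] ⊥ ×ˢ 𝓝[>] ⊥) (𝓝 (h (⊥, ⊥)))
  corner_bt : Tendsto g (𝓝[>] ⊥ ×ˢ 𝓝[<] ⊤) (𝓝 (h (⊥, ⊤)))
  corner_tb : Tendsto g (𝓝[<] ⊤ ×ˢ 𝓝[>] ⊥) (𝓝 (h (⊤, ⊥)))
  corner_tt : Tendsto g (𝓝[<] ⊤ ×ˢ 𝓝[<] ⊤) (𝓝 (h (⊤, ⊤)))

theorem IsNormalisationOf.add {N : Normalisation} {g h g' h' : RBar2 → ℝ}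
    (H : IsNormalisationOf N g h) (H' : IsNormalisationOf N g' h') :
    IsNormalisationOf N (g + g') (h + h') where
  plane x y := by
    obtain ⟨a, b, c, d, ha, hb, hc, hd, e⟩ := H.plane x y
    obtain ⟨a', b', c', d', ha', hb', hc', hd', e'⟩ := H'.plane x y
    exact ⟨_, _, _, _, ha.add ha', hb.add hb', hc.add hc', hd.add hd', by
      rw [Pi.add_apply, e, e']; ring⟩
  left y := by
    obtain ⟨a, b, ha, hb, e⟩ := H.left y
    obtain ⟨a', b', ha', hb', e'⟩ := H'.left y
    exact ⟨_, _, ha.add ha', hb.add hb', by rw [Pi.add_apply, e, e']; ring⟩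
  right y := by
    obtain ⟨a, b, ha, hb, e⟩ := H.right y
    obtain ⟨a', b', ha', hb', e'⟩ := H'.right y
    exact ⟨_, _, ha.add ha', hb.add hb', by rw [Pi.add_apply, e, e']; ring⟩
  bottom x := by
    obtain ⟨a, b, ha, hb, e⟩ := H.bottom x
    obtain ⟨a', b', ha', hb', e'⟩ := H'.bottom x
    exact ⟨_, _, ha.add ha', hb.add hb', by rw [Pi.add_apply, e, e']; ring⟩
  top x := by
    obtain ⟨a, b, ha, hb, e⟩ := H.top x
    obtain ⟨a', b', ha', hb', e'⟩ := H'.top x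
    exact ⟨_, _, ha.add ha', hb.add hb', by rw [Pi.add_apply, e, e']; ring⟩
  corner_bb := H.corner_bb.add H'.corner_bb
  corner_bt := H.corner_bt.add H'.corner_bt
  corner_tb := H.corner_tb.add H'.corner_tb
  corner_tt := H.corner_tt.add H'.corner_tt

theorem IsNormalisationOf.smul {N : Normalisation} {g h : RBar2 → ℝ} (r : ℝ)
    (H : IsNormalisationOf N g h) : IsNormalisationOf N (r • g) (r • h) where
  plane x y := by
    obtain ⟨a, b, c, d, ha, hb, hc, hd, e⟩ := H.plane x y
    exact ⟨_, _, _, _, ha.const_smul r, hb.const_smul r, hc.const_smul r, hd.const_smul r, by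
      rw [Pi.smul_apply, e]; simp only [smul_eq_mul]; ring⟩
  left y := by
    obtain ⟨a, b, ha, hb, e⟩ := H.left y
    exact ⟨_, _, ha.const_smul r, hb.const_smul r, by
      rw [Pi.smul_apply, e]; simp only [smul_eq_mul]; ring⟩
  right y := by
    obtain ⟨a, b, ha, hb, e⟩ := H.right y
    exact ⟨_, _, ha.const_smul r, hb.const_smul r, by
      rw [Pi.smul_apply, e]; simp only [smul_eq_mul]; ring⟩
  bottom x := by
    obtain ⟨a, b, ha, hb, e⟩ := H.bottom x
    exact ⟨_, _, ha.const_smul r, hb.const_smul r, by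
      rw [Pi.smul_apply, e]; simp only [smul_eq_mul]; ring⟩
  top x := by
    obtain ⟨a, b, ha, hb, e⟩ := H.top x
    exact ⟨_, _, ha.const_smul r, hb.const_smul r, by
      rw [Pi.smul_apply, e]; simp only [smul_eq_mul]; ring⟩
  corner_bb := H.corner_bb.const_smul r
  corner_bt := H.corner_bt.const_smul r
  corner_tb := H.corner_tb.const_smul r
  corner_tt := H.corner_tt.const_smul r

theorem isNormalisationOf_zero (N : Normalisation) : IsNormalisationOf N 0 0 where
  plane _ _ := ⟨0, 0, 0, 0, tendsto_const_nhds, tendsto_const_nhds, tendsto_const_nhds,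
    tendsto_const_nhds, by simp⟩
  left _ := ⟨0, 0, tendsto_const_nhds, tendsto_const_nhds, by simp⟩
  right _ := ⟨0, 0, tendsto_const_nhds, tendsto_const_nhds, by simp⟩
  bottom _ := ⟨0, 0, tendsto_const_nhds, tendsto_const_nhds, by simp⟩
  top _ := ⟨0, 0, tendsto_const_nhds, tendsto_const_nhds, by simp⟩
  corner_bb := tendsto_const_nhds
  corner_bt := tendsto_const_nhds
  corner_tb := tendsto_const_nhds
  corner_tt := tendsto_const_nhds

/-- The space of normalised functions of finite Hardy-Krause variation: those that are equal to their
own normalisation. Its norm is `‖·‖_bv`. -/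
def NHKBV (N : Normalisation) : Submodule ℝ HKBV where
  carrier := {g | IsNormalisationOf N g.1 g.1}
  zero_mem' := isNormalisationOf_zero N
  add_mem' := fun hg hh => IsNormalisationOf.add hg hh
  smul_mem' := fun c _ hg => IsNormalisationOf.smul c hg

/-- A tagged division of the interval `I`: finitely many pairwise nonoverlapping intervals with union
`I`, together with a point (the tag) in each of them. -/
def IsTaggedDivision {α : Type*} [TopologicalSpace α] [PartialOrder α]
    (I : NonemptyInterval α) (P : Finset (NonemptyInterval α × α)) : Prop :=
  (P : Set (NonemptyInterval α × α)).Pairwise (fun q r => Nonoverlapping q.1 r.1) ∧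
    (⋃ q ∈ P, (q.1 : Set α)) = (I : Set α) ∧ ∀ q ∈ P, q.2 ∈ q.1

/-- The Henstock-Stieltjes integral over `I` of the function `F` with respect to the interval function
`Δ` (the increment of the integrator over an interval) exists and has the value `A`. The gauge `γ`
assigns to each point an open set that contains it. -/
def HasHSIntegral {α : Type*} [TopologicalSpace α] [PartialOrder α]
    (I : NonemptyInterval α) (F : α → ℝ) (Δ : NonemptyInterval α → ℝ) (A : ℝ) : Prop :=
  ∀ ε > 0, ∃ γ : α → Set α, (∀ p, IsOpen (γ p) ∧ p ∈ γ p) ∧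
    ∀ P : Finset (NonemptyInterval α × α), IsTaggedDivision I P →
      (∀ q ∈ P, (q.1 : Set α) ⊆ γ q.2) → |∑ q ∈ P, F q.2 * Δ q.1 - A| < ε

/-- The increment `h(b) - h(a)` of a function of one variable over `[a, b]`. -/
def inc₁ (h : EReal → ℝ) (J : NonemptyInterval EReal) : ℝ := h J.snd - h J.fst

/-- The side `[a, b]` of the interval `[a, b] × [c, d]`. -/
def side₁ (I : NonemptyInterval RBar2) : NonemptyInterval EReal :=
  ⟨(I.fst.1, I.snd.1), I.fst_le_snd.1⟩

/-- The side `[c, d]` of the interval `[a, b] × [c, d]`. -/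
def side₂ (I : NonemptyInterval RBar2) : NonemptyInterval EReal :=
  ⟨(I.fst.2, I.snd.2), I.fst_le_snd.2⟩

/-- The integral of `f g` over `I = [a, b] × [c, d]`, defined by integration by parts, has the value
`v`; with the primitive `F` of `f` this means that all integrals below exist and
`v = F(a,c) g(a,c) + F(b,d) g(b,d) - F(a,d) g(a,d) - F(b,c) g(b,c)
  - ∫ F(x,d) d₁g(x,d) + ∫ F(x,c) d₁g(x,c) - ∫ F(b,y) d₂g(b,y) + ∫ F(a,y) d₂g(a,y)
  + ∫∫ F d₁₂g`. -/
def HasIntegralMul (I : NonemptyInterval RBar2) (f : Ac) (g : RBar2 → ℝ) (v : ℝ) : Prop :=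
  let F : RBar2 → ℝ := (primitive f).1
  let a := I.fst.1
  let b := I.snd.1
  let c := I.fst.2
  let d := I.snd.2
  ∃ Sd Sc Tb Ta U : ℝ,
    HasHSIntegral (side₁ I) (fun x => F (x, d)) (inc₁ fun x => g (x, d)) Sd ∧
    HasHSIntegral (side₁ I) (fun x => F (x, c)) (inc₁ fun x => g (x, c)) Sc ∧
    HasHSIntegral (side₂ I) (fun y => F (b, y)) (inc₁ fun y => g (b, y)) Tb ∧
    HasHSIntegral (side₂ I) (fun y => F (a, y)) (inc₁ fun y => g (a, y)) Ta ∧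
    HasHSIntegral I F (inc₂ g) U ∧
    v = F (a, c) * g (a, c) + F (b, d) * g (b, d) - F (a, d) * g (a, d) - F (b, c) * g (b, c)
      - Sd + Sc - Tb + Ta + U

end

end ContPrim

/-! Passing to primitives identifies `Ac` isometrically with `Bc`, so everything concerns bounded
functionals of `F` in `Bc`. For a grid of extended real nodes let `gridSum` be the sum of `g` at the
lower corners of the cells against the increments of `F`. Since `F` vanishes where a coordinate is
`⊥`, summation by parts (`gridSum_eq`) turns it into the discrete form of the right side of the
integration by parts formula. This bounds it by `‖F‖ * ‖g‖_bv`, so its limit `pairing` along an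
ultrafilter of ever finer grids exists. By uniform continuity of `F`, every sufficiently fine tagged
sum is close to the grid sums, so the limits of the separate terms are the Henstock-Stieltjes
integrals (`hasHSIntegral₁`, `hasHSIntegral₂`). Hence `toDual` is well defined, linear and bounded.

Injectivity: if `F = φ ⊗ ψ` with `φ`, `ψ` rising from 0 to 1 inside short intervals, the grid sum is
an average of `g` over a small rectangle. If all pairings vanish, then so do all limits of `g` from
inside (`limit_eq_zero`), and a normalised `g` is made of such limits.

Surjectivity: by Hahn-Banach a functional extends to a functional `T` on all bounded functions,
where it can be applied to characteristic functions. Put `tail T (x, y) = T (1_{(x,∞] × (y,∞]})`.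
Its increments are the values of `T` at characteristic functions of half-open rectangles, so its
Vitali variation is at most `‖T‖`, and `pairing_tail` recovers `T` because step functions
approximate `F` uniformly. This function need not be normalised. Increasing functions of one
variable dominate its increments, so its quadrant limits exist and its normalisation `normTail`
agrees with it on `D × D` for a dense set `D`. A function of finite Hardy-Krause variation that
vanishes on `D × D` pairs to zero with every `F` (`pairing_eq_zero_of_dense`), so `normTail`
represents the same functional.

Continuity of the inverse: increments of `normTail` away from the edges are limits of convex
combinations of increments of `tail T`, and the edge strips are estimated crudely. This gives the
explicit bound `52 * ‖T‖`, so neither completeness of `NHKBV N` nor the open mapping theorem is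
needed. -/

namespace ContPrim

noncomputable section

/-! ### Grids and telescoping sums over them. -/

/-- A strictly increasing finite sequence from `⊥` to `⊤` that runs through the points of `s`. -/
structure Grid (s : Finset EReal) where
  u : ℕ → EReal
  n : ℕ
  strict : StrictMonoOn u (Set.Iic (n + 1))
  mono : Monotone u
  zero : u 0 = ⊥
  last : u (n + 1) = ⊤
  surj : ∀ x ∈ s, ∃ i ≤ n + 1, u i = x
  mem : ∀ i, u i = ⊥ ∨ u i = ⊤ ∨ u i ∈ s

theorem nonempty_grid (s : Finset EReal) : Nonempty (Grid s) := by
  classical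
  let t : Finset EReal := insert ⊥ (insert ⊤ s)
  have hb : ⊥ ∈ t := by simp [t]
  have ht : ⊤ ∈ t := by simp [t]
  have hcard : 1 < t.card := Finset.one_lt_card.2 ⟨⊥, hb, ⊤, ht, bot_ne_top⟩
  obtain ⟨n, hn⟩ : ∃ n, t.card = n + 2 := ⟨t.card - 2, by omega⟩
  let w : Fin (n + 2) ↪o EReal := t.orderEmbOfFin hn
  have hw : ∀ x ∈ t, ∃ i, w i = x := fun x hx => by
    have : x ∈ Set.range w := by rw [Finset.range_orderEmbOfFin]; exact hx
    exact this
  -- Truncating the index makes the sequence constant from `n + 1` on: monotone on all of `ℕ`,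
  -- strictly increasing only up to `n + 1`.
  let c : ℕ → Fin (n + 2) := fun i => ⟨min i (n + 1), by omega⟩
  refine ⟨⟨fun i => w (c i), n, ?_, ?_, ?_, ?_, ?_, ?_⟩⟩
  · intro i hi j hj hij
    refine w.strictMono ?_
    simp only [Set.mem_Iic] at hi hj
    simp only [c, Fin.lt_def]
    omega
  · intro i j hij
    refine w.monotone ?_
    simp only [c, Fin.le_def]
    omega
  · obtain ⟨i, hi⟩ := hw ⊥ hb
    refine le_bot_iff.1 (hi ▸ w.monotone ?_)
    simp [c]
  · obtain ⟨i, hi⟩ := hw ⊤ ht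
    refine top_le_iff.1 (hi ▸ w.monotone ?_)
    have := i.2
    simp only [c, Fin.le_def]
    omega
  · intro x hx
    obtain ⟨i, hi⟩ := hw x (by simp [t, hx])
    have := i.2
    refine ⟨i, by omega, ?_⟩
    rw [← hi]
    congr 1
    ext
    simp only [c]
    omega
  · intro i
    have : w (c i) ∈ t := Finset.orderEmbOfFin_mem t hn _
    simpa [t] using this

/-- A grid through the points of `s`. -/
def theGrid (s : Finset EReal) : Grid s := Classical.choice (nonempty_grid s)

namespace Grid

variable {s : Finset EReal} (G : Grid s)

/-- The cell of a grid. -/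
abbrev box (q : ℕ × ℕ) : NonemptyInterval RBar2 := cell G.mono G.mono q

/-- The index set of the cells of a grid. -/
abbrev idx : Finset (ℕ × ℕ) := Finset.range (G.n + 1) ×ˢ Finset.range (G.n + 1)

theorem exists_eq {x : EReal} (hx : x = ⊥ ∨ x = ⊤ ∨ x ∈ s) : ∃ i ≤ G.n + 1, G.u i = x := by
  rcases hx with rfl | rfl | hx
  · exact ⟨0, by omega, G.zero⟩
  · exact ⟨_, le_rfl, G.last⟩
  · exact G.surj x hx

theorem lt_iff {i j : ℕ} (hi : i ≤ G.n + 1) (hj : j ≤ G.n + 1) : G.u i < G.u j ↔ i < j :=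
  G.strict.lt_iff_lt hi hj

theorem le_iff {i j : ℕ} (hi : i ≤ G.n + 1) (hj : j ≤ G.n + 1) : G.u i ≤ G.u j ↔ i ≤ j :=
  G.strict.le_iff_le hi hj

theorem bot_lt {i : ℕ} (hi : i < G.n + 1) : ⊥ < G.u (i + 1) := by
  rw [← G.zero, G.lt_iff] <;> omega

theorem not_between {i : ℕ} {x : EReal} (hx : x ∈ s) (hi : i ≤ G.n) :
    x ∉ Set.Ioo (G.u i) (G.u (i + 1)) := by
  obtain ⟨j, hj, rfl⟩ := G.surj x hx
  rintro ⟨h1, h2⟩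
  rw [G.lt_iff] at h1 h2 <;> omega

/-- The increment of `φ` over `[a, b]` is the sum of the increments over the intervals of the grid
with right end in `(a, b]`. -/
theorem sum_ite_inc (φ : EReal → ℝ) {a b : EReal} (ha : a = ⊥ ∨ a = ⊤ ∨ a ∈ s)
    (hb : b = ⊥ ∨ b = ⊤ ∨ b ∈ s) (hab : a ≤ b) :
    ∑ i ∈ Finset.range (G.n + 1), (if G.u (i + 1) ∈ Set.Ioc a b then
      φ (G.u (i + 1)) - φ (G.u i) else 0) = φ b - φ a := by
  obtain ⟨k, hk, rfl⟩ := G.exists_eq ha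
  obtain ⟨l, hl, rfl⟩ := G.exists_eq hb
  rw [G.le_iff hk hl] at hab
  have e : ∑ i ∈ Finset.Ico k l, (φ (G.u (i + 1)) - φ (G.u i)) = φ (G.u l) - φ (G.u k) := by
    rw [Finset.sum_Ico_eq_sub _ hab, Finset.sum_range_sub (fun i => φ (G.u i)),
      Finset.sum_range_sub (fun i => φ (G.u i))]
    exact sub_sub_sub_cancel_right _ _ _
  rw [← Finset.sum_filter, ← e]
  refine Finset.sum_congr ?_ fun _ _ => rfl
  ext i
  simp only [Finset.mem_filter, Finset.mem_range, Set.mem_Ioc, Finset.mem_Ico]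
  constructor
  · rintro ⟨h1, h2, h3⟩
    rw [G.lt_iff hk (by omega)] at h2
    rw [G.le_iff (by omega) hl] at h3
    omega
  · rintro ⟨h1, h2⟩
    rw [G.lt_iff hk (by omega), G.le_iff (by omega) hl]
    omega

end Grid

/-- The half-open interval `(a, b] × (c, d]`. -/
def hopen (J : NonemptyInterval RBar2) : Set RBar2 :=
  Set.Ioc J.fst.1 J.snd.1 ×ˢ Set.Ioc J.fst.2 J.snd.2

/-- The half-open interval `(a, b]`. -/
def hopen₁ (J : NonemptyInterval EReal) : Set EReal := Set.Ioc J.fst J.snd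

open Classical in
-- Telescoping in each variable. A cell is represented by its upper right corner, which lies in the
-- half-open interval of `J` exactly when the cell is part of `J`.
theorem Grid.sum_ite_inc₂ {s : Finset EReal} (G : Grid s) (g : RBar2 → ℝ)
    (J : NonemptyInterval RBar2)
    (h1 : J.fst.1 ∈ s) (h2 : J.fst.2 ∈ s) (h3 : J.snd.1 ∈ s) (h4 : J.snd.2 ∈ s) :
    inc₂ g J = ∑ q ∈ G.idx, (if (G.u (q.1 + 1), G.u (q.2 + 1)) ∈ hopen J then
      inc₂ g (G.box q) else 0) := by
  rw [Finset.sum_product, Finset.sum_comm]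
  have e1 : ∀ j, ∑ i ∈ Finset.range (G.n + 1),
      (if (G.u (i + 1), G.u (j + 1)) ∈ hopen J then inc₂ g (G.box (i, j)) else 0) =
      if G.u (j + 1) ∈ Set.Ioc J.fst.2 J.snd.2 then
        (g (J.snd.1, G.u (j + 1)) - g (J.fst.1, G.u (j + 1))) -
        (g (J.snd.1, G.u j) - g (J.fst.1, G.u j)) else 0 := by
    intro j
    split_ifs with h
    · have := G.sum_ite_inc (fun x => g (x, G.u (j + 1)) - g (x, G.u j))
        (.inr (.inr h1)) (.inr (.inr h3)) J.fst_le_snd.1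
      refine Eq.trans (Finset.sum_congr rfl fun i _ => ?_) (this.trans (by ring))
      simp only [hopen, Set.mem_prod, h, and_true, inc₂, cell]
      split_ifs <;> ring
    · refine Finset.sum_eq_zero fun i _ => if_neg fun h' => h h'.2
  simp only [e1]
  have := G.sum_ite_inc (fun y => g (J.snd.1, y) - g (J.fst.1, y))
        (.inr (.inr h2)) (.inr (.inr h4)) J.fst_le_snd.2
  rw [this, inc₂]
  ring

open Classical in
theorem Grid.sum_ite_inc₁ {s : Finset EReal} (G : Grid s) (k : EReal → ℝ)
    (J : NonemptyInterval EReal) (h1 : J.fst ∈ s) (h2 : J.snd ∈ s) :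
    inc₁ k J = ∑ i ∈ Finset.range (G.n + 1), (if G.u (i + 1) ∈ hopen₁ J then
      k (G.u (i + 1)) - k (G.u i) else 0) := by
  rw [inc₁, ← G.sum_ite_inc k (.inr (.inr h1)) (.inr (.inr h2)) J.fst_le_snd]
  exact Finset.sum_congr rfl fun i _ => by congr

/-! ### Comparison of a division with the cells of a finer grid. -/

/-- Two ways to discretise `F`: the sum with values `w k` on the pieces `A k`, and the sum over the
atoms `x c` of mass `m c`. -/
theorem abs_sum_sub_sum_le {α ι κ : Type*} (K : Finset ι) (C : Finset κ) (A : ι → Set α)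
    (w I : ι → ℝ) (m : κ → ℝ) (x : κ → α) (F : α → ℝ) {ε V : ℝ} (hε : 0 ≤ ε)
    (hV : ∑ c ∈ C, |m c| ≤ V)
    (hI : ∀ k ∈ K, I k = ∑ c ∈ C, (open Classical in if x c ∈ A k then m c else 0))
    (hA : ∀ c ∈ C, ∃ k ∈ K, x c ∈ A k ∧ ∀ k' ∈ K, x c ∈ A k' → k' = k)
    (hw : ∀ k ∈ K, ∀ p ∈ A k, |w k - F p| ≤ ε) :
    |∑ k ∈ K, w k * I k - ∑ c ∈ C, m c * F (x c)| ≤ ε * V := by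
  classical
  -- After the exchange of sums the inner sum is the value `w k` of the one piece that contains the
  -- atom `x c`, and this differs from `F (x c)` by at most `ε`.
  have e1 : ∑ k ∈ K, w k * I k = ∑ c ∈ C, m c * ∑ k ∈ K, (if x c ∈ A k then w k else 0) := by
    calc _ = ∑ k ∈ K, ∑ c ∈ C, (if x c ∈ A k then w k * m c else 0) := by
          refine Finset.sum_congr rfl fun k hk => ?_
          rw [hI k hk, Finset.mul_sum]
          exact Finset.sum_congr rfl fun c _ => by split_ifs <;> simp
      _ = _ := by
          rw [Finset.sum_comm]
          refine Finset.sum_congr rfl fun c _ => ?_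
          rw [Finset.mul_sum]
          exact Finset.sum_congr rfl fun k _ => by split_ifs <;> ring
  rw [e1, ← Finset.sum_sub_distrib]
  refine (Finset.abs_sum_le_sum_abs _ _).trans ?_
  refine le_trans (Finset.sum_le_sum (g := fun c => ε * |m c|) fun c hc => ?_) (by
    rw [← Finset.mul_sum]; exact mul_le_mul_of_nonneg_left hV hε)
  obtain ⟨k, hk, hxk, hu⟩ := hA c hc
  rw [Finset.sum_eq_single_of_mem k hk fun k' hk' hne => if_neg fun h => hne (hu k' hk' h),
    if_pos hxk, ← mul_sub, abs_mul, mul_comm]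
  exact mul_le_mul_of_nonneg_right (hw k hk _ hxk) (abs_nonneg _)

/-- Sums of absolute values over disjoint pieces are at most the sum over the atoms. -/
theorem sum_enorm_le_of_atoms {α ι κ : Type*} (K : Finset ι) (C : Finset κ) (A : ι → Set α)
    (I : ι → ℝ) (m : κ → ℝ) (x : κ → α)
    (hI : ∀ k ∈ K, I k = ∑ c ∈ C, (open Classical in if x c ∈ A k then m c else 0))
    (hA : ∀ c ∈ C, ∀ k ∈ K, x c ∈ A k → ∀ k' ∈ K, x c ∈ A k' → k' = k) :
    ∑ k ∈ K, ‖I k‖ₑ ≤ ∑ c ∈ C, ‖m c‖ₑ := by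
  classical
  calc _ ≤ ∑ k ∈ K, ∑ c ∈ C, (if x c ∈ A k then ‖m c‖ₑ else 0) := by
        refine Finset.sum_le_sum fun k hk => ?_
        rw [hI k hk]
        refine (enorm_sum_le _ _).trans (Finset.sum_le_sum fun c _ => ?_)
        split_ifs <;> simp
    _ = ∑ c ∈ C, ∑ k ∈ K, (if x c ∈ A k then ‖m c‖ₑ else 0) := Finset.sum_comm
    _ ≤ _ := by
        refine Finset.sum_le_sum fun c hc => ?_
        by_cases h : ∃ k ∈ K, x c ∈ A k
        · obtain ⟨k, hk, hxk⟩ := h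
          rw [Finset.sum_eq_single_of_mem k hk
            fun k' hk' hne => if_neg fun h => hne (hA c hc k hk hxk k' hk' h), if_pos hxk]
        · push Not at h
          rw [Finset.sum_eq_zero fun k hk => if_neg (h k hk)]
          exact zero_le

/-! Half-open intervals and divisions -/

/-- Think of `l` as the approach to `p` from the lower left. Finitely many closed intervals cover,
so one of them contains points arbitrarily far along `l`; then `p` lies in its half-open version. -/
theorem exists_hopen_of_cover {α ι : Type*} [TopologicalSpace α] [PartialOrder α] {K : Finset ι}
    {J : ι → NonemptyInterval α} {H : NonemptyInterval α → Set α} {l : Filter α} [l.NeBot] {p : α}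
    (hcov : ⋃ k ∈ K, (J k : Set α) = Set.univ)
    (h1 : ∀ J : NonemptyInterval α, (∃ᶠ z in l, z ∈ J) → p ∈ H J) :
    ∃ k ∈ K, p ∈ H (J k) := by
  have h2 : ∃ᶠ z in l, ∃ k ∈ K, z ∈ J k := Frequently.of_forall fun z => by
    have : z ∈ ⋃ k ∈ K, (J k : Set α) := hcov ▸ Set.mem_univ z
    simpa using this
  by_contra hcon
  push Not at hcon
  have h3 : ∀ᶠ z in l, ∀ k ∈ K, z ∉ J k :=
    (Filter.eventually_all_finset K).2 fun k hk => by
      have := fun h => hcon k hk (h1 (J k) h)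
      exact not_frequently.1 this
  obtain ⟨z, ⟨k, hk, hz⟩, hz'⟩ := (h2.and_eventually h3).exists
  exact hz' k hk hz

/-- If `p` is in both half-open versions, the points along `l` are eventually interior to both
intervals. With `exists_hopen_of_cover` this makes the half-open intervals of a division an honest
partition of the points without coordinate `⊥`; degenerate intervals contribute the empty set. -/
theorem not_nonoverlapping_of_hopen {α : Type*} [TopologicalSpace α] [PartialOrder α]
    {H : NonemptyInterval α → Set α} {l : Filter α} [l.NeBot] {p : α}
    (h2 : ∀ J : NonemptyInterval α, p ∈ H J → ∀ᶠ z in l, z ∈ interior (J : Set α))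
    {J J' : NonemptyInterval α} (hJ : p ∈ H J) (hJ' : p ∈ H J') : ¬ Nonoverlapping J J' := by
  intro h
  obtain ⟨z, h3, h4⟩ := ((h2 J hJ).and (h2 J' hJ')).exists
  exact Set.disjoint_left.1 h h3 h4

theorem neBot_nhdsLT {x : EReal} (hx : ⊥ < x) : (𝓝[<] x).NeBot := nhdsLT_neBot_of_exists_lt ⟨_, hx⟩

theorem mem_Ioc_of_frequently {x : EReal} {a b : EReal} (h : ∃ᶠ z in 𝓝[<] x, z ∈ Set.Icc a b) :
    x ∈ Set.Ioc a b := by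
  constructor
  · obtain ⟨z, hz, hz'⟩ := (h.and_eventually self_mem_nhdsWithin).exists
    exact hz.1.trans_lt hz'
  · by_contra hb
    obtain ⟨z, hz, hz'⟩ := (h.and_eventually
      (mem_nhdsWithin_of_mem_nhds (Ioi_mem_nhds (not_le.1 hb)))).exists
    exact absurd hz.2 (not_le.2 hz')

theorem eventually_mem_Ioo {x : EReal} {a b : EReal} (h : x ∈ Set.Ioc a b) :
    ∀ᶠ z in 𝓝[<] x, z ∈ Set.Ioo a b :=
  mem_of_superset (Ioo_mem_nhdsLT h.1) (Set.Ioo_subset_Ioo_right h.2)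

theorem mem_hopen₁_of_frequently {x : EReal} (J : NonemptyInterval EReal)
    (h : ∃ᶠ z in 𝓝[<] x, z ∈ J) : x ∈ hopen₁ J := mem_Ioc_of_frequently h

theorem eventually_interior₁ {x : EReal} (J : NonemptyInterval EReal) (h : x ∈ hopen₁ J) :
    ∀ᶠ z in 𝓝[<] x, z ∈ interior (J : Set EReal) :=
  (eventually_mem_Ioo h).mono fun _ hz => interior_maximal Set.Ioo_subset_Icc_self isOpen_Ioo hz

theorem mem_hopen_of_frequently {p : RBar2} (J : NonemptyInterval RBar2)
    (h : ∃ᶠ z in 𝓝[<] p.1 ×ˢ 𝓝[<] p.2, z ∈ J) : p ∈ hopen J := by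
  constructor
  · refine mem_Ioc_of_frequently ((tendsto_fst (f := 𝓝[<] p.1) (g := 𝓝[<] p.2)).frequently
      (h.mono fun z hz => ?_))
    exact ⟨hz.1.1, hz.2.1⟩
  · refine mem_Ioc_of_frequently ((tendsto_snd (f := 𝓝[<] p.1) (g := 𝓝[<] p.2)).frequently
      (h.mono fun z hz => ?_))
    exact ⟨hz.1.2, hz.2.2⟩

theorem eventually_interior {p : RBar2} (J : NonemptyInterval RBar2) (h : p ∈ hopen J) :
    ∀ᶠ z in 𝓝[<] p.1 ×ˢ 𝓝[<] p.2, z ∈ interior (J : Set RBar2) := by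
  filter_upwards [(eventually_mem_Ioo h.1).prod_mk (eventually_mem_Ioo h.2)] with z hz
  refine interior_maximal ?_ (isOpen_Ioo.prod isOpen_Ioo) hz
  rintro w ⟨h1, h2⟩
  exact ⟨⟨h1.1.le, h2.1.le⟩, ⟨h1.2.le, h2.2.le⟩⟩

theorem hopen_bot_lt {p : RBar2} {J : NonemptyInterval RBar2} (h : p ∈ hopen J) :
    ⊥ < p.1 ∧ ⊥ < p.2 := ⟨bot_le.trans_lt h.1.1, bot_le.trans_lt h.2.1⟩

theorem eq_of_mem_hopen {ι : Type*} {K : Set ι} {J : ι → NonemptyInterval RBar2}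
    (hK : K.Pairwise fun k k' => Nonoverlapping (J k) (J k')) {p : RBar2} {k k' : ι}
    (hk : k ∈ K) (hk' : k' ∈ K) (h : p ∈ hopen (J k)) (h' : p ∈ hopen (J k')) : k = k' := by
  have := neBot_nhdsLT (hopen_bot_lt h).1
  have := neBot_nhdsLT (hopen_bot_lt h).2
  by_contra hne
  exact not_nonoverlapping_of_hopen eventually_interior h h' (hK hk hk' hne)

theorem eq_of_mem_hopen₁ {ι : Type*} {K : Set ι} {J : ι → NonemptyInterval EReal}
    (hK : K.Pairwise fun k k' => Nonoverlapping (J k) (J k')) {p : EReal} {k k' : ι}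
    (hk : k ∈ K) (hk' : k' ∈ K) (h : p ∈ hopen₁ (J k)) (h' : p ∈ hopen₁ (J k')) : k = k' := by
  have := neBot_nhdsLT (bot_le.trans_lt h.1)
  by_contra hne
  exact not_nonoverlapping_of_hopen eventually_interior₁ h h' (hK hk hk' hne)

theorem exists_mem_hopen {ι : Type*} {K : Finset ι} {J : ι → NonemptyInterval RBar2}
    (hK : ⋃ k ∈ K, (J k : Set RBar2) = Set.univ) {p : RBar2} (h1 : ⊥ < p.1) (h2 : ⊥ < p.2) :
    ∃ k ∈ K, p ∈ hopen (J k) := by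
  have := neBot_nhdsLT h1
  have := neBot_nhdsLT h2
  exact exists_hopen_of_cover hK mem_hopen_of_frequently

theorem exists_mem_hopen₁ {ι : Type*} {K : Finset ι} {J : ι → NonemptyInterval EReal}
    (hK : ⋃ k ∈ K, (J k : Set EReal) = Set.univ) {p : EReal} (h1 : ⊥ < p) :
    ∃ k ∈ K, p ∈ hopen₁ (J k) := by
  have := neBot_nhdsLT h1
  exact exists_hopen_of_cover hK mem_hopen₁_of_frequently

/-! Summation by parts -/

theorem sum_by_parts (a b : ℕ → ℝ) (N : ℕ) (hb : b 0 = 0) :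
    ∑ i ∈ Finset.range N, a i * (b (i + 1) - b i) =
      a N * b N - ∑ i ∈ Finset.range N, b (i + 1) * (a (i + 1) - a i) := by
  induction N with
  | zero => simp [hb]
  | succ N ih => rw [Finset.sum_range_succ, Finset.sum_range_succ, ih]; ring

/-- One-variable summation by parts in `j`, then in `i`. All boundary terms at index `0` vanish by
hypothesis; the three remaining kinds of terms match the corner, edge and double integrals. -/
theorem sum_by_parts₂ (k Φ : ℕ → ℕ → ℝ) (N : ℕ) (h1 : ∀ j, Φ 0 j = 0) (h2 : ∀ i, Φ i 0 = 0) :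
    ∑ q ∈ Finset.range N ×ˢ Finset.range N, k q.1 q.2 *
        (Φ q.1 q.2 + Φ (q.1 + 1) (q.2 + 1) - Φ q.1 (q.2 + 1) - Φ (q.1 + 1) q.2) =
      k N N * Φ N N - ∑ i ∈ Finset.range N, Φ (i + 1) N * (k (i + 1) N - k i N)
        - ∑ j ∈ Finset.range N, Φ N (j + 1) * (k N (j + 1) - k N j)
        + ∑ q ∈ Finset.range N ×ˢ Finset.range N, Φ (q.1 + 1) (q.2 + 1) *
          (k q.1 q.2 + k (q.1 + 1) (q.2 + 1) - k q.1 (q.2 + 1) - k (q.1 + 1) q.2) := by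
  have e1 : ∀ i, ∑ j ∈ Finset.range N, k i j *
      (Φ i j + Φ (i + 1) (j + 1) - Φ i (j + 1) - Φ (i + 1) j) =
      k i N * (Φ (i + 1) N - Φ i N) -
        ∑ j ∈ Finset.range N, (k i (j + 1) - k i j) * (Φ (i + 1) (j + 1) - Φ i (j + 1)) := by
    intro i
    have := sum_by_parts (fun j => k i j) (fun j => Φ (i + 1) j - Φ i j) N (by simp [h2])
    refine Eq.trans (Finset.sum_congr rfl fun j _ => ?_) (this.trans ?_)
    · ring
    · congr 1
      exact Finset.sum_congr rfl fun j _ => mul_comm _ _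
  have e2 : ∀ j, ∑ i ∈ Finset.range N,
      (k i (j + 1) - k i j) * (Φ (i + 1) (j + 1) - Φ i (j + 1)) =
      (k N (j + 1) - k N j) * Φ N (j + 1) - ∑ i ∈ Finset.range N, Φ (i + 1) (j + 1) *
        (k i j + k (i + 1) (j + 1) - k i (j + 1) - k (i + 1) j) := by
    intro j
    have := sum_by_parts (fun i => k i (j + 1) - k i j) (fun i => Φ i (j + 1)) N (h1 _)
    refine this.trans ?_
    congr 1
    exact Finset.sum_congr rfl fun i _ => by ring
  have e3 := sum_by_parts (fun i => k i N) (fun i => Φ i N) N (h1 _)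
  rw [Finset.sum_product]
  simp only [e1]
  rw [Finset.sum_sub_distrib, e3, Finset.sum_comm]
  simp only [e2]
  rw [Finset.sum_sub_distrib, Finset.sum_product, Finset.sum_comm (s := Finset.range N)
    (t := Finset.range N) (f := fun i j => Φ (i + 1) (j + 1) *
        (k i j + k (i + 1) (j + 1) - k i (j + 1) - k (i + 1) j))]
  simp only [mul_comm (Φ N _)]
  ring

/-! Sums over the standard grids -/

theorem sum_abs_le_toReal {ι : Type*} {K : Finset ι} {m : ι → ℝ} {V : ℝ≥0∞} (hV : V < ∞)
    (h : ∑ k ∈ K, ‖m k‖ₑ ≤ V) : ∑ k ∈ K, |m k| ≤ V.toReal := by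
  have := ENNReal.toReal_mono hV.ne h
  rwa [ENNReal.toReal_sum (fun _ _ => enorm_ne_top)] at this

theorem Grid.sum_abs_inc₂_le {s : Finset EReal} (G : Grid s) {g : RBar2 → ℝ} (hg : V₁₂ g < ∞) :
    ∑ q ∈ G.idx, |inc₂ g (G.box q)| ≤ (V₁₂ g).toReal :=
  sum_abs_le_toReal hg (sum_cell_le g G.mono G.mono G.zero G.last G.zero G.last)

theorem Grid.sum_abs_inc₁_le {s : Finset EReal} (G : Grid s) {k : EReal → ℝ}
    (hk : eVariationOn k Set.univ < ∞) :
    ∑ i ∈ Finset.range (G.n + 1), |k (G.u (i + 1)) - k (G.u i)| ≤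
      (eVariationOn k Set.univ).toReal := by
  refine sum_abs_le_toReal hk (le_trans (le_of_eq ?_) (eVariationOn.sum_le (f := k)
    (n := G.n + 1) G.mono fun i => Set.mem_univ _))
  simp only [edist_eq_enorm_sub]

/-- Sum of `F` against the increments of `g` over the cells of a grid, tags in the upper corners. -/
def sum₂ (s : Finset EReal) (F g : RBar2 → ℝ) : ℝ :=
  ∑ q ∈ (theGrid s).idx, inc₂ g ((theGrid s).box q) *
    F ((theGrid s).u (q.1 + 1), (theGrid s).u (q.2 + 1))

/-- Sum of `F` against the increments of `k` over a grid, tags in the right ends. -/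
def sum₁ (s : Finset EReal) (F k : EReal → ℝ) : ℝ :=
  ∑ i ∈ Finset.range ((theGrid s).n + 1),
    (k ((theGrid s).u (i + 1)) - k ((theGrid s).u i)) * F ((theGrid s).u (i + 1))

/-- Sum of `g` against the increments of `F` over the cells of a grid, tags in the lower corners. -/
def gridSum (s : Finset EReal) (F g : RBar2 → ℝ) : ℝ :=
  ∑ q ∈ (theGrid s).idx, g ((theGrid s).u q.1, (theGrid s).u q.2) *
    inc₂ F ((theGrid s).box q)

theorem gridSum_eq (s : Finset EReal) {F : RBar2 → ℝ} (hF : ∀ x, F (⊥, x) = 0 ∧ F (x, ⊥) = 0)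
    (g : RBar2 → ℝ) :
    gridSum s F g = F (⊤, ⊤) * g (⊤, ⊤) - sum₁ s (fun x => F (x, ⊤)) (fun x => g (x, ⊤)) -
      sum₁ s (fun y => F (⊤, y)) (fun y => g (⊤, y)) + sum₂ s F g := by
  set G := theGrid s with hG
  have := sum_by_parts₂ (fun i j => g (G.u i, G.u j)) (fun i j => F (G.u i, G.u j)) (G.n + 1)
    (fun j => by rw [G.zero]; exact (hF _).1) (fun j => by rw [G.zero]; exact (hF _).2)
  simp only [G.last] at this
  refine this.trans ?_
  simp only [sum₁, sum₂, ← hG, inc₂, cell, mul_comm]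

/-- The bound does not depend on `s` as long as the grid contains all corners, so it survives the
passage to the limit over finer grids. -/
theorem abs_sum_sub_sum₂_le {ι : Type*} {K : Finset ι} {J : ι → NonemptyInterval RBar2}
    {w : ι → ℝ} {F g : RBar2 → ℝ} {ε : ℝ} (hε : 0 ≤ ε) (hg : V₁₂ g < ∞)
    (hA : ∀ p : RBar2, ⊥ < p.1 → ⊥ < p.2 → ∃ k ∈ K, p ∈ hopen (J k) ∧
      ∀ k' ∈ K, p ∈ hopen (J k') → k' = k)
    (hw : ∀ k ∈ K, ∀ p ∈ hopen (J k), |w k - F p| ≤ ε) {s : Finset EReal}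
    (hs : ∀ k ∈ K, (J k).fst.1 ∈ s ∧ (J k).fst.2 ∈ s ∧ (J k).snd.1 ∈ s ∧ (J k).snd.2 ∈ s) :
    |∑ k ∈ K, w k * inc₂ g (J k) - sum₂ s F g| ≤ ε * (V₁₂ g).toReal := by
  refine abs_sum_sub_sum_le K (theGrid s).idx (fun k => hopen (J k)) w _ _
    (fun q => ((theGrid s).u (q.1 + 1), (theGrid s).u (q.2 + 1))) F hε
    ((theGrid s).sum_abs_inc₂_le hg) ?_ ?_ hw
  · intro k hk
    obtain ⟨h1, h2, h3, h4⟩ := hs k hk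
    exact (theGrid s).sum_ite_inc₂ g (J k) h1 h2 h3 h4
  · intro q hq
    have := Finset.mem_product.1 hq
    exact hA _ ((theGrid s).bot_lt (Finset.mem_range.1 this.1))
      ((theGrid s).bot_lt (Finset.mem_range.1 this.2))

theorem abs_sum_sub_sum₁_le {ι : Type*} {K : Finset ι} {J : ι → NonemptyInterval EReal}
    {w : ι → ℝ} {F k : EReal → ℝ} {ε : ℝ} (hε : 0 ≤ ε) (hk : eVariationOn k Set.univ < ∞)
    (hA : ∀ p : EReal, ⊥ < p → ∃ k ∈ K, p ∈ hopen₁ (J k) ∧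
      ∀ k' ∈ K, p ∈ hopen₁ (J k') → k' = k)
    (hw : ∀ k ∈ K, ∀ p ∈ hopen₁ (J k), |w k - F p| ≤ ε) {s : Finset EReal}
    (hs : ∀ k ∈ K, (J k).fst ∈ s ∧ (J k).snd ∈ s) :
    |∑ i ∈ K, w i * inc₁ k (J i) - sum₁ s F k| ≤ ε * (eVariationOn k Set.univ).toReal := by
  refine abs_sum_sub_sum_le K (Finset.range ((theGrid s).n + 1)) (fun k => hopen₁ (J k)) w _ _
    (fun i => (theGrid s).u (i + 1)) F hε ((theGrid s).sum_abs_inc₁_le hk) ?_ ?_ hw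
  · intro i hi
    obtain ⟨h1, h2⟩ := hs i hi
    exact (theGrid s).sum_ite_inc₁ k (J i) h1 h2
  · intro i hi
    exact hA _ ((theGrid s).bot_lt (Finset.mem_range.1 hi))

/-! ### Limits along ever finer grids. -/

/-- An ultrafilter that contains, for each finite set, the collection of its supersets. -/
def ult : Ultrafilter (Finset EReal) := Ultrafilter.of atTop

theorem eventually_superset (s : Finset EReal) : ∀ᶠ t in (ult : Filter (Finset EReal)), s ⊆ t :=
  Ultrafilter.of_le atTop (eventually_ge_atTop s)

/-- Compactness of `[-C, C]`: along an ultrafilter boundedness alone gives a limit, so no Cauchy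
estimate for the grid sums is needed. -/
theorem exists_tendsto_ult {a : Finset EReal → ℝ} {C : ℝ} (h : ∀ s, |a s| ≤ C) :
    ∃ L, Tendsto a ult (𝓝 L) := by
  obtain ⟨L, -, hL⟩ := isCompact_Icc.ultrafilter_le_nhds (ult.map a) (s := Set.Icc (-C) C)
    (by
      rw [le_principal_iff]
      exact Ultrafilter.mem_map.2 (univ_mem' fun s => abs_le.1 (h s)))
  exact ⟨L, hL⟩

theorem abs_sum₂_le (s : Finset EReal) {F g : RBar2 → ℝ} {M : ℝ} (hM : ∀ p, |F p| ≤ M)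
    (hg : V₁₂ g < ∞) : |sum₂ s F g| ≤ M * (V₁₂ g).toReal := by
  have hM0 : 0 ≤ M := (abs_nonneg _).trans (hM (⊤, ⊤))
  refine (Finset.abs_sum_le_sum_abs _ _).trans (le_trans (Finset.sum_le_sum fun q _ => ?_)
    ((Finset.mul_sum _ _ M).symm.le.trans (mul_le_mul_of_nonneg_left
      ((theGrid s).sum_abs_inc₂_le hg) hM0)))
  rw [abs_mul, mul_comm]
  exact mul_le_mul_of_nonneg_right (hM _) (abs_nonneg _)

theorem abs_sum₁_le (s : Finset EReal) {F k : EReal → ℝ} {M : ℝ} (hM : ∀ p, |F p| ≤ M)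
    (hk : eVariationOn k Set.univ < ∞) :
    |sum₁ s F k| ≤ M * (eVariationOn k Set.univ).toReal := by
  have hM0 : 0 ≤ M := (abs_nonneg _).trans (hM ⊤)
  refine (Finset.abs_sum_le_sum_abs _ _).trans (le_trans (Finset.sum_le_sum fun q _ => ?_)
    ((Finset.mul_sum _ _ M).symm.le.trans (mul_le_mul_of_nonneg_left
      ((theGrid s).sum_abs_inc₁_le hk) hM0)))
  rw [abs_mul, mul_comm]
  exact mul_le_mul_of_nonneg_right (hM _) (abs_nonneg _)

theorem IsHKBV.V₁_lt_top {g : RBar2 → ℝ} (hg : IsHKBV g) (y : EReal) : V₁ g y < ∞ := by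
  obtain ⟨h12, x₀, y₀, h1, h2⟩ := hg
  exact (V₁_le g y y₀).trans_lt (ENNReal.add_lt_top.2 ⟨h1, h12⟩)

theorem IsHKBV.V₂_lt_top {g : RBar2 → ℝ} (hg : IsHKBV g) (x : EReal) : V₂ g x < ∞ := by
  obtain ⟨h12, x₀, y₀, h1, h2⟩ := hg
  exact (V₂_le g x x₀).trans_lt (ENNReal.add_lt_top.2 ⟨h2, h12⟩)

theorem sum_toReal_le_norm {g : RBar2 → ℝ} (hg : IsHKBV g) :
    |g (⊤, ⊤)| + (V₁ g ⊤).toReal + (V₂ g ⊤).toReal + (V₁₂ g).toReal ≤ (hkENorm g).toReal := by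
  have h := hg.hkENorm_lt_top
  have hle : ‖g (⊤, ⊤)‖ₑ + V₁ g ⊤ + V₂ g ⊤ + V₁₂ g ≤ hkENorm g :=
    add_le_add (add_le_add (add_le_add (le_iSup (fun p => ‖g p‖ₑ) _) (le_iSup (V₁ g) _))
      (le_iSup (V₂ g) _)) le_rfl
  have := ENNReal.toReal_mono h.ne hle
  rwa [ENNReal.toReal_add (by simp [(hg.V₁_lt_top ⊤).ne, (hg.V₂_lt_top ⊤).ne]) hg.1.ne,
    ENNReal.toReal_add (by simp [(hg.V₁_lt_top ⊤).ne]) (hg.V₂_lt_top ⊤).ne,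
    ENNReal.toReal_add (by simp) (hg.V₁_lt_top ⊤).ne, toReal_enorm] at this

/-- After summation by parts each of the four terms is at most `‖F‖` times one of the four terms in
`sum_toReal_le_norm`. -/
theorem abs_gridSum_le (s : Finset EReal) (F : Bc) {g : RBar2 → ℝ} (hg : IsHKBV g) :
    |gridSum s F.1 g| ≤ ‖F‖ * (hkENorm g).toReal := by
  have hb : ∀ p, |F.1 p| ≤ ‖F‖ := F.1.norm_coe_le_norm
  rw [gridSum_eq s F.2]
  have e0 : |F.1 (⊤, ⊤) * g (⊤, ⊤)| ≤ ‖F‖ * |g (⊤, ⊤)| := by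
    rw [abs_mul]
    exact mul_le_mul_of_nonneg_right (hb _) (abs_nonneg _)
  have e1 : |sum₁ s (fun x => F.1 (x, ⊤)) (fun x => g (x, ⊤))| ≤ ‖F‖ * (V₁ g ⊤).toReal :=
    abs_sum₁_le s (fun x => hb (x, ⊤)) (hg.V₁_lt_top ⊤)
  have e2 : |sum₁ s (fun y => F.1 (⊤, y)) (fun y => g (⊤, y))| ≤ ‖F‖ * (V₂ g ⊤).toReal :=
    abs_sum₁_le s (fun x => hb (⊤, x)) (hg.V₂_lt_top ⊤)
  have e3 := abs_sum₂_le s hb hg.1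
  have e4 := mul_le_mul_of_nonneg_left (sum_toReal_le_norm hg) (norm_nonneg F)
  rw [abs_le] at *
  constructor <;> linarith [e0.1, e0.2, e1.1, e1.2, e2.1, e2.2, e3.1, e3.2]

/-- The limit of the grid sums. -/
def pairing (F g : RBar2 → ℝ) : ℝ := limUnder (ult : Filter (Finset EReal)) fun s => gridSum s F g

theorem tendsto_pairing (F : Bc) {g : RBar2 → ℝ} (hg : IsHKBV g) :
    Tendsto (fun s => gridSum s F.1 g) ult (𝓝 (pairing F.1 g)) :=
  tendsto_nhds_limUnder (exists_tendsto_ult fun s => abs_gridSum_le s F hg)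

/-! Existence of the integrals -/

theorem coe_top_nonemptyInterval {α : Type*} [PartialOrder α] [BoundedOrder α] :
    ((⊤ : NonemptyInterval α) : Set α) = Set.univ :=
  Set.eq_univ_of_forall fun _ => ⟨bot_le, le_top⟩

theorem hasHSIntegral_of_forall {α : Type*} [TopologicalSpace α] [PartialOrder α]
    {I : NonemptyInterval α} {F : α → ℝ} (hF : Continuous F) {Δ : NonemptyInterval α → ℝ} {A V : ℝ}
    (hV : 0 ≤ V)
    (h : ∀ ε > 0, ∀ P : Finset (NonemptyInterval α × α), IsTaggedDivision I P →
      (∀ q ∈ P, ∀ p ∈ q.1, |F q.2 - F p| ≤ ε) → |∑ q ∈ P, F q.2 * Δ q.1 - A| ≤ ε * V) :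
    HasHSIntegral I F Δ A := by
  intro ε hε
  -- The gauge at `p` is the open set where `F` differs from `F p` by less than `ε / (V + 1)`; the
  -- `+ 1` covers `V = 0`.
  have hδ : 0 < ε / (V + 1) := by positivity
  refine ⟨fun p => {p' | |F p - F p'| < ε / (V + 1)}, fun p => ⟨?_, ?_⟩, fun P hP hγ => ?_⟩
  · exact isOpen_lt (by fun_prop) continuous_const
  · simpa using hδ
  · refine (h _ hδ P hP fun q hq p hp => (hγ q hq hp).le).trans_lt ?_
    rw [div_mul_eq_mul_div, div_lt_iff₀ (by positivity)]
    linarith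

/-- For a fixed tagged division the grid eventually contains all its corners. The comparison with
the grid sums then passes to the limit, which identifies the ultrafilter limit with the integral. -/
theorem hasHSIntegral₂ {F g : RBar2 → ℝ} (hF : Continuous F) (hg : V₁₂ g < ∞) {A : ℝ}
    (hA : Tendsto (fun s => sum₂ s F g) ult (𝓝 A)) : HasHSIntegral ⊤ F (inc₂ g) A := by
  classical
  refine hasHSIntegral_of_forall hF (ENNReal.toReal_nonneg (a := V₁₂ g)) fun ε hε P hP hP' => ?_
  obtain ⟨h1, h2, h3⟩ := hP
  rw [coe_top_nonemptyInterval] at h2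
  refine le_of_tendsto ((tendsto_const_nhds.sub hA).abs) ?_
  filter_upwards [eventually_superset (P.image (fun q => q.1.fst.1) ∪ P.image (fun q => q.1.fst.2) ∪
    P.image (fun q => q.1.snd.1) ∪ P.image (fun q => q.1.snd.2))] with s hs
  refine abs_sum_sub_sum₂_le hε.le hg (fun p hp hp' => ?_) (fun q hq p hp => ?_) (fun q hq => ?_)
  · obtain ⟨k, hk, hpk⟩ := exists_mem_hopen h2 hp hp'
    exact ⟨k, hk, hpk, fun k' hk' hpk' => eq_of_mem_hopen h1 hk' hk hpk' hpk⟩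
  · exact hP' q hq p ⟨⟨hp.1.1.le, hp.2.1.le⟩, hp.1.2, hp.2.2⟩
  · refine ⟨hs ?_, hs ?_, hs ?_, hs ?_⟩ <;> simp only [Finset.mem_union, Finset.mem_image]
    · exact .inl (.inl (.inl ⟨q, hq, rfl⟩))
    · exact .inl (.inl (.inr ⟨q, hq, rfl⟩))
    · exact .inl (.inr ⟨q, hq, rfl⟩)
    · exact .inr ⟨q, hq, rfl⟩

theorem hasHSIntegral₁ {F k : EReal → ℝ} (hF : Continuous F) (hk : eVariationOn k Set.univ < ∞)
    {A : ℝ} (hA : Tendsto (fun s => sum₁ s F k) ult (𝓝 A)) : HasHSIntegral ⊤ F (inc₁ k) A := by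
  classical
  refine hasHSIntegral_of_forall hF (ENNReal.toReal_nonneg (a := eVariationOn k Set.univ))
    fun ε hε P hP hP' => ?_
  obtain ⟨h1, h2, h3⟩ := hP
  rw [coe_top_nonemptyInterval] at h2
  refine le_of_tendsto ((tendsto_const_nhds.sub hA).abs) ?_
  filter_upwards [eventually_superset (P.image (fun q => q.1.fst) ∪ P.image (fun q => q.1.snd))]
    with s hs
  refine abs_sum_sub_sum₁_le hε.le hk (fun p hp => ?_) (fun q hq p hp => ?_) (fun q hq => ?_)
  · obtain ⟨k, hk, hpk⟩ := exists_mem_hopen₁ h2 hp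
    exact ⟨k, hk, hpk, fun k' hk' hpk' => eq_of_mem_hopen₁ h1 hk' hk hpk' hpk⟩
  · exact hP' q hq p ⟨hp.1.le, hp.2⟩
  · refine ⟨hs ?_, hs ?_⟩ <;> simp only [Finset.mem_union, Finset.mem_image]
    · exact .inl ⟨q, hq, rfl⟩
    · exact .inr ⟨q, hq, rfl⟩

theorem hasHSIntegral_zero {α : Type*} [TopologicalSpace α] [PartialOrder α]
    {I : NonemptyInterval α} {F : α → ℝ} (hF : ∀ p, F p = 0) (Δ : NonemptyInterval α → ℝ) :
    HasHSIntegral I F Δ 0 := fun ε hε =>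
  ⟨fun _ => Set.univ, fun _ => ⟨isOpen_univ, trivial⟩, fun P _ _ => by simpa [hF] using hε⟩

theorem continuous_slices (F : C(RBar2, ℝ)) :
    Continuous (fun x => F (x, ⊤)) ∧ Continuous (fun y => F (⊤, y)) := by
  constructor <;> fun_prop

theorem exists_tendsto_sums (F : C(RBar2, ℝ)) {g : RBar2 → ℝ} (hg : IsHKBV g) :
    ∃ S T U : ℝ, Tendsto (fun s => sum₁ s (fun x => F (x, ⊤)) fun x => g (x, ⊤)) ult (𝓝 S) ∧
      Tendsto (fun s => sum₁ s (fun y => F (⊤, y)) fun y => g (⊤, y)) ult (𝓝 T) ∧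
      Tendsto (fun s => sum₂ s F g) ult (𝓝 U) := by
  have hb : ∀ p, |F p| ≤ ‖F‖ := F.norm_coe_le_norm
  obtain ⟨S, hS⟩ := exists_tendsto_ult (fun s => abs_sum₁_le s (fun x => hb (x, ⊤))
    (hg.V₁_lt_top ⊤))
  obtain ⟨T, hT⟩ := exists_tendsto_ult (fun s => abs_sum₁_le s (fun x => hb (⊤, x))
    (hg.V₂_lt_top ⊤))
  obtain ⟨U, hU⟩ := exists_tendsto_ult (fun s => abs_sum₂_le s hb hg.1)
  exact ⟨S, T, U, hS, hT, hU⟩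

theorem pairing_eq (F : Bc) {g : RBar2 → ℝ} (hg : IsHKBV g) {S T U : ℝ}
    (hS : Tendsto (fun s => sum₁ s (fun x => F.1 (x, ⊤)) fun x => g (x, ⊤)) ult (𝓝 S))
    (hT : Tendsto (fun s => sum₁ s (fun y => F.1 (⊤, y)) fun y => g (⊤, y)) ult (𝓝 T))
    (hU : Tendsto (fun s => sum₂ s F.1 g) ult (𝓝 U)) :
    pairing F.1 g = F.1 (⊤, ⊤) * g (⊤, ⊤) - S - T + U := by
  refine tendsto_nhds_unique (tendsto_pairing F hg) ?_
  simp only [fun s => gridSum_eq s F.2 g]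
  exact ((tendsto_const_nhds.sub hS).sub hT).add hU

theorem hasIntegralMul_pairing (f : Ac) {g : RBar2 → ℝ} (hg : IsHKBV g) :
    HasIntegralMul ⊤ f g (pairing (primitive f).1 g) := by
  obtain ⟨S, T, U, hS, hT, hU⟩ := exists_tendsto_sums (primitive f).1 hg
  have hF := (primitive f).2
  -- The integrals along the edges `y = ⊥` and `x = ⊥` are zero because `F` vanishes there.
  refine ⟨S, 0, T, 0, U, hasHSIntegral₁ (continuous_slices _).1 (hg.V₁_lt_top ⊤) hS,
    hasHSIntegral_zero (fun x => (hF x).2) _, hasHSIntegral₁ (continuous_slices _).2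
    (hg.V₂_lt_top ⊤) hT, hasHSIntegral_zero (fun x => (hF x).1) _,
    hasHSIntegral₂ (primitive f).1.continuous hg.1 hU, ?_⟩
  rw [pairing_eq _ hg hS hT hU]
  have e : ∀ x, (primitive f).1 (⊥, x) = 0 := fun x => (hF x).1
  have e' : ∀ x, (primitive f).1 (x, ⊥) = 0 := fun x => (hF x).2
  change _ = (primitive f).1 (⊥, ⊥) * g (⊥, ⊥) + (primitive f).1 (⊤, ⊤) * g (⊤, ⊤) -
    (primitive f).1 (⊥, ⊤) * g (⊥, ⊤) - (primitive f).1 (⊤, ⊥) * g (⊤, ⊥) - S + 0 - T + 0 + U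
  rw [e, e, e']
  ring

/-! The pairing as a bilinear map -/

theorem gridSum_add_left (s : Finset EReal) (F F' g : RBar2 → ℝ) :
    gridSum s (F + F') g = gridSum s F g + gridSum s F' g := by
  simp only [gridSum, ← Finset.sum_add_distrib]
  refine Finset.sum_congr rfl fun q _ => ?_
  simp only [inc₂, Pi.add_apply]; ring

theorem gridSum_smul_left (s : Finset EReal) (c : ℝ) (F g : RBar2 → ℝ) :
    gridSum s (c • F) g = c * gridSum s F g := by
  simp only [gridSum, Finset.mul_sum]
  refine Finset.sum_congr rfl fun q _ => ?_
  simp only [inc₂, Pi.smul_apply, smul_eq_mul]; ring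

theorem gridSum_add_right (s : Finset EReal) (F g g' : RBar2 → ℝ) :
    gridSum s F (g + g') = gridSum s F g + gridSum s F g' := by
  simp only [gridSum, ← Finset.sum_add_distrib, Pi.add_apply, add_mul]

theorem gridSum_smul_right (s : Finset EReal) (c : ℝ) (F g : RBar2 → ℝ) :
    gridSum s F (c • g) = c * gridSum s F g := by
  simp only [gridSum, Finset.mul_sum, Pi.smul_apply, smul_eq_mul, mul_assoc]

theorem pairing_add_left (F F' : Bc) {g : RBar2 → ℝ} (hg : IsHKBV g) :
    pairing (F + F').1 g = pairing F.1 g + pairing F'.1 g :=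
  tendsto_nhds_unique (tendsto_pairing (F + F') hg)
    (((tendsto_pairing F hg).add (tendsto_pairing F' hg)).congr fun s =>
      (gridSum_add_left s _ _ _).symm)

theorem pairing_smul_left (c : ℝ) (F : Bc) {g : RBar2 → ℝ} (hg : IsHKBV g) :
    pairing (c • F).1 g = c * pairing F.1 g :=
  tendsto_nhds_unique (tendsto_pairing (c • F) hg)
    (((tendsto_pairing F hg).const_mul c).congr fun s => (gridSum_smul_left s _ _ _).symm)

theorem pairing_add_right (F : Bc) {g g' : RBar2 → ℝ} (hg : IsHKBV g) (hg' : IsHKBV g') :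
    pairing F.1 (g + g') = pairing F.1 g + pairing F.1 g' :=
  tendsto_nhds_unique (tendsto_pairing F (hkbvSubmodule.add_mem hg hg'))
    (((tendsto_pairing F hg).add (tendsto_pairing F hg')).congr fun s =>
      (gridSum_add_right s _ _ _).symm)

theorem pairing_smul_right (c : ℝ) (F : Bc) {g : RBar2 → ℝ} (hg : IsHKBV g) :
    pairing F.1 (c • g) = c * pairing F.1 g :=
  tendsto_nhds_unique (tendsto_pairing F (hkbvSubmodule.smul_mem c hg))
    (((tendsto_pairing F hg).const_mul c).congr fun s => (gridSum_smul_right s _ _ _).symm)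

theorem abs_pairing_le (F : Bc) {g : RBar2 → ℝ} (hg : IsHKBV g) :
    |pairing F.1 g| ≤ ‖F‖ * (hkENorm g).toReal :=
  le_of_tendsto (tendsto_pairing F hg).abs (Eventually.of_forall fun s => abs_gridSum_le s F hg)

/-- The functional `f ↦ ∫∫ f g`, linear in `g`. -/
def toDual (N : Normalisation) : NHKBV N →L[ℝ] StrongDual ℝ Ac :=
  LinearMap.mkContinuous₂
    (LinearMap.mk₂ ℝ (fun (g : NHKBV N) (f : Ac) => pairing (primitive f).1 g.1.1)
      (fun g g' f => pairing_add_right _ g.1.2 g'.1.2)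
      (fun c g f => pairing_smul_right c _ g.1.2)
      (fun g f f' => by rw [map_add]; exact pairing_add_left _ _ g.1.2)
      (fun c g f => by rw [map_smul]; exact pairing_smul_left c _ g.1.2))
    1 fun g f => by
      rw [one_mul, mul_comm]
      exact abs_pairing_le (primitive f) g.1.2

theorem toDual_apply {N : Normalisation} (g : NHKBV N) (f : Ac) :
    toDual N g f = pairing (primitive f).1 g.1.1 := rfl

/-! ### Injectivity: testing against products of ramps. -/

/-- An order isomorphism between the extended real line and the unit interval. -/
def unitIso : EReal ≃o Set.Icc (0 : ℝ) 1 :=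
  EReal.expOrderIso.trans ENNReal.orderIsoUnitIntervalBirational

/-- The coordinate in `[0, 1]` of an extended real number. -/
def unitCoord (x : EReal) : ℝ := unitIso x

theorem strictMono_unitCoord : StrictMono unitCoord := fun _ _ h => unitIso.strictMono h

theorem continuous_unitCoord : Continuous unitCoord :=
  continuous_subtype_val.comp unitIso.continuous

theorem unitCoord_mem (x : EReal) : unitCoord x ∈ Set.Icc (0 : ℝ) 1 := (unitIso x).2

/-- Continuous increasing functions from `0` to `1` with increase inside a given interval. -/
theorem exists_ramp {a b : EReal} (hab : a < b) : ∃ φ : C(EReal, ℝ), Monotone φ ∧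
    (∀ x ≤ a, φ x = 0) ∧ (∀ x, b ≤ x → φ x = 1) := by
  have h : 0 < unitCoord b - unitCoord a := sub_pos.2 (strictMono_unitCoord hab)
  refine ⟨⟨fun x => max 0 (min 1 ((unitCoord x - unitCoord a) / (unitCoord b - unitCoord a))),
    ?_⟩, ?_, ?_, ?_⟩
  · have := continuous_unitCoord
    fun_prop
  · intro x y hxy
    have := strictMono_unitCoord.monotone hxy
    simp only [ContinuousMap.coe_mk]
    gcongr
  · intro x hx
    have := strictMono_unitCoord.monotone hx
    exact max_eq_left ((min_le_right _ _).trans (div_nonpos_of_nonpos_of_nonneg (by linarith) h.le))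
  · intro x hx
    have := strictMono_unitCoord.monotone hx
    have h1 : 1 ≤ (unitCoord x - unitCoord a) / (unitCoord b - unitCoord a) := by
      rw [le_div_iff₀ h]; linarith
    simp [min_eq_left h1]

/-- The function `φ(x) ψ(y)`. -/
def tensor (φ ψ : C(EReal, ℝ)) (hφ : φ ⊥ = 0) (hψ : ψ ⊥ = 0) : Bc :=
  ⟨⟨fun p => φ p.1 * ψ p.2, by fun_prop⟩, fun s => ⟨by simp [hφ], by simp [hψ]⟩⟩

/-- The increments of `φ ⊗ ψ` over the cells are nonnegative with sum 1, so the grid sum is a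
weighted mean of values of `g`. Only cells whose lower corner lies in `[a, b) × [c, d)` have nonzero
weight. -/
theorem gridSum_tensor_sub_le {s : Finset EReal} {φ ψ : C(EReal, ℝ)} {a b c d : EReal}
    (hφm : Monotone φ) (hψm : Monotone ψ) (hφ0 : ∀ x ≤ a, φ x = 0) (hφ1 : ∀ x, b ≤ x → φ x = 1)
    (hψ0 : ∀ x ≤ c, ψ x = 0) (hψ1 : ∀ x, d ≤ x → ψ x = 1) (ha : a ∈ s) (hc : c ∈ s)
    {g : RBar2 → ℝ} {C ε : ℝ}
    (h : ∀ x ∈ Set.Ico a b, ∀ y ∈ Set.Ico c d, |g (x, y) - C| ≤ ε) :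
    |gridSum s (tensor φ ψ (hφ0 _ bot_le) (hψ0 _ bot_le)).1 g - C| ≤ ε := by
  set G := theGrid s with hG
  have e1 : ∑ i ∈ Finset.range (G.n + 1), (φ (G.u (i + 1)) - φ (G.u i)) = 1 := by
    rw [Finset.sum_range_sub (fun i => φ (G.u i)), G.zero, G.last, hφ0 _ bot_le, hφ1 _ le_top,
      sub_zero]
  have e2 : ∑ i ∈ Finset.range (G.n + 1), (ψ (G.u (i + 1)) - ψ (G.u i)) = 1 := by
    rw [Finset.sum_range_sub (fun i => ψ (G.u i)), G.zero, G.last, hψ0 _ bot_le, hψ1 _ le_top,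
      sub_zero]
  have e3 : ∑ q ∈ G.idx, (φ (G.u (q.1 + 1)) - φ (G.u q.1)) * (ψ (G.u (q.2 + 1)) - ψ (G.u q.2)) = 1 := by
    rw [Finset.sum_product]
    exact (Finset.sum_mul_sum _ _ _ _).symm.trans ((congrArg₂ (· * ·) e1 e2).trans (one_mul 1))
  have e4 : gridSum s (tensor φ ψ (hφ0 _ bot_le) (hψ0 _ bot_le)).1 g - C =
      ∑ q ∈ G.idx, (g (G.u q.1, G.u q.2) - C) *
        ((φ (G.u (q.1 + 1)) - φ (G.u q.1)) * (ψ (G.u (q.2 + 1)) - ψ (G.u q.2))) := by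
    simp only [sub_mul (g _), Finset.sum_sub_distrib, ← Finset.mul_sum, e3, mul_one]
    congr 1
    refine Finset.sum_congr rfl fun q _ => ?_
    rw [← hG]
    congr 1
    simp only [inc₂, cell, tensor, ContinuousMap.coe_mk]
    ring
  have key : ∀ {χ : C(EReal, ℝ)} {a b : EReal} (i : ℕ), Monotone χ → (∀ x ≤ a, χ x = 0) →
      (∀ x, b ≤ x → χ x = 1) → a ∈ s → i < G.n + 1 → χ (G.u (i + 1)) - χ (G.u i) ≠ 0 →
      G.u i ∈ Set.Ico a b := by
    intro χ a b i hm h0 h1 ha hi hne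
    constructor
    · by_contra hlt
      push Not at hlt
      refine hne ?_
      -- Since `a` is a node, no interval of the grid straddles it.
      have : G.u (i + 1) ≤ a := by
        by_contra h'
        exact G.not_between ha (by omega) ⟨hlt, not_le.1 h'⟩
      rw [h0 _ this, h0 _ hlt.le, sub_zero]
    · by_contra hle
      push Not at hle
      exact hne (by rw [h1 _ hle, h1 _ (hle.trans (G.mono i.le_succ)), sub_self])
  rw [e4]
  refine (Finset.abs_sum_le_sum_abs _ _).trans ?_
  rw [← mul_one ε, ← e3, Finset.mul_sum]
  refine Finset.sum_le_sum fun q hq => ?_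
  have h1 : 0 ≤ φ (G.u (q.1 + 1)) - φ (G.u q.1) := sub_nonneg.2 (hφm (G.mono q.1.le_succ))
  have h2 : 0 ≤ ψ (G.u (q.2 + 1)) - ψ (G.u q.2) := sub_nonneg.2 (hψm (G.mono q.2.le_succ))
  rw [abs_mul, abs_of_nonneg (mul_nonneg h1 h2)]
  obtain ⟨hq1, hq2⟩ := Finset.mem_product.1 hq
  by_cases h3 : φ (G.u (q.1 + 1)) - φ (G.u q.1) = 0
  · simp [h3]
  by_cases h4 : ψ (G.u (q.2 + 1)) - ψ (G.u q.2) = 0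
  · simp [h4]
  exact mul_le_mul_of_nonneg_right (h _ (key _ hφm hφ0 hφ1 ha (Finset.mem_range.1 hq1) h3) _
    (key _ hψm hψ0 hψ1 hc (Finset.mem_range.1 hq2) h4)) (mul_nonneg h1 h2)

/-- Each member of the filter contains an open interval. -/
def HasIntervals (l : Filter EReal) : Prop := ∀ U ∈ l, ∃ a b, a < b ∧ Set.Ioo a b ⊆ U

theorem hasIntervals_nhdsLT {x : EReal} (hx : ⊥ < x) : HasIntervals (𝓝[<] x) := fun U hU => by
  obtain ⟨a, ha, h⟩ := (mem_nhdsLT_iff_exists_Ioo_subset' hx).1 hU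
  exact ⟨a, x, ha, h⟩

theorem hasIntervals_nhdsGT {x : EReal} (hx : x < ⊤) : HasIntervals (𝓝[>] x) := fun U hU => by
  obtain ⟨a, ha, h⟩ := (mem_nhdsGT_iff_exists_Ioo_subset' hx).1 hU
  exact ⟨x, a, ha, h⟩

/-- If all pairings with `g` vanish, then the limits of `g` from inside vanish. -/
theorem limit_eq_zero {g : RBar2 → ℝ} (hg : IsHKBV g) (h0 : ∀ F : Bc, pairing F.1 g = 0)
    {l₁ l₂ : Filter EReal} (h1 : HasIntervals l₁) (h2 : HasIntervals l₂) {C : ℝ}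
    (hC : Tendsto g (l₁ ×ˢ l₂) (𝓝 C)) : C = 0 := by
  refine abs_eq_zero.1 (le_antisymm (le_of_forall_pos_le_add fun ε hε => ?_) (abs_nonneg _))
  have h3 := hC (Metric.closedBall_mem_nhds C hε)
  obtain ⟨U, hU, V, hV, hUV⟩ := Filter.mem_prod_iff.1 h3
  obtain ⟨a, b, hab, hU⟩ := h1 U hU
  obtain ⟨c, d, hcd, hV⟩ := h2 V hV
  -- The ramps rise strictly inside the open rectangle, so that the half-open rectangle `[a', b') ×
  -- [c', d')` of relevant nodes stays in it.
  obtain ⟨a', haa', ha'b⟩ := exists_between hab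
  obtain ⟨b', ha'b', hb'b⟩ := exists_between ha'b
  obtain ⟨c', hcc', hc'd⟩ := exists_between hcd
  obtain ⟨d', hc'd', hd'd⟩ := exists_between hc'd
  obtain ⟨φ, hφm, hφ0, hφ1⟩ := exists_ramp ha'b'
  obtain ⟨ψ, hψm, hψ0, hψ1⟩ := exists_ramp hc'd'
  have h4 := tendsto_pairing (tensor φ ψ (hφ0 _ bot_le) (hψ0 _ bot_le)) hg
  rw [h0] at h4
  have h5 : |0 - C| ≤ ε := by
    refine le_of_tendsto (h4.sub_const C).abs ?_
    filter_upwards [eventually_superset {a', c'}] with s hs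
    refine gridSum_tensor_sub_le hφm hψm hφ0 hφ1 hψ0 hψ1 (hs (by simp)) (hs (by simp))
      fun x hx y hy => ?_
    have : (x, y) ∈ U ×ˢ V :=
      ⟨hU ⟨haa'.trans_le hx.1, hx.2.trans hb'b⟩, hV ⟨hcc'.trans_le hy.1, hy.2.trans hd'd⟩⟩
    exact hUV this
  simpa using h5

/-- Every value of a normalised function, also on the edges and at the corners, is a combination of
limits from inside, and these vanish by `limit_eq_zero`. -/
theorem eq_zero_of_pairing {N : Normalisation} {g : RBar2 → ℝ} (hg : IsHKBV g)
    (hN : IsNormalisationOf N g g) (h0 : ∀ F : Bc, pairing F.1 g = 0) : g = 0 := by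
  have hl : ∀ x : ℝ, HasIntervals (𝓝[<] (x : EReal)) := fun x =>
    hasIntervals_nhdsLT (EReal.bot_lt_coe x)
  have hr : ∀ x : ℝ, HasIntervals (𝓝[>] (x : EReal)) := fun x =>
    hasIntervals_nhdsGT (EReal.coe_lt_top x)
  have ht : HasIntervals (𝓝[<] (⊤ : EReal)) := hasIntervals_nhdsLT bot_lt_top
  have hb : HasIntervals (𝓝[>] (⊥ : EReal)) := hasIntervals_nhdsGT bot_lt_top
  funext ⟨x, y⟩
  induction x using EReal.rec with
  | bot =>
    induction y using EReal.rec with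
    | bot => exact limit_eq_zero hg h0 hb hb hN.corner_bb
    | top => exact limit_eq_zero hg h0 hb ht hN.corner_bt
    | coe y =>
      obtain ⟨a, b, h1, h2, h3⟩ := hN.left y
      rw [h3, limit_eq_zero hg h0 hb (hl y) h1, limit_eq_zero hg h0 hb (hr y) h2]
      simp
  | top =>
    induction y using EReal.rec with
    | bot => exact limit_eq_zero hg h0 ht hb hN.corner_tb
    | top => exact limit_eq_zero hg h0 ht ht hN.corner_tt
    | coe y =>
      obtain ⟨a, b, h1, h2, h3⟩ := hN.right y
      rw [h3, limit_eq_zero hg h0 ht (hl y) h1, limit_eq_zero hg h0 ht (hr y) h2]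
      simp
  | coe x =>
    induction y using EReal.rec with
    | bot =>
      obtain ⟨a, b, h1, h2, h3⟩ := hN.bottom x
      rw [h3, limit_eq_zero hg h0 (hl x) hb h1, limit_eq_zero hg h0 (hr x) hb h2]
      simp
    | top =>
      obtain ⟨a, b, h1, h2, h3⟩ := hN.top x
      rw [h3, limit_eq_zero hg h0 (hl x) ht h1, limit_eq_zero hg h0 (hr x) ht h2]
      simp
    | coe y =>
      obtain ⟨a, b, c, d, h1, h2, h3, h4, h5⟩ := hN.plane x y
      rw [h5, limit_eq_zero hg h0 (hl x) (hl y) h1, limit_eq_zero hg h0 (hr x) (hr y) h2,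
        limit_eq_zero hg h0 (hl x) (hr y) h3, limit_eq_zero hg h0 (hr x) (hl y) h4]
      simp

theorem toDual_injective (N : Normalisation) : Function.Injective (toDual N) := by
  refine (injective_iff_map_eq_zero _).2 fun g hg => ?_
  have h0 : ∀ F : Bc, pairing F.1 g.1.1 = 0 := fun F => by
    have := congrArg (fun T => T (primitive.symm F)) hg
    simpa [toDual_apply] using this
  exact Subtype.ext (Subtype.ext (eq_zero_of_pairing g.1.2 g.2 h0))

/-! ### Grids with nodes in a dense set on which `F` oscillates little. -/

/-- Finitely many points of a dense set between which a continuous function on the extended real line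
varies by less than `ε`. -/
theorem exists_finset_dist_le {Y : Type*} [PseudoMetricSpace Y] {H : EReal → Y} (hH : Continuous H)
    {D : Set EReal} (hD : Dense D) {ε : ℝ} (hε : 0 < ε) :
    ∃ s : Finset EReal, (s : Set EReal) ⊆ D ∧ ∀ x x' : EReal, x ≤ x' →
      (∀ z ∈ s, z ∉ Set.Ioo x x') → dist (H x) (H x') ≤ ε := by
  classical
  have hc : UniformContinuous fun t : Set.Icc (0 : ℝ) 1 => H (unitIso.symm t) :=
    CompactSpace.uniformContinuous_of_continuous (hH.comp unitIso.symm.continuous)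
  obtain ⟨δ, hδ, hδ'⟩ := Metric.uniformContinuous_iff.1 hc ε hε
  -- One point of `D` is chosen in each of `n` equal parts of the unit interval. As `2 / n < δ`, an
  -- interval of coordinate length at least `δ` contains a whole part and hence a chosen point.
  obtain ⟨n, hn⟩ := exists_nat_gt (2 / δ)
  have hn0 : (0 : ℝ) < n := (by positivity : 0 < 2 / δ).trans hn
  have hz : ∀ i : ℕ, ∃ z ∈ D, i < n → (i / n : ℝ) < unitCoord z ∧ unitCoord z < ((i + 1 : ℕ) / n : ℝ) := by
    intro i
    by_cases hi : i < n
    · have hi' : ((i + 1 : ℕ) : ℝ) ≤ n := by exact_mod_cast hi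
      have hlt : (i / n : ℝ) < ((i + 1 : ℕ) / n : ℝ) := by
        push_cast
        gcongr
        linarith
      have m1 : (i / n : ℝ) ∈ Set.Icc (0 : ℝ) 1 :=
        ⟨by positivity, hlt.le.trans ((div_le_one hn0).2 hi')⟩
      have m2 : ((i + 1 : ℕ) / n : ℝ) ∈ Set.Icc (0 : ℝ) 1 :=
        ⟨by positivity, (div_le_one hn0).2 hi'⟩
      have : unitIso.symm ⟨_, m1⟩ < unitIso.symm ⟨_, m2⟩ := unitIso.symm.strictMono hlt
      obtain ⟨z, hz, hzD⟩ := hD.exists_between this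
      exact ⟨z, hz, fun _ => ⟨unitIso.symm_apply_lt.1 hzD.1, unitIso.lt_symm_apply.1 hzD.2⟩⟩
    · obtain ⟨z, hz⟩ := hD.nonempty
      exact ⟨z, hz, fun h => absurd h hi⟩
  choose z hzD hz using hz
  refine ⟨(Finset.range n).image z, ?_, fun x x' hxx' h => ?_⟩
  · intro w hw
    obtain ⟨i, -, rfl⟩ := Finset.mem_image.1 (Finset.mem_coe.1 hw)
    exact hzD i
  · have hlt : unitCoord x' - unitCoord x < δ := by
      by_contra hge
      push Not at hge
      have h2 : 2 / (n : ℝ) < δ := by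
        rw [div_lt_iff₀ hn0]; rwa [div_lt_iff₀ hδ, mul_comm] at hn
      obtain ⟨hx0, hx1⟩ := unitCoord_mem x
      obtain ⟨hx0', hx1'⟩ := unitCoord_mem x'
      set i := ⌈(n : ℝ) * unitCoord x⌉₊ with hi
      have h3 : (n : ℝ) * unitCoord x ≤ i := Nat.le_ceil _
      have h4 : (i : ℝ) < n * unitCoord x + 1 := Nat.ceil_lt_add_one (by positivity)
      have h5 : (i : ℝ) + 1 < n * unitCoord x' := by
        have : 2 < n * (unitCoord x' - unitCoord x) := by
          rw [div_lt_iff₀' hn0] at h2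
          exact h2.trans_le (mul_le_mul_of_nonneg_left hge hn0.le)
        linarith
      have h6 : i < n := by
        have : (i : ℝ) < n := by nlinarith
        exact_mod_cast this
      obtain ⟨h7, h8⟩ := hz i h6
      refine h (z i) (Finset.mem_image_of_mem _ (Finset.mem_range.2 h6)) ⟨?_, ?_⟩
      · rw [← strictMono_unitCoord.lt_iff_lt]
        refine lt_of_le_of_lt ?_ h7
        rwa [le_div_iff₀' hn0]
      · rw [← strictMono_unitCoord.lt_iff_lt]
        refine h8.trans ?_
        rw [div_lt_iff₀' hn0]
        push_cast
        exact h5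
    have := hδ' (a := unitIso x) (b := unitIso x') (by
      rw [Subtype.dist_eq, dist_comm, Real.dist_eq, abs_of_nonneg]
      · exact hlt
      · exact sub_nonneg.2 (strictMono_unitCoord.monotone hxx'))
    simpa using this.le

/-- Finitely many points of a dense set such that a continuous function on the extended real plane
varies little on the cells of all grids through these points. -/
theorem exists_fine (F : C(RBar2, ℝ)) {D : Set EReal} (hD : Dense D) {ε : ℝ} (hε : 0 < ε) :
    ∃ s : Finset EReal, (s : Set EReal) ⊆ D ∧ ∀ t, s ⊆ t → ∀ G : Grid t,
      ∀ q ∈ G.idx, ∀ p ∈ G.box q, ∀ p' ∈ G.box q, |F p - F p'| ≤ ε := by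
  classical
  -- The slices depend continuously on `x` in the uniform norm, so the one-variable statement,
  -- applied to each variable, is uniform in the other one.
  have c1 : Continuous fun x => F.curry x := F.curry.continuous
  have c2 : Continuous fun x => (F.comp ContinuousMap.prodSwap).curry x :=
    (F.comp ContinuousMap.prodSwap).curry.continuous
  obtain ⟨s₁, hs₁, h1⟩ := exists_finset_dist_le c1 hD (ε := ε / 2) (by positivity)
  obtain ⟨s₂, hs₂, h2⟩ := exists_finset_dist_le c2 hD (ε := ε / 2) (by positivity)
  refine ⟨s₁ ∪ s₂, by simp [hs₁, hs₂], fun t ht G q hq p hp p' hp' => ?_⟩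
  obtain ⟨hq1, hq2⟩ := Finset.mem_product.1 hq
  have key : ∀ {Y : Type} [PseudoMetricSpace Y] {H : EReal → Y} {s : Finset EReal} {i : ℕ}
      {x x' : EReal}, (∀ x x' : EReal, x ≤ x' → (∀ z ∈ s, z ∉ Set.Ioo x x') →
      dist (H x) (H x') ≤ ε / 2) → s ⊆ t → i < G.n + 1 → x ∈ Set.Icc (G.u i) (G.u (i + 1)) →
      x' ∈ Set.Icc (G.u i) (G.u (i + 1)) → dist (H x) (H x') ≤ ε / 2 := by
    intro Y _ H s i x x' hH hst hi hx hx'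
    have hno : ∀ z ∈ s, ∀ w ∈ Set.Icc (G.u i) (G.u (i + 1)),
        ∀ w' ∈ Set.Icc (G.u i) (G.u (i + 1)), z ∉ Set.Ioo w w' := fun z hz w hw w' hw' h =>
      G.not_between (hst hz) (by omega) ⟨hw.1.trans_lt h.1, h.2.trans_le hw'.2⟩
    rcases le_total x x' with h | h
    · exact hH x x' h fun z hz => hno z hz x hx x' hx'
    · rw [dist_comm]
      exact hH x' x h fun z hz => hno z hz x' hx' x hx
  have d1 := key (x := p.1) (x' := p'.1) h1 (Finset.subset_union_left.trans ht)
    (Finset.mem_range.1 hq1) ⟨hp.1.1, hp.2.1⟩ ⟨hp'.1.1, hp'.2.1⟩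
  have d2 := key (x := p.2) (x' := p'.2) h2 (Finset.subset_union_right.trans ht)
    (Finset.mem_range.1 hq2) ⟨hp.1.2, hp.2.2⟩ ⟨hp'.1.2, hp'.2.2⟩
  have d3 : |F (p.1, p.2) - F (p'.1, p.2)| ≤ ε / 2 :=
    (ContinuousMap.dist_apply_le_dist (f := F.curry p.1) (g := F.curry p'.1) p.2).trans d1
  have d4 : |F (p'.1, p.2) - F (p'.1, p'.2)| ≤ ε / 2 :=
    (ContinuousMap.dist_apply_le_dist (f := (F.comp ContinuousMap.prodSwap).curry p.2)
      (g := (F.comp ContinuousMap.prodSwap).curry p'.2) p'.1).trans d2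
  calc |F p - F p'| ≤ |F (p.1, p.2) - F (p'.1, p.2)| + |F (p'.1, p.2) - F (p'.1, p'.2)| :=
        abs_sub_le _ _ _
    _ ≤ ε := by linarith

/-! Extension of functionals to bounded functions -/

/-- The extended real plane with the discrete topology. -/
def DiscretePlane : Type := RBar2

instance : TopologicalSpace DiscretePlane := ⊥
instance : DiscreteTopology DiscretePlane := ⟨rfl⟩

/-- The bounded functions on the extended real plane, with the uniform norm. -/
abbrev BoundedFun : Type := BoundedContinuousFunction DiscretePlane ℝ

/-- A bounded function as an element of `BoundedFun`. -/
def mkBounded (f : RBar2 → ℝ) (C : ℝ) (h : ∀ p, |f p| ≤ C) : BoundedFun :=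
  BoundedContinuousFunction.ofNormedAddCommGroupDiscrete (α := DiscretePlane) f C h

theorem norm_le_of_forall {φ : BoundedFun} {M : ℝ} (hM : 0 ≤ M)
    (h : ∀ p : RBar2, |(φ : RBar2 → ℝ) p| ≤ M) : ‖φ‖ ≤ M :=
  (BoundedContinuousFunction.norm_le hM).2 h

theorem abs_apply_le (φ : BoundedFun) (p : RBar2) : |(φ : RBar2 → ℝ) p| ≤ ‖φ‖ :=
  BoundedContinuousFunction.norm_coe_le_norm φ p

theorem boundedFun_ext {φ ψ : BoundedFun}
    (h : ∀ p : RBar2, (φ : RBar2 → ℝ) p = (ψ : RBar2 → ℝ) p) : φ = ψ :=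
  BoundedContinuousFunction.ext h

theorem abs_indicator_one_le (A : Set RBar2) (p : RBar2) :
    |A.indicator (fun _ => (1 : ℝ)) p| ≤ 1 := by
  by_cases h : p ∈ A
  · simp [Set.indicator_of_mem h]
  · simp [Set.indicator_of_notMem h]

/-- The characteristic function of a set. -/
def ind (A : Set RBar2) : BoundedFun :=
  mkBounded (A.indicator fun _ => 1) 1 (abs_indicator_one_le A)

theorem ind_apply_of_mem {A : Set RBar2} {p : RBar2} (h : p ∈ A) : (ind A : RBar2 → ℝ) p = 1 :=
  Set.indicator_of_mem h fun _ => (1 : ℝ)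

theorem ind_apply_of_notMem {A : Set RBar2} {p : RBar2} (h : p ∉ A) :
    (ind A : RBar2 → ℝ) p = 0 :=
  Set.indicator_of_notMem h fun _ => (1 : ℝ)

/-- The primitive of a distribution as a bounded function. -/
def toBounded : Ac →ₗᵢ[ℝ] BoundedFun where
  toFun f := mkBounded (primitive f).1 ‖primitive f‖ fun p => (primitive f).1.norm_coe_le_norm p
  map_add' f f' := boundedFun_ext fun p => by
    refine (congrArg (fun F : Bc => F.1 p) (map_add primitive f f')).trans ?_
    rfl
  map_smul' c f := boundedFun_ext fun p => by
    refine (congrArg (fun F : Bc => F.1 p) (map_smul primitive c f)).trans ?_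
    rfl
  norm_map' f := by
    refine le_antisymm (norm_le_of_forall (norm_nonneg _)
      fun p => (primitive f).1.norm_coe_le_norm p) ?_
    rw [Ac.norm_eq]
    exact (ContinuousMap.norm_le _ (norm_nonneg _)).2 fun p =>
      abs_apply_le (mkBounded (primitive f).1 ‖primitive f‖ fun p =>
        (primitive f).1.norm_coe_le_norm p) p

theorem toBounded_apply (f : Ac) (p : RBar2) : (toBounded f : RBar2 → ℝ) p = (primitive f).1 p := rfl

/-- Hahn-Banach on the isometric image of `Ac`. The larger space contains the characteristic
functions, which are the source of the representing function. -/
theorem exists_extension (T : StrongDual ℝ Ac) : ∃ T' : StrongDual ℝ BoundedFun,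
    ‖T'‖ ≤ ‖T‖ ∧ ∀ f, T' (toBounded f) = T f := by
  let e := toBounded.equivRange
  let S : StrongDual ℝ (LinearMap.range toBounded.toLinearMap) :=
    T.comp (e.symm.toContinuousLinearEquiv : _ →L[ℝ] Ac)
  obtain ⟨T', h1, h2⟩ := exists_extension_norm_eq _ S
  refine ⟨T', h2.le.trans ?_, fun f => ?_⟩
  · refine ContinuousLinearMap.opNorm_le_bound _ (norm_nonneg _) fun x => ?_
    exact (T.le_opNorm _).trans_eq (by congr 1; exact e.symm.norm_map x)
  · exact (h1 (e f)).trans (congrArg T (e.symm_apply_apply f))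

/-! ### The representing function `tail T` and its variation. -/

section

variable (T : StrongDual ℝ BoundedFun)

/-- The value of the functional at the characteristic function of `(x, ∞] × (y, ∞]`. -/
def tail (p : RBar2) : ℝ := T (ind (Set.Ioi p.1 ×ˢ Set.Ioi p.2))

theorem norm_ind_le (A : Set RBar2) : ‖ind A‖ ≤ 1 :=
  norm_le_of_forall zero_le_one (abs_indicator_one_le A)

theorem abs_tail_le (p : RBar2) : |tail T p| ≤ ‖T‖ :=
  (T.le_opNorm _).trans (mul_le_of_le_one_right (norm_nonneg _) (norm_ind_le _))

theorem ind_empty : ind ∅ = 0 := boundedFun_ext fun _ => ind_apply_of_notMem (Set.notMem_empty _)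

theorem tail_top (x : EReal) : tail T (⊤, x) = 0 ∧ tail T (x, ⊤) = 0 := by
  constructor <;> simp [tail, ind_empty]

theorem ind_prod_apply (A B : Set EReal) (p : RBar2) : (ind (A ×ˢ B) : RBar2 → ℝ) p =
    A.indicator (fun _ => (1 : ℝ)) p.1 * B.indicator (fun _ => (1 : ℝ)) p.2 := by
  classical
  change (A ×ˢ B).indicator (fun _ => (1 : ℝ)) p = _
  simp only [Set.indicator_apply, Set.mem_prod]
  split_ifs <;> simp_all

theorem indicator_Ioc {a b : EReal} (h : a ≤ b) (x : EReal) :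
    (Set.Ioc a b).indicator (fun _ => (1 : ℝ)) x =
      (Set.Ioi a).indicator (fun _ => (1 : ℝ)) x - (Set.Ioi b).indicator (fun _ => (1 : ℝ)) x := by
  classical
  simp only [Set.indicator_apply, Set.mem_Ioc, Set.mem_Ioi]
  by_cases h1 : b < x
  · have := h.trans_lt h1
    simp [h1, this]
  · simp [h1, not_lt.1 h1]

/-- Multiply out `1_{(a,b]} = 1_{(a,∞]} - 1_{(b,∞]}` in both variables and use linearity of `T`. -/
theorem inc₂_tail (J : NonemptyInterval RBar2) : inc₂ (tail T) J = T (ind (hopen J)) := by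
  simp only [inc₂, tail, ← map_add, ← map_sub]
  congr 1
  refine boundedFun_ext fun p => ?_
  have e : ∀ φ ψ χ ω : BoundedFun, ((φ + ψ - χ - ω : BoundedFun) : RBar2 → ℝ) p =
      (φ : RBar2 → ℝ) p + (ψ : RBar2 → ℝ) p - (χ : RBar2 → ℝ) p - (ω : RBar2 → ℝ) p :=
    fun _ _ _ _ => rfl
  rw [e, hopen]
  simp only [ind_prod_apply]
  rw [indicator_Ioc J.fst_le_snd.1, indicator_Ioc J.fst_le_snd.2]
  ring

theorem sum_smul_ind_apply {ι : Type*} (K : Finset ι) (c : ι → ℝ) (A : ι → Set RBar2) (p : RBar2) :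
    ((∑ k ∈ K, c k • ind (A k) : BoundedFun) : RBar2 → ℝ) p =
      ∑ k ∈ K, c k * (ind (A k) : RBar2 → ℝ) p := by
  exact BoundedContinuousFunction.sum_apply K (fun k => c k • ind (A k)) (a := (p : DiscretePlane))

theorem sum_smul_ind_apply_of_mem {ι : Type*} {K : Finset ι} {c : ι → ℝ} {A : ι → Set RBar2}
    {p : RBar2} {k : ι} (hk : k ∈ K) (hp : p ∈ A k) (h : ∀ k' ∈ K, p ∈ A k' → k' = k) :
    ((∑ k ∈ K, c k • ind (A k) : BoundedFun) : RBar2 → ℝ) p = c k := by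
  rw [sum_smul_ind_apply, Finset.sum_eq_single_of_mem k hk, ind_apply_of_mem hp, mul_one]
  intro k' hk' hne
  rw [ind_apply_of_notMem fun hp' => hne (h k' hk' hp'), mul_zero]

theorem sum_smul_ind_apply_of_notMem {ι : Type*} {K : Finset ι} {c : ι → ℝ} {A : ι → Set RBar2}
    {p : RBar2} (h : ∀ k ∈ K, p ∉ A k) :
    ((∑ k ∈ K, c k • ind (A k) : BoundedFun) : RBar2 → ℝ) p = 0 := by
  rw [sum_smul_ind_apply]
  refine Finset.sum_eq_zero fun k hk => ?_
  rw [ind_apply_of_notMem (h k hk), mul_zero]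

/-- The increments of `tail T` over disjoint intervals. -/
theorem sum_abs_inc₂_tail_le {ι : Type*} {K : Finset ι} {J : ι → NonemptyInterval RBar2}
    (hJ : ∀ p, ∀ k ∈ K, p ∈ hopen (J k) → ∀ k' ∈ K, p ∈ hopen (J k') → k' = k) :
    ∑ k ∈ K, |inc₂ (tail T) (J k)| ≤ ‖T‖ := by
  -- With the signs as coefficients, `T` of the combination is the sum of absolute values; the
  -- half-open intervals are disjoint, so the combination has norm at most 1.
  let c : ι → ℝ := fun k => SignType.sign (inc₂ (tail T) (J k))
  have hc : ∀ k, |c k| ≤ 1 := fun k => by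
    simp only [c]
    rcases lt_trichotomy (inc₂ (tail T) (J k)) 0 with h | h | h
    · simp [sign_neg h]
    · simp [h]
    · simp [sign_pos h]
  have e : ∑ k ∈ K, |inc₂ (tail T) (J k)| = T (∑ k ∈ K, c k • ind (hopen (J k))) := by
    rw [map_sum]
    refine Finset.sum_congr rfl fun k _ => ?_
    rw [map_smul, ← inc₂_tail, smul_eq_mul]
    exact (sign_mul_self _).symm
  rw [e]
  refine (le_abs_self _).trans ((T.le_opNorm _).trans (mul_le_of_le_one_right (norm_nonneg _) ?_))
  refine norm_le_of_forall zero_le_one fun p => ?_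
  by_cases h : ∃ k ∈ K, p ∈ hopen (J k)
  · obtain ⟨k, hk, hp⟩ := h
    rw [sum_smul_ind_apply_of_mem hk hp (hJ p k hk hp)]
    exact hc k
  · push Not at h
    rw [sum_smul_ind_apply_of_notMem h, abs_zero]
    exact zero_le_one

theorem sum_enorm_le_ofReal {ι : Type*} {K : Finset ι} {m : ι → ℝ} {C : ℝ}
    (h : ∑ k ∈ K, |m k| ≤ C) : ∑ k ∈ K, ‖m k‖ₑ ≤ ENNReal.ofReal C := by
  simp only [Real.enorm_eq_ofReal_abs]
  rw [← ENNReal.ofReal_sum_of_nonneg fun _ _ => abs_nonneg _]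
  exact ENNReal.ofReal_le_ofReal h

/-- The half-open intervals of a division are disjoint, which bounds `V₁₂` by `‖T‖`; on the edges `x
= ⊤` and `y = ⊤` the function is constantly zero. -/
theorem isHKBV_tail : IsHKBV (tail T) := by
  refine ⟨lt_of_le_of_lt (b := ENNReal.ofReal ‖T‖) (iSup₂_le fun D hD => ?_)
    ENNReal.ofReal_lt_top, ⊤, ⊤, ?_, ?_⟩
  · exact sum_enorm_le_ofReal (sum_abs_inc₂_tail_le T fun p k hk hp k' hk' hp' =>
      eq_of_mem_hopen (J := id) hD.1 hk' hk hp' hp)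
  · refine lt_of_eq_of_lt (eVariationOn.constant_on ?_) ENNReal.zero_lt_top
    rintro _ ⟨x, -, rfl⟩ _ ⟨y, -, rfl⟩
    exact (tail_top T x).2.trans (tail_top T y).2.symm
  · refine lt_of_eq_of_lt (eVariationOn.constant_on ?_) ENNReal.zero_lt_top
    rintro _ ⟨x, -, rfl⟩ _ ⟨y, -, rfl⟩
    exact (tail_top T x).1.trans (tail_top T y).1.symm

/-- The norm of the functional restricted to the functions that vanish where `π > x`. -/
def partialNorm (π : RBar2 → EReal) (x : EReal) : ℝ :=
  sSup {r | ∃ φ : BoundedFun, ‖φ‖ ≤ 1 ∧ (∀ p : RBar2, x < π p → (φ : RBar2 → ℝ) p = 0) ∧ T φ = r}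

theorem le_partialNorm {π : RBar2 → EReal} {x : EReal} {φ : BoundedFun} (h1 : ‖φ‖ ≤ 1)
    (h2 : ∀ p : RBar2, x < π p → (φ : RBar2 → ℝ) p = 0) : T φ ≤ partialNorm T π x := by
  refine le_csSup ⟨‖T‖, ?_⟩ ⟨φ, h1, h2, rfl⟩
  rintro _ ⟨φ, h1, -, rfl⟩
  exact (le_abs_self _).trans ((T.le_opNorm φ).trans (mul_le_of_le_one_right (norm_nonneg _) h1))

/-- A function supported in `x < π ≤ x'` and one supported in `π ≤ x` have disjoint supports, so
their sum still has norm at most 1 and competes in the supremum at `x'`. Thus `partialNorm` serves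
as an increasing distribution function for the size of `T`. -/
theorem abs_le_partialNorm_sub {π : RBar2 → EReal} {x x' : EReal} (hxx' : x ≤ x') {ψ : BoundedFun}
    (h1 : ‖ψ‖ ≤ 1) (h2 : ∀ p : RBar2, π p ∉ Set.Ioc x x' → (ψ : RBar2 → ℝ) p = 0) :
    |T ψ| ≤ partialNorm T π x' - partialNorm T π x := by
  have key : ∀ ψ : BoundedFun, ‖ψ‖ ≤ 1 →
      (∀ p : RBar2, π p ∉ Set.Ioc x x' → (ψ : RBar2 → ℝ) p = 0) →
      T ψ ≤ partialNorm T π x' - partialNorm T π x := by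
    intro ψ h1 h2
    rw [le_sub_iff_add_le, ← le_sub_iff_add_le']
    refine csSup_le ⟨0, 0, by simp, fun _ _ => rfl, map_zero T⟩ ?_
    rintro _ ⟨φ, h3, h4, rfl⟩
    rw [le_sub_iff_add_le', ← map_add]
    have e : ∀ p : RBar2, ((ψ + φ : BoundedFun) : RBar2 → ℝ) p =
      (ψ : RBar2 → ℝ) p + (φ : RBar2 → ℝ) p := fun _ => rfl
    refine le_partialNorm T (norm_le_of_forall zero_le_one fun p => ?_) fun p hp => ?_
    · rw [e]
      by_cases hp : x < π p
      · rw [h4 p hp, add_zero]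
        exact (abs_apply_le ψ p).trans h1
      · rw [h2 p fun h => hp h.1, zero_add]
        exact (abs_apply_le φ p).trans h3
    · rw [e, h2 p fun h => absurd h.2 (not_le.2 hp), h4 p (hxx'.trans_lt hp), add_zero]
  refine abs_le'.2 ⟨key ψ h1 h2, ?_⟩
  rw [← map_neg]
  refine key (-ψ) (by rwa [norm_neg]) fun p hp => ?_
  exact neg_eq_zero.2 (h2 p hp)

theorem monotone_partialNorm (π : RBar2 → EReal) : Monotone (partialNorm T π) := fun x x' h => by
  have := abs_le_partialNorm_sub T (π := π) h (ψ := 0) (by simp) fun _ _ => rfl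
  simpa using this

/-- Since `tail T` vanishes at `y = ⊤`, the difference is an increment over `(x, x'] × (y, ⊤]`. The
bound is uniform in `y`, which is what makes joint limits accessible. -/
theorem abs_tail_sub_le₁ (x x' y : EReal) : |tail T (x, y) - tail T (x', y)| ≤
    |partialNorm T Prod.fst x - partialNorm T Prod.fst x'| := by
  wlog h : x ≤ x' generalizing x x'
  · rw [abs_sub_comm, abs_sub_comm (partialNorm _ _ _)]
    exact this x' x (le_of_not_ge h)
  have e := inc₂_tail T ⟨((x, y), (x', ⊤)), h, le_top⟩
  simp only [inc₂, (tail_top T _).2] at e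
  rw [add_zero, sub_zero] at e
  rw [e, abs_sub_comm (partialNorm _ _ _)]
  refine (abs_le_partialNorm_sub T h (norm_ind_le _) fun p hp => ?_).trans (le_abs_self _)
  exact ind_apply_of_notMem fun h' => hp h'.1

theorem abs_tail_sub_le₂ (x y y' : EReal) : |tail T (x, y) - tail T (x, y')| ≤
    |partialNorm T Prod.snd y - partialNorm T Prod.snd y'| := by
  wlog h : y ≤ y' generalizing y y'
  · rw [abs_sub_comm, abs_sub_comm (partialNorm _ _ _)]
    exact this y' y (le_of_not_ge h)
  have e := inc₂_tail T ⟨((x, y), (⊤, y')), le_top, h⟩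
  simp only [inc₂, (tail_top T _).1] at e
  rw [add_zero, sub_zero] at e
  rw [e, abs_sub_comm (partialNorm _ _ _)]
  refine (abs_le_partialNorm_sub T h (norm_ind_le _) fun p hp => ?_).trans (le_abs_self _)
  exact ind_apply_of_notMem fun h' => hp h'.2

theorem abs_tail_sub_le (p p' : RBar2) : |tail T p - tail T p'| ≤
    |partialNorm T Prod.fst p.1 - partialNorm T Prod.fst p'.1| +
    |partialNorm T Prod.snd p.2 - partialNorm T Prod.snd p'.2| :=
  (abs_sub_le _ (tail T (p'.1, p.2)) _).trans
    (add_le_add (abs_tail_sub_le₁ T p.1 p'.1 p.2) (abs_tail_sub_le₂ T p'.1 p.2 p'.2))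

/-! The pairing with `tail T` -/

theorem index_eq_of_mem_Ioc {v : ℕ → EReal} {S : Set ℕ} (hv : MonotoneOn v S) {i j : ℕ}
    (hi : i ∈ S) (hi' : i + 1 ∈ S) (hj : j ∈ S) (hj' : j + 1 ∈ S) {x : EReal}
    (h : x ∈ Set.Ioc (v i) (v (i + 1))) (h' : x ∈ Set.Ioc (v j) (v (j + 1))) : i = j := by
  rcases lt_trichotomy i j with h1 | h1 | h1
  · exact absurd (h.2.trans (hv hi' hj h1)) (not_le.2 h'.1)
  · exact h1
  · exact absurd (h'.2.trans (hv hj' hi h1)) (not_le.2 h.1)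

namespace Grid

variable {s : Finset EReal} (G : Grid s)

/-- The intervals of a grid. -/
def seg (i : ℕ) : NonemptyInterval EReal := ⟨(G.u i, G.u (i + 1)), G.mono i.le_succ⟩

theorem index_eq {i j : ℕ} {x : EReal} (h : x ∈ hopen₁ (G.seg i)) (h' : x ∈ hopen₁ (G.seg j)) :
    i = j :=
  index_eq_of_mem_Ioc (S := Set.univ) (G.mono.monotoneOn _) trivial trivial trivial trivial h h'

theorem exists_seg {x : EReal} (hx : ⊥ < x) : ∃ i ∈ Finset.range (G.n + 1), x ∈ hopen₁ (G.seg i) := by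
  refine exists_mem_hopen₁ (J := G.seg) ?_ hx
  rw [Set.eq_univ_iff_forall]
  intro y
  obtain ⟨i, hi, hy⟩ := exists_cell G.zero G.last y
  exact Set.mem_iUnion₂.2 ⟨i, hi, hy⟩

theorem seg_partition {x : EReal} (hx : ⊥ < x) : ∃ i ∈ Finset.range (G.n + 1),
    x ∈ hopen₁ (G.seg i) ∧ ∀ j ∈ Finset.range (G.n + 1), x ∈ hopen₁ (G.seg j) → j = i := by
  obtain ⟨i, hi, h⟩ := G.exists_seg hx
  exact ⟨i, hi, h, fun j _ h' => G.index_eq h' h⟩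

theorem box_partition {p : RBar2} (h1 : ⊥ < p.1) (h2 : ⊥ < p.2) : ∃ q ∈ G.idx,
    p ∈ hopen (G.box q) ∧ ∀ q' ∈ G.idx, p ∈ hopen (G.box q') → q' = q := by
  obtain ⟨i, hi, h⟩ := G.exists_seg h1
  obtain ⟨j, hj, h'⟩ := G.exists_seg h2
  exact ⟨(i, j), Finset.mem_product.2 ⟨hi, hj⟩, ⟨h, h'⟩, fun q _ hq =>
    Prod.ext (G.index_eq hq.1 h) (G.index_eq hq.2 h')⟩

end Grid

theorem Grid.mem_box {s : Finset EReal} {G : Grid s} {q : ℕ × ℕ} {x y : EReal}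
    (hx : x ∈ Set.Icc (G.u q.1) (G.u (q.1 + 1))) (hy : y ∈ Set.Icc (G.u q.2) (G.u (q.2 + 1))) :
    (x, y) ∈ G.box q := ⟨⟨hx.1, hy.1⟩, hx.2, hy.2⟩

theorem hopen_subset (J : NonemptyInterval RBar2) {p : RBar2} (hp : p ∈ hopen J) : p ∈ J :=
  ⟨⟨hp.1.1.le, hp.2.1.le⟩, hp.1.2, hp.2.2⟩

/-- As `tail T` vanishes on the edges `⊤`, the grid sum is `T` of the step function that takes on
each half-open cell the value of `F` at the upper corner. These step functions tend to `F`
uniformly. -/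
theorem pairing_tail (f : Ac) : pairing (primitive f).1 (tail T) = T (toBounded f) := by
  have hF := (primitive f).2
  refine tendsto_nhds_unique (tendsto_pairing (primitive f) (isHKBV_tail T)) ?_
  have e : ∀ s, gridSum s (primitive f).1 (tail T) = T (∑ q ∈ (theGrid s).idx,
      (primitive f).1 ((theGrid s).u (q.1 + 1), (theGrid s).u (q.2 + 1)) •
        ind (hopen ((theGrid s).box q))) := fun s => by
    rw [gridSum_eq s hF, map_sum]
    simp only [sum₁, sum₂, (tail_top T _).1, (tail_top T _).2, sub_self, zero_mul, mul_zero,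
      Finset.sum_const_zero, zero_add, map_smul, inc₂_tail, smul_eq_mul]
    exact Finset.sum_congr rfl fun q _ => mul_comm _ _
  simp only [e]
  refine (T.continuous.tendsto _).comp ?_
  rw [Metric.tendsto_nhds]
  intro ε hε
  obtain ⟨s₀, -, hs₀⟩ := exists_fine (primitive f).1 dense_univ (ε := ε / 2) (by positivity)
  filter_upwards [eventually_superset s₀] with s hs
  rw [dist_eq_norm]
  refine (norm_le_of_forall (by positivity : 0 ≤ ε / 2) fun p => ?_).trans_lt (half_lt_self hε)
  have e' : ∀ φ ψ : BoundedFun, ((φ - ψ : BoundedFun) : RBar2 → ℝ) p =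
      (φ : RBar2 → ℝ) p - (ψ : RBar2 → ℝ) p := fun _ _ => rfl
  rw [e', toBounded_apply]
  by_cases hp : ⊥ < p.1 ∧ ⊥ < p.2
  · obtain ⟨q, hq, hpq, hu⟩ := (theGrid s).box_partition hp.1 hp.2
    rw [sum_smul_ind_apply_of_mem hq hpq hu]
    refine hs₀ s hs (theGrid s) q hq _ ?_ p (hopen_subset _ hpq)
    exact ⟨⟨(theGrid s).mono q.1.le_succ, (theGrid s).mono q.2.le_succ⟩, le_rfl, le_rfl⟩
  · rw [sum_smul_ind_apply_of_notMem fun q _ hpq => hp (hopen_bot_lt hpq)]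
    -- The half-open cells miss the points with a coordinate `⊥`, where `F` is zero anyway.
    have : (primitive f).1 p = 0 := by
      rcases not_and_or.1 hp with h | h
      · have h' := (hF p.2).1
        rwa [← not_bot_lt_iff.1 h] at h'
      · have h' := (hF p.1).2
        rwa [← not_bot_lt_iff.1 h] at h'
    rw [this, sub_zero, abs_zero]
    positivity

/-! Functions that vanish on a dense grid -/

/-- On a grid with all interior nodes in `D`, summation by parts is applied with the nodes of `F`
moved slightly so that the sum against increments of `F` is exactly zero. The other side is then
close to the value of the pairing. -/
theorem pairing_eq_zero_of_dense (F : Bc) {k : RBar2 → ℝ} (hk : IsHKBV k) {D : Set EReal}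
    (hD : Dense D) (h0 : ∀ x ∈ D, ∀ y ∈ D, k (x, y) = 0) : pairing F.1 k = 0 := by
  classical
  obtain ⟨S, S', U, hS, hS', hU⟩ := exists_tendsto_sums F.1 hk
  rw [pairing_eq F hk hS hS' hU]
  set C := (V₁ k ⊤).toReal + (V₂ k ⊤).toReal + (V₁₂ k).toReal with hC
  have hC0 : 0 ≤ C := by positivity
  refine abs_eq_zero.1 (le_antisymm (le_of_forall_pos_le_add fun ε hε => ?_) (abs_nonneg _))
  obtain ⟨s₀, hs₀, hfine⟩ := exists_fine F.1 hD (ε := ε / (C + 1)) (by positivity)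
  -- The node `d` guarantees an interior node, so `1 ≤ G.n` and `v (G.n + 1) = ⊤` below.
  obtain ⟨d, hd, hdD⟩ := hD.exists_between (bot_lt_top (α := EReal))
  obtain ⟨s, hs, hds, hsD⟩ : ∃ s : Finset EReal, s₀ ⊆ s ∧ d ∈ s ∧ (s : Set EReal) ⊆ D :=
    ⟨insert d s₀, Finset.subset_insert _ _, Finset.mem_insert_self _ _, by
      rw [Finset.coe_insert]; exact Set.insert_subset hd hs₀⟩
  set G := theGrid s
  have hfine := hfine s hs G
  have hn : 1 ≤ G.n := by
    obtain ⟨i, hi, rfl⟩ := G.surj d hds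
    have h1 : i ≠ 0 := by rintro rfl; exact hdD.1.ne' G.zero
    have h2 : i ≠ G.n + 1 := by rintro rfl; exact hdD.2.ne G.last
    omega
  -- Merging the first two nodes kills the increments of `F` over the cells with index `0`, where
  -- `k` may be nonzero at the lower corner. Still `v (i + 1)` lies in the `i`-th interval of the
  -- grid, so it is an admissible tag.
  let v : ℕ → EReal := fun i => if i ≤ 1 then ⊥ else G.u i
  have hv0 : v 0 = ⊥ := rfl
  have hv1 : v 1 = ⊥ := rfl
  have hvtop : v (G.n + 1) = ⊤ := by
    simp only [v]; rw [if_neg (by omega), G.last]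
  have hvmem : ∀ i, v (i + 1) ∈ Set.Icc (G.u i) (G.u (i + 1)) := by
    intro i
    simp only [v]
    split_ifs with h
    · have : i = 0 := by omega
      subst this
      rw [G.zero]; exact ⟨le_rfl, bot_le⟩
    · exact ⟨G.mono i.le_succ, le_rfl⟩
  have hFb : ∀ x, F.1 (⊥, x) = 0 := fun x => (F.2 x).1
  have hFb' : ∀ x, F.1 (x, ⊥) = 0 := fun x => (F.2 x).2
  have hmem : ∀ i, i < G.n → G.u (i + 1) ∈ D := by
    intro i hi
    rcases G.mem (i + 1) with h | h | h
    · exact absurd h (G.bot_lt (by omega)).ne'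
    · rw [← G.last] at h
      exact absurd h ((G.lt_iff (by omega) le_rfl).2 (by omega)).ne
    · exact hsD h
  have hparts := sum_by_parts₂ (fun i j => k (G.u i, G.u j)) (fun i j => F.1 (v i, v j)) (G.n + 1)
    (fun j => by rw [hv0]; exact hFb _) (fun j => by rw [hv0]; exact hFb' _)
  rw [Finset.sum_eq_zero] at hparts
  swap
  · rintro ⟨i, j⟩ hq
    simp only [Finset.mem_product, Finset.mem_range] at hq
    rcases i with _ | i
    · simp [hv0, hv1, hFb]
    rcases j with _ | j
    · simp [hv0, hv1, hFb']
    simp [h0 _ (hmem i (by omega)) _ (hmem j (by omega))]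
  simp only [G.last, hvtop] at hparts
  set δ := ε / (C + 1) with hδ
  have hδ0 : 0 ≤ δ := by positivity
  have htop : (⊤ : EReal) ∈ Set.Icc (G.u G.n) (G.u (G.n + 1)) := by
    rw [G.last]; exact ⟨le_top, le_rfl⟩
  have hlast : G.n ∈ Finset.range (G.n + 1) := by simp
  have b1 : |∑ i ∈ Finset.range (G.n + 1), F.1 (v (i + 1), ⊤) * (k (G.u (i + 1), ⊤) - k (G.u i, ⊤))
      - S| ≤ δ * (V₁ k ⊤).toReal := by
    refine le_of_tendsto (tendsto_const_nhds.sub hS).abs ?_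
    filter_upwards [eventually_superset ((Finset.range (G.n + 2)).image G.u)] with t ht
    refine abs_sum_sub_sum₁_le (J := G.seg) hδ0 (hk.V₁_lt_top ⊤) (fun p hp => G.seg_partition hp)
      (fun i hi p hp => ?_) (fun i hi => ?_)
    · exact hfine (i, G.n) (Finset.mem_product.2 ⟨hi, hlast⟩) _
        (Grid.mem_box (hvmem i) htop) _ (Grid.mem_box ⟨hp.1.le, hp.2⟩ htop)
    · rw [Finset.mem_range] at hi
      constructor <;> refine ht (Finset.mem_image_of_mem _ (Finset.mem_range.2 (by omega)))
  have b2 : |∑ i ∈ Finset.range (G.n + 1), F.1 (⊤, v (i + 1)) * (k (⊤, G.u (i + 1)) - k (⊤, G.u i))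
      - S'| ≤ δ * (V₂ k ⊤).toReal := by
    refine le_of_tendsto (tendsto_const_nhds.sub hS').abs ?_
    filter_upwards [eventually_superset ((Finset.range (G.n + 2)).image G.u)] with t ht
    refine abs_sum_sub_sum₁_le (J := G.seg) hδ0 (hk.V₂_lt_top ⊤) (fun p hp => G.seg_partition hp)
      (fun i hi p hp => ?_) (fun i hi => ?_)
    · exact hfine (G.n, i) (Finset.mem_product.2 ⟨hlast, hi⟩) _
        (Grid.mem_box htop (hvmem i)) _ (Grid.mem_box htop ⟨hp.1.le, hp.2⟩)
    · rw [Finset.mem_range] at hi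
      constructor <;> refine ht (Finset.mem_image_of_mem _ (Finset.mem_range.2 (by omega)))
  have b3 : |∑ q ∈ G.idx, F.1 (v (q.1 + 1), v (q.2 + 1)) * inc₂ k (G.box q) - U| ≤
      δ * (V₁₂ k).toReal := by
    refine le_of_tendsto (tendsto_const_nhds.sub hU).abs ?_
    filter_upwards [eventually_superset ((Finset.range (G.n + 2)).image G.u)] with t ht
    refine abs_sum_sub_sum₂_le (J := G.box) hδ0 hk.1 (fun p hp hp' => G.box_partition hp hp')
      (fun q hq p hp => ?_) (fun q hq => ?_)
    · exact hfine q hq _ (Grid.mem_box (hvmem _) (hvmem _)) _ (hopen_subset _ hp)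
    · simp only [Finset.mem_product, Finset.mem_range] at hq
      refine ⟨?_, ?_, ?_, ?_⟩ <;>
        refine ht (Finset.mem_image_of_mem _ (Finset.mem_range.2 (by omega)))
  simp only [inc₂, cell] at b3
  have hle : δ * C ≤ ε := by
    rw [hδ, div_mul_eq_mul_div, div_le_iff₀ (by positivity)]
    linarith
  have hsplit : δ * C = δ * (V₁ k ⊤).toReal + δ * (V₂ k ⊤).toReal + δ * (V₁₂ k).toReal := by
    rw [hC]; ring
  rw [abs_le] at *
  constructor <;> linarith [b1.1, b1.2, b2.1, b2.2, b3.1, b3.2, mul_comm (F.1 (⊤, ⊤)) (k (⊤, ⊤))]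

end

/-! One-sided limits from inside the plane -/

/-- The filter of the points on one side of `x`: the right side for `true`; at `⊥` and `⊤` there is
only one side. -/
def sideFilter (σ : Bool) (x : EReal) : Filter EReal :=
  if x = ⊤ then 𝓝[<] x else if x = ⊥ then 𝓝[>] x else if σ then 𝓝[>] x else 𝓝[<] x

theorem sideFilter_eq (σ : Bool) (x : EReal) :
    (sideFilter σ x = 𝓝[<] x ∧ ⊥ < x) ∨ (sideFilter σ x = 𝓝[>] x ∧ x < ⊤) := by
  by_cases h : x = ⊤
  · subst h
    exact .inl ⟨if_pos rfl, bot_lt_top⟩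
  by_cases h' : x = ⊥
  · subst h'
    exact .inr ⟨by simp [sideFilter], bot_lt_top⟩
  cases σ
  · exact .inl ⟨by simp [sideFilter, h, h'], bot_lt_iff_ne_bot.2 h'⟩
  · exact .inr ⟨by simp [sideFilter, h, h'], lt_top_iff_ne_top.2 h⟩

instance (σ : Bool) (x : EReal) : (sideFilter σ x).NeBot := by
  rcases sideFilter_eq σ x with ⟨h, hx⟩ | ⟨h, hx⟩ <;> rw [h]
  · exact neBot_nhdsLT hx
  · exact nhdsGT_neBot_of_exists_gt ⟨_, hx⟩

theorem sideFilter_le (σ : Bool) (x : EReal) : sideFilter σ x ≤ 𝓝 x := by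
  rcases sideFilter_eq σ x with ⟨h, -⟩ | ⟨h, -⟩ <;> rw [h] <;> exact nhdsWithin_le_nhds

theorem exists_Ioo_mem_sideFilter {σ : Bool} {x : EReal} {U : Set EReal} (hU : U ∈ sideFilter σ x) :
    ∃ a b, Set.Ioo a b ⊆ U ∧ Set.Ioo a b ∈ sideFilter σ x := by
  rcases sideFilter_eq σ x with ⟨h, hx⟩ | ⟨h, hx⟩ <;> rw [h] at hU ⊢
  · obtain ⟨a, ha, h⟩ := (mem_nhdsLT_iff_exists_Ioo_subset' hx).1 hU
    exact ⟨a, x, h, Ioo_mem_nhdsLT ha⟩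
  · obtain ⟨a, ha, h⟩ := (mem_nhdsGT_iff_exists_Ioo_subset' hx).1 hU
    exact ⟨x, a, h, Ioo_mem_nhdsGT ha⟩

/-- A sequence of points on one side of `x` that tends to `x`. -/
def shift (n : ℕ) (σ : Bool) (x : EReal) : EReal :=
  if x = ⊤ then ((n : ℝ) : EReal) else if x = ⊥ then ((-(n : ℝ) : ℝ) : EReal) else
    if σ then ((x.toReal + 1 / ((n : ℝ) + 1) : ℝ) : EReal)
    else ((x.toReal - 1 / ((n : ℝ) + 1) : ℝ) : EReal)

theorem tendsto_shift (σ : Bool) (x : EReal) :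
    Tendsto (fun n => shift n σ x) atTop (sideFilter σ x) := by
  have h0 : Tendsto (fun n : ℕ => 1 / ((n : ℝ) + 1)) atTop (𝓝 0) :=
    tendsto_one_div_add_atTop_nhds_zero_nat
  induction x using EReal.rec with
  | bot =>
    simp only [sideFilter, shift, bot_ne_top, if_false, if_true]
    refine tendsto_nhdsWithin_iff.2 ⟨EReal.tendsto_coe_nhds_bot_iff.2
      (tendsto_neg_atTop_atBot.comp tendsto_natCast_atTop_atTop),
      Eventually.of_forall fun n => EReal.bot_lt_coe _⟩
  | top =>
    simp only [sideFilter, shift, if_true]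
    refine tendsto_nhdsWithin_iff.2 ⟨EReal.tendsto_coe_nhds_top_iff.2 tendsto_natCast_atTop_atTop,
      Eventually.of_forall fun n => EReal.coe_lt_top _⟩
  | coe x =>
    simp only [sideFilter, shift, EReal.coe_ne_top, EReal.coe_ne_bot, if_false, EReal.toReal_coe]
    cases σ
    · simp only [Bool.false_eq_true, if_false]
      refine tendsto_nhdsWithin_iff.2 ⟨(continuous_coe_real_ereal.tendsto x).comp ?_,
        Eventually.of_forall fun n => EReal.coe_lt_coe_iff.2 (sub_lt_self _ (by positivity))⟩
      simpa using h0.const_sub x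
    · simp only [if_true]
      refine tendsto_nhdsWithin_iff.2 ⟨(continuous_coe_real_ereal.tendsto x).comp ?_,
        Eventually.of_forall fun n => EReal.coe_lt_coe_iff.2 (lt_add_of_pos_right _ (by positivity))⟩
      simpa using h0.const_add x

/-- Between `⊥` and `⊤` the shift is a translation. Monotonicity fails at the ends: the shift of `⊤`
is the real number `n`. This is why the edge strips are treated separately later. -/
theorem shift_mono (n : ℕ) (σ : Bool) : MonotoneOn (shift n σ) (Set.Ioo ⊥ ⊤) := by
  intro x hx y hy hxy
  have h := EReal.toReal_le_toReal hxy hx.1.ne' hy.2.ne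
  simp only [shift, hx.1.ne', hx.2.ne, hy.1.ne', hy.2.ne, if_false]
  cases σ
  · simp only [Bool.false_eq_true, if_false]
    exact EReal.coe_le_coe_iff.2 (by linarith)
  · simp only [if_true]
    exact EReal.coe_le_coe_iff.2 (by linarith)

/-- The weight for the negative side (`false`) or the positive side (`true`). -/
def EdgeWeights.weight (E : EdgeWeights) (τ : Bool) : ℝ := if τ then E.pos else E.neg

/-- The weights of the quadrant limits in the normalisation at a point. -/
def Normalisation.weight (N : Normalisation) (x y : EReal) (σ τ : Bool) : ℝ :=
  -- On an edge one of two equal sides gets all the weight. The corners take the weights of the edge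
  -- `x = ⊤` or `x = ⊥`, which is harmless because all quadrant limits coincide there.
  if x = ⊤ then (if σ then 0 else N.right.weight τ)
  else if x = ⊥ then (if σ then 0 else N.left.weight τ)
  else if y = ⊤ then (if τ then 0 else N.top.weight σ)
  else if y = ⊥ then (if τ then 0 else N.bottom.weight σ)
  else if σ then (if τ then N.αpp else N.αpm) else (if τ then N.αmp else N.αmm)

theorem EdgeWeights.weight_nonneg (E : EdgeWeights) (τ : Bool) : 0 ≤ E.weight τ := by
  unfold EdgeWeights.weight
  split_ifs
  · exact E.pos_nonneg
  · exact E.neg_nonneg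

theorem Normalisation.weight_nonneg (N : Normalisation) (x y : EReal) (σ τ : Bool) :
    0 ≤ N.weight x y σ τ := by
  unfold Normalisation.weight
  split_ifs
  all_goals first
    | exact le_rfl
    | exact EdgeWeights.weight_nonneg _ _
    | exact N.αpp_nonneg
    | exact N.αpm_nonneg
    | exact N.αmp_nonneg
    | exact N.αmm_nonneg

theorem Normalisation.sum_weight (N : Normalisation) (x y : EReal) :
    ∑ σ, ∑ τ, N.weight x y σ τ = 1 := by
  have h1 := N.sum_eq_one
  have h2 := N.right.sum_eq_one
  have h3 := N.left.sum_eq_one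
  have h4 := N.top.sum_eq_one
  have h5 := N.bottom.sum_eq_one
  simp only [Fintype.sum_bool, Normalisation.weight, EdgeWeights.weight]
  split_ifs <;> simp_all <;> linarith

/-! ### Quadrant limits and the normalisation of `tail T`. -/

section

variable (T : StrongDual ℝ BoundedFun)

theorem exists_tendsto_sideFilter {A : EReal → ℝ} (hA : Monotone A) (σ : Bool) (x : EReal) :
    ∃ a, Tendsto A (sideFilter σ x) (𝓝 a) := by
  rcases sideFilter_eq σ x with ⟨h, -⟩ | ⟨h, -⟩ <;> rw [h]
  · exact ⟨_, hA.tendsto_nhdsLT x⟩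
  · exact ⟨_, hA.tendsto_nhdsGT x⟩

/-- Cauchy's criterion: the dominating increasing functions have one-sided limits, and near these
the difference of two values of `tail T` is less than four times `ε / 4`. -/
theorem exists_tendsto_tail (p : RBar2) (σ τ : Bool) :
    ∃ L, Tendsto (tail T) (sideFilter σ p.1 ×ˢ sideFilter τ p.2) (𝓝 L) := by
  obtain ⟨a, ha⟩ := exists_tendsto_sideFilter (monotone_partialNorm T Prod.fst) σ p.1
  obtain ⟨b, hb⟩ := exists_tendsto_sideFilter (monotone_partialNorm T Prod.snd) τ p.2
  refine cauchy_map_iff_exists_tendsto.1 (Metric.cauchy_iff.2 ⟨inferInstance, fun ε hε => ?_⟩)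
  have hU := ha (Metric.ball_mem_nhds a (ε := ε / 4) (by positivity))
  have hV := hb (Metric.ball_mem_nhds b (ε := ε / 4) (by positivity))
  refine ⟨_, image_mem_map (prod_mem_prod hU hV), ?_⟩
  rintro _ ⟨q, ⟨hq1, hq2⟩, rfl⟩ _ ⟨q', ⟨hq1', hq2'⟩, rfl⟩
  simp only [Set.mem_preimage, Metric.mem_ball] at hq1 hq2 hq1' hq2'
  have h := abs_tail_sub_le T q q'
  have h1 := dist_triangle_right (partialNorm T Prod.fst q.1) (partialNorm T Prod.fst q'.1) a
  have h2 := dist_triangle_right (partialNorm T Prod.snd q.2) (partialNorm T Prod.snd q'.2) b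
  rw [Real.dist_eq] at h1 h2 ⊢
  linarith

/-- The quadrant limits of `tail T`. -/
def quadrantLimit (σ τ : Bool) (p : RBar2) : ℝ :=
  limUnder (sideFilter σ p.1 ×ˢ sideFilter τ p.2) (tail T)

theorem tendsto_quadrantLimit (σ τ : Bool) (p : RBar2) :
    Tendsto (tail T) (sideFilter σ p.1 ×ˢ sideFilter τ p.2) (𝓝 (quadrantLimit T σ τ p)) :=
  tendsto_nhds_limUnder (exists_tendsto_tail T p σ τ)

/-- The normalisation of `tail T`. -/
def normTail (N : Normalisation) (p : RBar2) : ℝ :=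
  ∑ σ, ∑ τ, N.weight p.1 p.2 σ τ * quadrantLimit T σ τ p

theorem abs_sum_weight_sub_le (N : Normalisation) (x y : EReal) {L : Bool → Bool → ℝ} {C ε : ℝ}
    (h : ∀ σ τ, |L σ τ - C| ≤ ε) : |∑ σ, ∑ τ, N.weight x y σ τ * L σ τ - C| ≤ ε := by
  have e : ∑ σ, ∑ τ, N.weight x y σ τ * L σ τ - C =
      ∑ σ, ∑ τ, N.weight x y σ τ * (L σ τ - C) := by
    have : C = ∑ σ, ∑ τ, N.weight x y σ τ * C := by
      simp only [← Finset.sum_mul, N.sum_weight, one_mul]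
    simp only [mul_sub, Finset.sum_sub_distrib]
    rw [← this]
  rw [e]
  refine (Finset.abs_sum_le_sum_abs _ _).trans ((Finset.sum_le_sum fun σ _ =>
    (Finset.abs_sum_le_sum_abs _ _).trans (Finset.sum_le_sum (g := fun τ =>
      N.weight x y σ τ * ε) fun τ _ => ?_)).trans_eq ?_)
  · rw [abs_mul, abs_of_nonneg (N.weight_nonneg x y σ τ)]
    exact mul_le_mul_of_nonneg_left (h σ τ) (N.weight_nonneg x y σ τ)
  · simp only [← Finset.sum_mul, N.sum_weight, one_mul]

/-- Normalising does not change the quadrant limits. Near `p`, on the given side, `q` lies in an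
open rectangle on which `tail T` is almost constant, so all quadrant limits at `q` and their convex
combinations are close to that constant. -/
theorem tendsto_normTail (N : Normalisation) (σ τ : Bool) (p : RBar2) :
    Tendsto (normTail T N) (sideFilter σ p.1 ×ˢ sideFilter τ p.2) (𝓝 (quadrantLimit T σ τ p)) := by
  refine Metric.nhds_basis_closedBall.tendsto_right_iff.2 fun ε hε => ?_
  obtain ⟨U, hU, V, hV, hUV⟩ := Filter.mem_prod_iff.1
    (tendsto_quadrantLimit T σ τ p (Metric.closedBall_mem_nhds _ hε))
  obtain ⟨a, b, hab, hab'⟩ := exists_Ioo_mem_sideFilter hU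
  obtain ⟨c, d, hcd, hcd'⟩ := exists_Ioo_mem_sideFilter hV
  filter_upwards [prod_mem_prod hab' hcd'] with q hq
  rw [Metric.mem_closedBall, Real.dist_eq]
  refine abs_sum_weight_sub_le N _ _ fun σ' τ' => ?_
  have hmem : ∀ᶠ z in sideFilter σ' q.1 ×ˢ sideFilter τ' q.2, z ∈ U ×ˢ V :=
    prod_mem_prod (mem_of_superset (sideFilter_le _ _ (Ioo_mem_nhds hq.1.1 hq.1.2)) hab)
      (mem_of_superset (sideFilter_le _ _ (Ioo_mem_nhds hq.2.1 hq.2.2)) hcd)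
  refine le_of_tendsto ((tendsto_quadrantLimit T σ' τ' q).sub_const _).abs ?_
  filter_upwards [hmem] with z hz
  exact hUV hz

theorem isNormalisationOf_normTail (N : Normalisation) :
    IsNormalisationOf N (normTail T N) (normTail T N) := by
  have key := tendsto_normTail T N
  have l : ∀ x : ℝ, sideFilter false (x : EReal) = 𝓝[<] (x : EReal) := fun x => by simp [sideFilter]
  have r : ∀ x : ℝ, sideFilter true (x : EReal) = 𝓝[>] (x : EReal) := fun x => by simp [sideFilter]
  have t : ∀ σ, sideFilter σ ⊤ = 𝓝[<] (⊤ : EReal) := fun σ => by simp [sideFilter]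
  have b : ∀ σ, sideFilter σ ⊥ = 𝓝[>] (⊥ : EReal) := fun σ => by simp [sideFilter]
  have corner : ∀ x y : EReal, (∀ σ, sideFilter σ x = sideFilter false x) →
      (∀ τ, sideFilter τ y = sideFilter false y) →
      Tendsto (normTail T N) (sideFilter false x ×ˢ sideFilter false y)
        (𝓝 (normTail T N (x, y))) := by
    intro x y hx hy
    have h1 : ∀ σ τ, quadrantLimit T σ τ (x, y) = quadrantLimit T false false (x, y) :=
      fun σ τ => by simp only [quadrantLimit, hx σ, hy τ]
    have h2 : normTail T N (x, y) = quadrantLimit T false false (x, y) := by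
      simp only [normTail, h1, ← Finset.sum_mul, N.sum_weight, one_mul]
    rw [h2]
    exact key false false (x, y)
  refine ⟨fun x y => ⟨quadrantLimit T false false (x, y), quadrantLimit T true true (x, y),
      quadrantLimit T false true (x, y), quadrantLimit T true false (x, y), ?_, ?_, ?_, ?_, ?_⟩,
    fun y => ⟨quadrantLimit T false false (⊥, y), quadrantLimit T false true (⊥, y), ?_, ?_, ?_⟩,
    fun y => ⟨quadrantLimit T false false (⊤, y), quadrantLimit T false true (⊤, y), ?_, ?_, ?_⟩,
    fun x => ⟨quadrantLimit T false false (x, ⊥), quadrantLimit T true false (x, ⊥), ?_, ?_, ?_⟩,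
    fun x => ⟨quadrantLimit T false false (x, ⊤), quadrantLimit T true false (x, ⊤), ?_, ?_, ?_⟩,
    ?_, ?_, ?_, ?_⟩
  · simpa only [l, r] using key false false (x, y)
  · simpa only [l, r] using key true true (x, y)
  · simpa only [l, r] using key false true (x, y)
  · simpa only [l, r] using key true false (x, y)
  · simp [normTail, Normalisation.weight]; ring
  · simpa only [l, r, t, b] using key false false (⊥, y)
  · simpa only [l, r, t, b] using key false true (⊥, y)
  · simp [normTail, Normalisation.weight, EdgeWeights.weight]; ring
  · simpa only [l, r, t, b] using key false false (⊤, y)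
  · simpa only [l, r, t, b] using key false true (⊤, y)
  · simp [normTail, Normalisation.weight, EdgeWeights.weight]; ring
  · simpa only [l, r, t, b] using key false false (x, ⊥)
  · simpa only [l, r, t, b] using key true false (x, ⊥)
  · simp [normTail, Normalisation.weight, EdgeWeights.weight]; ring
  · simpa only [l, r, t, b] using key false false (x, ⊤)
  · simpa only [l, r, t, b] using key true false (x, ⊤)
  · simp [normTail, Normalisation.weight, EdgeWeights.weight]; ring
  · simpa only [t, b] using corner ⊥ ⊥ (fun σ => by rw [b, b]) (fun σ => by rw [b, b])
  · simpa only [t, b] using corner ⊥ ⊤ (fun σ => by rw [b, b]) (fun σ => by rw [t, t])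
  · simpa only [t, b] using corner ⊤ ⊥ (fun σ => by rw [t, t]) (fun σ => by rw [b, b])
  · simpa only [t, b] using corner ⊤ ⊤ (fun σ => by rw [t, t]) (fun σ => by rw [t, t])

/-- The two increasing functions that dominate the increments have countably many discontinuities.
Where both coordinates avoid them, `tail T` is jointly continuous and all quadrant limits equal its
value. -/
theorem exists_dense_normTail_eq (N : Normalisation) : ∃ D : Set EReal, Dense D ∧
    ∀ x ∈ D, ∀ y ∈ D, normTail T N (x, y) = tail T (x, y) := by
  set A := partialNorm T Prod.fst with hA
  set B := partialNorm T Prod.snd with hB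
  refine ⟨{x | ContinuousAt A x ∧ ContinuousAt B x}, ?_, fun x hx y hy => ?_⟩
  · have c1 := (monotone_partialNorm T Prod.fst).countable_not_continuousAt
    have c2 := (monotone_partialNorm T Prod.snd).countable_not_continuousAt
    have c3 : ((fun x : ℝ => (x : EReal)) ⁻¹' {x | ¬ ContinuousAt A x} ∪
        (fun x : ℝ => (x : EReal)) ⁻¹' {x | ¬ ContinuousAt B x}).Countable :=
      (c1.preimage EReal.coe_injective).union (c2.preimage EReal.coe_injective)
    refine (denseRange_coe_ereal.dense_image continuous_coe_real_ereal
      (c3.dense_compl ℝ)).mono ?_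
    rintro _ ⟨x, hx, rfl⟩
    simpa using hx
  · have h1 : Tendsto (tail T) (𝓝 x ×ˢ 𝓝 y) (𝓝 (tail T (x, y))) := by
      rw [tendsto_iff_norm_sub_tendsto_zero]
      have t1 : Tendsto (fun q : RBar2 => |A q.1 - A x|) (𝓝 x ×ˢ 𝓝 y) (𝓝 0) := by
        have := ((hx.1.tendsto.comp (tendsto_fst (g := 𝓝 y))).sub_const (A x)).abs
        simpa using this
      have t2 : Tendsto (fun q : RBar2 => |B q.2 - B y|) (𝓝 x ×ˢ 𝓝 y) (𝓝 0) := by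
        have := ((hy.2.tendsto.comp (tendsto_snd (f := 𝓝 x))).sub_const (B y)).abs
        simpa using this
      refine squeeze_zero (fun _ => norm_nonneg _) (fun q => ?_) (by simpa using t1.add t2)
      exact abs_tail_sub_le T q (x, y)
    have h2 : ∀ σ τ, quadrantLimit T σ τ (x, y) = tail T (x, y) := fun σ τ =>
      tendsto_nhds_unique (tendsto_quadrantLimit T σ τ (x, y))
        (h1.mono_left (Filter.prod_mono (sideFilter_le _ _) (sideFilter_le _ _)))
    simp only [normTail, h2, ← Finset.sum_mul, N.sum_weight, one_mul]

/-! Bounds for the normalisation -/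

/-- A single sequence of shifts serves all points at once and respects the order of interior nodes,
so variation sums of `normTail T N` become limits of those of `tail T`. -/
theorem tendsto_shift_normTail (N : Normalisation) (p : RBar2) :
    Tendsto (fun n => ∑ σ, ∑ τ, N.weight p.1 p.2 σ τ * tail T (shift n σ p.1, shift n τ p.2))
      atTop (𝓝 (normTail T N p)) :=
  tendsto_finsetSum _ fun σ _ => tendsto_finsetSum _ fun τ _ =>
    (((tendsto_quadrantLimit T σ τ p).comp
      ((tendsto_shift σ p.1).prodMk (tendsto_shift τ p.2))).const_mul _)

theorem abs_normTail_le (N : Normalisation) (p : RBar2) : |normTail T N p| ≤ ‖T‖ := by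
  refine le_of_tendsto (tendsto_shift_normTail T N p).abs (Eventually.of_forall fun n => ?_)
  have := abs_sum_weight_sub_le N p.1 p.2 (L := fun σ τ => tail T (shift n σ p.1, shift n τ p.2))
    (C := 0) (ε := ‖T‖) (fun σ τ => by rw [sub_zero]; exact abs_tail_le T _)
  rwa [sub_zero] at this

/-- Convexity of the absolute value; it needs weights that are the same for all summands. -/
theorem sum_abs_le_of_tendsto {ι : Type*} {I : Finset ι} {W : Bool → Bool → ℝ}
    (hW : ∀ σ τ, 0 ≤ W σ τ) (hW1 : ∑ σ, ∑ τ, W σ τ = 1) {d : ℕ → Bool → Bool → ι → ℝ} {D : ι → ℝ}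
    {M : ℝ} (hd : ∀ n σ τ, ∑ i ∈ I, |d n σ τ i| ≤ M)
    (hD : ∀ i ∈ I, Tendsto (fun n => ∑ σ, ∑ τ, W σ τ * d n σ τ i) atTop (𝓝 (D i))) :
    ∑ i ∈ I, |D i| ≤ M := by
  refine le_of_tendsto (tendsto_finsetSum I fun i hi => (hD i hi).abs)
    (Eventually.of_forall fun n => ?_)
  calc _ ≤ ∑ i ∈ I, ∑ σ, ∑ τ, W σ τ * |d n σ τ i| := by
        refine Finset.sum_le_sum fun i _ => (Finset.abs_sum_le_sum_abs _ _).trans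
          (Finset.sum_le_sum fun σ _ => (Finset.abs_sum_le_sum_abs _ _).trans
            (Finset.sum_le_sum fun τ _ => ?_))
        rw [abs_mul, abs_of_nonneg (hW σ τ)]
    _ = ∑ σ, ∑ τ, W σ τ * ∑ i ∈ I, |d n σ τ i| := by
        rw [Finset.sum_comm]
        refine Finset.sum_congr rfl fun σ _ => ?_
        rw [Finset.sum_comm]
        simp only [Finset.mul_sum]
    _ ≤ ∑ σ, ∑ τ, W σ τ * M := Finset.sum_le_sum fun σ _ => Finset.sum_le_sum fun τ _ =>
        mul_le_mul_of_nonneg_left (hd n σ τ) (hW σ τ)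
    _ = M := by simp only [← Finset.sum_mul, hW1, one_mul]

/-- Supplies the common weights for `sum_abs_le_of_tendsto` as the node runs through the interior.
-/
theorem Normalisation.weight_right (N : Normalisation) (x : EReal) {y : EReal}
    (hy : y ∈ Set.Ioo (⊥ : EReal) ⊤) : N.weight x y = N.weight x 0 := by
  funext σ τ
  simp [Normalisation.weight, hy.1.ne', hy.2.ne]

theorem Normalisation.weight_left (N : Normalisation) (y : EReal) {x : EReal}
    (hx : x ∈ Set.Ioo (⊥ : EReal) ⊤) : N.weight x y = N.weight 0 y := by
  funext σ τ
  simp [Normalisation.weight, hx.1.ne', hx.2.ne]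

theorem Grid.mem_Ioo {s : Finset EReal} (G : Grid s) {i : ℕ} (h1 : 1 ≤ i) (h2 : i ≤ G.n) :
    G.u i ∈ Set.Ioo (⊥ : EReal) ⊤ := by
  rw [← G.zero, ← G.last]
  exact ⟨(G.lt_iff (by omega) (by omega)).2 h1, (G.lt_iff (by omega) le_rfl).2 (by omega)⟩

theorem Grid.shift_mono {s : Finset EReal} (G : Grid s) (n : ℕ) (σ : Bool) :
    MonotoneOn (fun i => shift n σ (G.u i)) (Set.Icc 1 G.n) := fun _ hi _ hj hij =>
  ContPrim.shift_mono n σ (G.mem_Ioo hi.1 hi.2) (G.mem_Ioo hj.1 hj.2) (G.mono hij)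

/-- As `tail T` vanishes for `x = ⊤`, the differences are, up to sign, increments over the disjoint
strips `(x, ⊤] × (v i, v (i + 1)]`. -/
theorem sum_abs_tail_sub_le₂ (x : EReal) {v : ℕ → EReal} {n : ℕ}
    (hv : MonotoneOn v (Set.Icc 1 n)) :
    ∑ i ∈ Finset.Ico 1 n, |tail T (x, v (i + 1)) - tail T (x, v i)| ≤ ‖T‖ := by
  have hm : ∀ i ∈ Finset.Ico 1 n, i ∈ Set.Icc 1 n ∧ i + 1 ∈ Set.Icc 1 n := fun i hi => by
    simp only [Finset.mem_Ico, Set.mem_Icc] at hi ⊢; omega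
  have hle : ∀ i ∈ Finset.Ico 1 n, v i ≤ v (i + 1) := fun i hi =>
    hv (hm i hi).1 (hm i hi).2 i.le_succ
  -- The minimum only makes `J i` an interval for every `i`; in the range of summation it is `v i`.
  let J : ℕ → NonemptyInterval RBar2 := fun i =>
    ⟨((x, min (v i) (v (i + 1))), (⊤, v (i + 1))), le_top, min_le_right _ _⟩
  have hJ : ∀ p, ∀ k ∈ Finset.Ico 1 n, p ∈ hopen (J k) → ∀ k' ∈ Finset.Ico 1 n,
      p ∈ hopen (J k') → k' = k := by
    intro p k hk hp k' hk' hp'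
    have h1 := hp.2
    have h2 := hp'.2
    simp only [J, min_eq_left (hle k hk), min_eq_left (hle k' hk')] at h1 h2
    exact index_eq_of_mem_Ioc hv (hm k' hk').1 (hm k' hk').2 (hm k hk).1 (hm k hk).2 h2 h1
  refine le_trans (le_of_eq (Finset.sum_congr rfl fun i hi => ?_)) (sum_abs_inc₂_tail_le T hJ)
  simp only [inc₂, J, min_eq_left (hle i hi), (tail_top T _).1]
  rw [abs_sub_comm]
  congr 1; ring

theorem sum_abs_tail_sub_le₁ (y : EReal) {v : ℕ → EReal} {n : ℕ}
    (hv : MonotoneOn v (Set.Icc 1 n)) :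
    ∑ i ∈ Finset.Ico 1 n, |tail T (v (i + 1), y) - tail T (v i, y)| ≤ ‖T‖ := by
  have hm : ∀ i ∈ Finset.Ico 1 n, i ∈ Set.Icc 1 n ∧ i + 1 ∈ Set.Icc 1 n := fun i hi => by
    simp only [Finset.mem_Ico, Set.mem_Icc] at hi ⊢; omega
  have hle : ∀ i ∈ Finset.Ico 1 n, v i ≤ v (i + 1) := fun i hi =>
    hv (hm i hi).1 (hm i hi).2 i.le_succ
  let J : ℕ → NonemptyInterval RBar2 := fun i =>
    ⟨((min (v i) (v (i + 1)), y), (v (i + 1), ⊤)), min_le_right _ _, le_top⟩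
  have hJ : ∀ p, ∀ k ∈ Finset.Ico 1 n, p ∈ hopen (J k) → ∀ k' ∈ Finset.Ico 1 n,
      p ∈ hopen (J k') → k' = k := by
    intro p k hk hp k' hk' hp'
    have h1 := hp.1
    have h2 := hp'.1
    simp only [J, min_eq_left (hle k hk), min_eq_left (hle k' hk')] at h1 h2
    exact index_eq_of_mem_Ioc hv (hm k' hk').1 (hm k' hk').2 (hm k hk).1 (hm k hk).2 h2 h1
  refine le_trans (le_of_eq (Finset.sum_congr rfl fun i hi => ?_)) (sum_abs_inc₂_tail_le T hJ)
  simp only [inc₂, J, min_eq_left (hle i hi), (tail_top T _).2]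
  rw [abs_sub_comm]
  congr 1; ring

theorem eVariationOn_le_of_grid {k : EReal → ℝ} {C : ℝ≥0∞}
    (h : ∀ (s : Finset EReal) (G : Grid s),
      ∑ i ∈ Finset.range (G.n + 1), ‖k (G.u (i + 1)) - k (G.u i)‖ₑ ≤ C) :
    eVariationOn k Set.univ ≤ C := by
  classical
  refine iSup_le fun ⟨n, u, hu, _⟩ => ?_
  let s := (Finset.range (n + 1)).image u
  let J : ℕ → NonemptyInterval EReal := fun i => ⟨(u i, u (i + 1)), hu i.le_succ⟩
  refine le_trans ?_ (h s (theGrid s))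
  have hs : ∀ i ≤ n, u i ∈ s := fun i hi =>
    Finset.mem_image_of_mem _ (Finset.mem_range.2 (by omega))
  refine le_trans (le_of_eq ?_) (sum_enorm_le_of_atoms (Finset.range n) _ (fun i => hopen₁ (J i))
    (fun i => inc₁ k (J i)) _ (fun i => (theGrid s).u (i + 1)) (fun i hi => ?_) ?_)
  · simp only [edist_eq_enorm_sub]
    rfl
  · have := Finset.mem_range.1 hi
    exact (theGrid s).sum_ite_inc₁ k (J i) (hs _ (by omega)) (hs _ (by omega))
  · intro c _ i _ h1 j _ h2
    exact index_eq_of_mem_Ioc (S := Set.univ) (hu.monotoneOn _) trivial trivial trivial trivial h2 h1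

/-- The grid through all corners of a division refines it, and splitting an increment can only
increase the sum of absolute values. -/
theorem V₁₂_le_of_grid {g : RBar2 → ℝ} {C : ℝ≥0∞}
    (h : ∀ (s : Finset EReal) (G : Grid s), ∑ q ∈ G.idx, ‖inc₂ g (G.box q)‖ₑ ≤ C) :
    V₁₂ g ≤ C := by
  classical
  refine iSup₂_le fun D hD => ?_
  let s := D.image (fun J => J.fst.1) ∪ D.image (fun J => J.fst.2) ∪
    D.image (fun J => J.snd.1) ∪ D.image (fun J => J.snd.2)
  refine le_trans ?_ (h s (theGrid s))
  refine sum_enorm_le_of_atoms D _ hopen _ _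
    (fun q => ((theGrid s).u (q.1 + 1), (theGrid s).u (q.2 + 1))) (fun J hJ => ?_) ?_
  · refine (theGrid s).sum_ite_inc₂ g J ?_ ?_ ?_ ?_ <;>
      simp only [s, Finset.mem_union, Finset.mem_image]
    · exact .inl (.inl (.inl ⟨J, hJ, rfl⟩))
    · exact .inl (.inl (.inr ⟨J, hJ, rfl⟩))
    · exact .inl (.inr ⟨J, hJ, rfl⟩)
    · exact .inr ⟨J, hJ, rfl⟩
  · intro c _ J hJ h1 J' hJ' h2
    exact eq_of_mem_hopen (J := id) hD.1 hJ' hJ h2 h1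

/-- For `n = 0` the single term is counted twice on the right, which nonnegativity allows. -/
theorem sum_range_le_of_middle {f : ℕ → ℝ} (hf : ∀ i, 0 ≤ f i) (n : ℕ) :
    ∑ i ∈ Finset.range (n + 1), f i ≤ ∑ i ∈ Finset.Ico 1 n, f i + f 0 + f n := by
  classical
  have h : ∀ i ∈ Finset.range (n + 1), f i ≤
      (if i ∈ Finset.Ico 1 n then f i else 0) + (if i = 0 then f i else 0) +
      (if i = n then f i else 0) := by
    intro i hi
    have hi := Finset.mem_range.1 hi
    have h0 := hf i
    by_cases h1 : i = 0
    · simp only [h1, if_true] at h0 ⊢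
      split_ifs <;> linarith
    by_cases h2 : i = n
    · simp only [h2, if_true] at h0 ⊢
      split_ifs <;> linarith
    · have : i ∈ Finset.Ico 1 n := Finset.mem_Ico.2 ⟨by omega, by omega⟩
      simp [this, h1, h2]
  refine (Finset.sum_le_sum h).trans ?_
  rw [Finset.sum_add_distrib, Finset.sum_add_distrib, Finset.sum_ite_eq', Finset.sum_ite_eq',
    ← Finset.sum_filter]
  have : (Finset.range (n + 1)).filter (· ∈ Finset.Ico 1 n) = Finset.Ico 1 n := by
    ext i; simp only [Finset.mem_filter, Finset.mem_range, Finset.mem_Ico]; omega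
  rw [this]
  simp

/-- The interior part contributes `M`, and each of the two end intervals at most `2 * M`. -/
theorem eVariationOn_le_of_middle {k : EReal → ℝ} {M : ℝ} (hk : ∀ x, |k x| ≤ M)
    (h : ∀ (s : Finset EReal) (G : Grid s),
      ∑ i ∈ Finset.Ico 1 G.n, |k (G.u (i + 1)) - k (G.u i)| ≤ M) :
    eVariationOn k Set.univ ≤ ENNReal.ofReal (5 * M) := by
  refine eVariationOn_le_of_grid fun s G => sum_enorm_le_ofReal ?_
  refine (sum_range_le_of_middle (fun i => abs_nonneg _) G.n).trans ?_
  have h1 : ∀ i, |k (G.u (i + 1)) - k (G.u i)| ≤ 2 * M := fun i =>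
    (abs_sub _ _).trans (by linarith [hk (G.u (i + 1)), hk (G.u i)])
  linarith [h s G, h1 0, h1 G.n]

theorem V₂_normTail_le (N : Normalisation) (x : EReal) :
    V₂ (normTail T N) x ≤ ENNReal.ofReal (5 * ‖T‖) := by
  refine eVariationOn_le_of_middle (fun y => abs_normTail_le T N (x, y)) fun s G => ?_
  refine sum_abs_le_of_tendsto (N.weight_nonneg x 0) (N.sum_weight x 0)
    (d := fun n σ τ i => tail T (shift n σ x, shift n τ (G.u (i + 1))) -
      tail T (shift n σ x, shift n τ (G.u i)))
    (fun n σ τ => sum_abs_tail_sub_le₂ T (shift n σ x) (v := fun i => shift n τ (G.u i))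
      (G.shift_mono n τ)) fun i hi => ?_
  rw [Finset.mem_Ico] at hi
  have h1 := tendsto_shift_normTail T N (x, G.u (i + 1))
  have h2 := tendsto_shift_normTail T N (x, G.u i)
  simp only [N.weight_right x (G.mem_Ioo hi.1 hi.2.le)] at h2
  simp only [N.weight_right x (G.mem_Ioo (i := i + 1) (by omega) hi.2)] at h1
  refine (h1.sub h2).congr fun n => ?_
  simp only [mul_sub, Finset.sum_sub_distrib]

theorem V₁_normTail_le (N : Normalisation) (y : EReal) :
    V₁ (normTail T N) y ≤ ENNReal.ofReal (5 * ‖T‖) := by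
  refine eVariationOn_le_of_middle (fun x => abs_normTail_le T N (x, y)) fun s G => ?_
  refine sum_abs_le_of_tendsto (N.weight_nonneg 0 y) (N.sum_weight 0 y)
    (d := fun n σ τ i => tail T (shift n σ (G.u (i + 1)), shift n τ y) -
      tail T (shift n σ (G.u i), shift n τ y))
    (fun n σ τ => sum_abs_tail_sub_le₁ T (shift n τ y) (v := fun i => shift n σ (G.u i))
      (G.shift_mono n σ)) fun i hi => ?_
  rw [Finset.mem_Ico] at hi
  have h1 := tendsto_shift_normTail T N (G.u (i + 1), y)
  have h2 := tendsto_shift_normTail T N (G.u i, y)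
  simp only [N.weight_left y (G.mem_Ioo hi.1 hi.2.le)] at h2
  simp only [N.weight_left y (G.mem_Ioo (i := i + 1) (by omega) hi.2)] at h1
  refine (h1.sub h2).congr fun n => ?_
  simp only [mul_sub, Finset.sum_sub_distrib]

/-- For cells with all nodes interior the weights are constant and the shifted cells remain
disjoint, so the bound for `tail T` passes to the limit without loss. -/
theorem sum_abs_inc₂_normTail_middle_le (N : Normalisation) {s : Finset EReal} (G : Grid s) :
    ∑ q ∈ Finset.Ico 1 G.n ×ˢ Finset.Ico 1 G.n, |inc₂ (normTail T N) (G.box q)| ≤ ‖T‖ := by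
  have hm : ∀ i ∈ Finset.Ico 1 G.n, i ∈ Set.Icc 1 G.n ∧ i + 1 ∈ Set.Icc 1 G.n := fun i hi => by
    simp only [Finset.mem_Ico, Set.mem_Icc] at hi ⊢; omega
  have hIoo : ∀ i ∈ Set.Icc 1 G.n, G.u i ∈ Set.Ioo (⊥ : EReal) ⊤ := fun i hi =>
    G.mem_Ioo hi.1 hi.2
  let d : ℕ → Bool → Bool → ℕ × ℕ → ℝ := fun n σ τ q =>
    tail T (shift n σ (G.u q.1), shift n τ (G.u q.2)) +
    tail T (shift n σ (G.u (q.1 + 1)), shift n τ (G.u (q.2 + 1))) -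
    tail T (shift n σ (G.u q.1), shift n τ (G.u (q.2 + 1))) -
    tail T (shift n σ (G.u (q.1 + 1)), shift n τ (G.u q.2))
  refine sum_abs_le_of_tendsto (N.weight_nonneg 0 0) (N.sum_weight 0 0) (d := d)
    (fun n σ τ => ?_) fun q hq => ?_
  · let a : ℕ → EReal := fun i => shift n σ (G.u i)
    let b : ℕ → EReal := fun i => shift n τ (G.u i)
    have ha : ∀ i ∈ Finset.Ico 1 G.n, a i ≤ a (i + 1) := fun i hi =>
      G.shift_mono n σ (hm i hi).1 (hm i hi).2 i.le_succ
    have hb : ∀ i ∈ Finset.Ico 1 G.n, b i ≤ b (i + 1) := fun i hi =>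
      G.shift_mono n τ (hm i hi).1 (hm i hi).2 i.le_succ
    let J : ℕ × ℕ → NonemptyInterval RBar2 := fun q =>
      ⟨((min (a q.1) (a (q.1 + 1)), min (b q.2) (b (q.2 + 1))), (a (q.1 + 1), b (q.2 + 1))),
        min_le_right _ _, min_le_right _ _⟩
    refine le_trans (le_of_eq (Finset.sum_congr rfl fun q hq => ?_))
      (sum_abs_inc₂_tail_le T (K := Finset.Ico 1 G.n ×ˢ Finset.Ico 1 G.n) (J := J) ?_)
    · obtain ⟨hq1, hq2⟩ := Finset.mem_product.1 hq
      simp only [inc₂, J, min_eq_left (ha _ hq1), min_eq_left (hb _ hq2), d, a, b]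
    · intro p q hq hp q' hq' hp'
      obtain ⟨hq1, hq2⟩ := Finset.mem_product.1 hq
      obtain ⟨hq1', hq2'⟩ := Finset.mem_product.1 hq'
      simp only [hopen, J, min_eq_left (ha _ hq1), min_eq_left (hb _ hq2)] at hp
      simp only [hopen, J, min_eq_left (ha _ hq1'), min_eq_left (hb _ hq2')] at hp'
      exact Prod.ext
        (index_eq_of_mem_Ioc (G.shift_mono n σ) (hm _ hq1').1 (hm _ hq1').2 (hm _ hq1).1
          (hm _ hq1).2 hp'.1 hp.1)
        (index_eq_of_mem_Ioc (G.shift_mono n τ) (hm _ hq2').1 (hm _ hq2').2 (hm _ hq2).1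
          (hm _ hq2).2 hp'.2 hp.2)
  · obtain ⟨hq1, hq2⟩ := Finset.mem_product.1 hq
    have key : ∀ i j, i ∈ Set.Icc 1 G.n → j ∈ Set.Icc 1 G.n →
        Tendsto (fun n => ∑ σ, ∑ τ, N.weight 0 0 σ τ *
          tail T (shift n σ (G.u i), shift n τ (G.u j))) atTop (𝓝 (normTail T N (G.u i, G.u j))) := by
      intro i j hi hj
      have := tendsto_shift_normTail T N (G.u i, G.u j)
      simpa only [N.weight_left _ (hIoo i hi), N.weight_right _ (hIoo j hj)] using this
    obtain ⟨i1, i2⟩ := hm _ hq1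
    obtain ⟨j1, j2⟩ := hm _ hq2
    refine ((((key _ _ i1 j1).add (key _ _ i2 j2)).sub (key _ _ i1 j2)).sub (key _ _ i2 j1)).congr
      fun n => ?_
    simp only [d, ← Finset.sum_add_distrib, ← Finset.sum_sub_distrib]
    exact Finset.sum_congr rfl fun σ _ => Finset.sum_congr rfl fun τ _ => by ring

/-- A row or column of cells costs at most two one-variable variations, hence `10 * ‖T‖`. The inner
cells give `1`, the two outer rows and two outer columns `40`. -/
theorem V₁₂_normTail_le (N : Normalisation) :
    V₁₂ (normTail T N) ≤ ENNReal.ofReal (41 * ‖T‖) := by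
  refine V₁₂_le_of_grid fun s G => sum_enorm_le_ofReal ?_
  set g := normTail T N
  have toReal_le : ∀ {a : ℝ≥0∞}, a ≤ ENNReal.ofReal (5 * ‖T‖) → a < ∞ ∧ a.toReal ≤ 5 * ‖T‖ :=
    fun h => ⟨h.trans_lt ENNReal.ofReal_lt_top, ENNReal.toReal_le_of_le_ofReal (by positivity) h⟩
  have hrow : ∀ i, ∑ j ∈ Finset.range (G.n + 1), |inc₂ g (G.box (i, j))| ≤ 10 * ‖T‖ := by
    intro i
    have h : ∀ x, ∑ j ∈ Finset.range (G.n + 1), |g (x, G.u (j + 1)) - g (x, G.u j)| ≤ 5 * ‖T‖ :=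
      fun x => (G.sum_abs_inc₁_le (k := fun y => g (x, y))
        (toReal_le (V₂_normTail_le T N x)).1).trans (toReal_le (V₂_normTail_le T N x)).2
    refine le_trans (Finset.sum_le_sum (g := fun j => |g (G.u (i + 1), G.u (j + 1)) -
      g (G.u (i + 1), G.u j)| + |g (G.u i, G.u (j + 1)) - g (G.u i, G.u j)|) fun j _ => ?_) ?_
    · refine le_trans (le_of_eq ?_) (abs_sub _ _)
      simp only [inc₂, cell]
      congr 1; ring
    · rw [Finset.sum_add_distrib]
      linarith [h (G.u (i + 1)), h (G.u i)]
  have hcol : ∀ j, ∑ i ∈ Finset.range (G.n + 1), |inc₂ g (G.box (i, j))| ≤ 10 * ‖T‖ := by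
    intro j
    have h : ∀ y, ∑ i ∈ Finset.range (G.n + 1), |g (G.u (i + 1), y) - g (G.u i, y)| ≤ 5 * ‖T‖ :=
      fun y => (G.sum_abs_inc₁_le (k := fun x => g (x, y))
        (toReal_le (V₁_normTail_le T N y)).1).trans (toReal_le (V₁_normTail_le T N y)).2
    refine le_trans (Finset.sum_le_sum (g := fun i => |g (G.u (i + 1), G.u (j + 1)) -
      g (G.u i, G.u (j + 1))| + |g (G.u (i + 1), G.u j) - g (G.u i, G.u j)|) fun i _ => ?_) ?_
    · refine le_trans (le_of_eq ?_) (abs_sub _ _)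
      simp only [inc₂, cell]
      congr 1; ring
    · rw [Finset.sum_add_distrib]
      linarith [h (G.u (j + 1)), h (G.u j)]
  rw [Finset.sum_product]
  have h1 := sum_range_le_of_middle (f := fun i => ∑ j ∈ Finset.range (G.n + 1),
    |inc₂ g (G.box (i, j))|) (fun i => Finset.sum_nonneg fun _ _ => abs_nonneg _) G.n
  have h2 : ∑ i ∈ Finset.Ico 1 G.n, ∑ j ∈ Finset.range (G.n + 1), |inc₂ g (G.box (i, j))| ≤
      ∑ i ∈ Finset.Ico 1 G.n, ∑ j ∈ Finset.Ico 1 G.n, |inc₂ g (G.box (i, j))| +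
      ∑ i ∈ Finset.Ico 1 G.n, |inc₂ g (G.box (i, 0))| +
      ∑ i ∈ Finset.Ico 1 G.n, |inc₂ g (G.box (i, G.n))| := by
    rw [← Finset.sum_add_distrib, ← Finset.sum_add_distrib]
    exact Finset.sum_le_sum fun i _ => sum_range_le_of_middle (fun j => abs_nonneg _) G.n
  have h3 : ∀ j, ∑ i ∈ Finset.Ico 1 G.n, |inc₂ g (G.box (i, j))| ≤ 10 * ‖T‖ := fun j =>
    (Finset.sum_le_sum_of_subset_of_nonneg (fun i hi => by
      simp only [Finset.mem_Ico, Finset.mem_range] at hi ⊢; omega)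
      fun _ _ _ => abs_nonneg _).trans (hcol j)
  have h4 := sum_abs_inc₂_normTail_middle_le T N G
  rw [Finset.sum_product] at h4
  linarith [hrow 0, hrow G.n, h3 0, h3 G.n]

/-- The constant is `1 + 5 + 5 + 41`, from the supremum, the two one-variable variations and `V₁₂`.
-/
theorem hkENorm_normTail_le (N : Normalisation) :
    hkENorm (normTail T N) ≤ ENNReal.ofReal (52 * ‖T‖) := by
  have h0 : (⨆ p, ‖normTail T N p‖ₑ) ≤ ENNReal.ofReal ‖T‖ := iSup_le fun p => by
    rw [Real.enorm_eq_ofReal_abs]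
    exact ENNReal.ofReal_le_ofReal (abs_normTail_le T N p)
  refine (add_le_add (add_le_add (add_le_add h0 (iSup_le (V₁_normTail_le T N)))
    (iSup_le (V₂_normTail_le T N))) (V₁₂_normTail_le T N)).trans_eq ?_
  rw [← ENNReal.ofReal_add, ← ENNReal.ofReal_add, ← ENNReal.ofReal_add]
  · congr 1; ring
  all_goals positivity

/-! ### The isomorphism. -/

/-- Each functional is represented by a normalised function with a bound for its norm. -/
theorem exists_toDual_eq (N : Normalisation) (S : StrongDual ℝ Ac) :
    ∃ g : NHKBV N, toDual N g = S ∧ ‖g‖ ≤ 52 * ‖S‖ := by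
  obtain ⟨T, hT, hTS⟩ := exists_extension S
  have hb := hkENorm_normTail_le T N
  have hg : IsHKBV (normTail T N) :=
    isHKBV_of_hkENorm_lt_top (hb.trans_lt ENNReal.ofReal_lt_top)
  refine ⟨⟨⟨normTail T N, hg⟩, isNormalisationOf_normTail T N⟩, ?_, ?_⟩
  · ext f
    rw [toDual_apply, ← hTS, ← pairing_tail]
    obtain ⟨D, hD, hD0⟩ := exists_dense_normTail_eq T N
    -- The difference vanishes on `D × D`, so it pairs to zero and `normTail T N` represents the
    -- same functional as `tail T`.
    have hk : IsHKBV (normTail T N + (-1 : ℝ) • tail T) :=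
      hkbvSubmodule.add_mem hg (hkbvSubmodule.smul_mem _ (isHKBV_tail T))
    have h0 := pairing_eq_zero_of_dense (primitive f) hk hD fun x hx y hy => by
      simp [hD0 x hx y hy]
    rw [pairing_add_right _ hg (hkbvSubmodule.smul_mem _ (isHKBV_tail T)),
      pairing_smul_right _ _ (isHKBV_tail T)] at h0
    change pairing _ (normTail T N) = _
    linarith
  · refine (ENNReal.toReal_le_of_le_ofReal (by positivity) hb).trans ?_
    exact mul_le_mul_of_nonneg_left hT (by norm_num)

/-- The isomorphism between the normalised functions and the dual space. -/
def dualEquiv (N : Normalisation) : NHKBV N ≃L[ℝ] StrongDual ℝ Ac :=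
  (LinearEquiv.ofBijective (toDual N).toLinearMap
    ⟨toDual_injective N, fun S =>
      (exists_toDual_eq N S).imp fun _ h => h.1⟩).toContinuousLinearEquivOfBounds
    -- By injectivity the preimage of `S` is the representative found in `exists_toDual_eq`, so its
    -- norm bound is a bound for the inverse.
    ‖toDual N‖ 52 (fun g => (toDual N).le_opNorm g) fun S => by
      obtain ⟨g, rfl, hg⟩ := exists_toDual_eq N S
      refine le_trans (le_of_eq (congrArg norm ?_)) hg
      exact LinearEquiv.ofBijective_symm_apply_apply _ g

end

end

end ContPrim

/-- The dual space of `Ac`: the map that sends a normalised function `g` of finite Hardy-Krause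
variation to the functional `f ↦ ∫∫ f g` (integral over the whole extended real plane) is an
isomorphism of normed spaces from the normalised functions onto the dual of `Ac`. -/
theorem proposition8p4 (N : ContPrim.Normalisation) :
    ∃ Λ : ContPrim.NHKBV N ≃L[ℝ] StrongDual ℝ ContPrim.Ac,
      ∀ (g : ContPrim.NHKBV N) (f : ContPrim.Ac),
        ContPrim.HasIntegralMul ⊤ f g.1 (Λ g f) :=
  ⟨ContPrim.dualEquiv N, fun g f => ContPrim.hasIntegralMul_pairing f g.1.2⟩
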